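/- **Setting.** Let $k$ be a number field of degree $l$ with $l_1$ real and $l_2$ complex places, $k_\infty=k\otimes_{\mathbb Q}\mathbb R\cong\mathbb R^{l_1}\times\mathbb C^{l_2}$, $G=\mathrm{SL}_2(k_\infty)$, $K_0=\mathrm{SO}_2(\mathbb R)^{l_1}\times \mathrm{SU}_2^{l_2}$. Let $\Gamma\le \mathrm{SL}_2(k)$ be an arithmetic subgroup (i.e. commensurable with $\mathrm{SL}_2(\mathcal O_k)$), embedded in $G$, and $Y=G/\Gamma$; for $E\subset G$ let $[E]$ be its image in $Y$. Fix a right invariant Riemannian metric $d_G$ on $G$, let $d_Y$ be the quotient metric on $Y$, and let $\mathrm{Lip}(\varphi)$ be the Lipschitz constant of $\varphi:Y\to\mathbb R$ with respect to $d_Y$. For $v\in k_\infty^2$ put $\|v\|_{k_\infty}=\prod_{i\le l_1}\|v_i\|\prod_{j\le l_2}\|v_{l_1+j}\|^2$, where $v_i$ are the components of $v$ in $\mathbb R^2$, $\mathbb C^2$ and $\|\cdot\|$ is the standard Euclidean norm; $e_1,e_2$ is the standard basis. For $\vec t\in k_\infty^\times$ let $h_{\vec t}=\mathrm{diag}(\vec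 t,\vec t^{-1})\in G$, $H=\{h_{\vec t}\}$, $h^\Delta_t=h_{(t,\dots,t)}$ for $t>0$, and $H^{(1)}=\{h_{\vec t}:\prod_{i\le l_1}|t_i|\prod_{j\le l_2}|t_{l_1+j}|^2=1\}$. Let $U=U^+$ and $U^-$ be the groups of upper and lower triangular unipotent matrices in $G$. For $\vec s\in(\mathbb R^+)^{l_1+l_2}$ let $a_{\vec s}\in G$ have the components $\frac12\begin{bmatrix}s_i+s_i^{-1}&s_i-s_i^{-1}\\ s_i-s_i^{-1}&s_i+s_i^{-1}\end{bmatrix}$, and let $A$ be the set of all $a_{\vec s}$. For $\varepsilon\in(0,1)$ let $H[\varepsilon]$ be the set of the $h_{e^{\vec t}}$ with $|t_i|<\varepsilon$ at the real places and $|\mathrm{Re}\,t_j|,|\mathrm{Im}\,t_j|<\varepsilon$ at the complex places. Fix $\varepsilon_0\in(0,1)$ such that the maps $H[\varepsilon_0]\times U^\star/(U^\star\cap\Gamma)\to Y$, $(h,u)\mapsto hu\Gamma$, are injective for $\star=+,-$. Let $\mathrm m_{H[\varepsilon_0]}$ be the restriction of a Haar measure of $H$ to $H[\varepsilon_0]$,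 normalized to a probability measure, and for $E=H^{(1)},U,U^-$ let $\mathrm m_{[E]}$ be the $E$-invariant probability measure on the compact set $[E]$. For $z\in[H^{(1)}]$ with a lift $h_z\in H^{(1)}$, let $\mathrm m_z$ be the image of $\mathrm m_{H[\varepsilon_0]}$ under $h\mapsto h.z$, and for $V=U,U^-$ let $\mathrm m_z^{V}$ be the image of $\mathrm m_{H[\varepsilon_0]}\otimes\mathrm m_{[V]}$ under $(h,y)\mapsto h_zh.y$ (it does not depend on the lift). Put $\mathrm m_{\varepsilon_0}=\int \mathrm m_z\,d\mathrm m_{[H^{(1)}]}(z)$ and $\mathrm m^V_{\varepsilon_0}=\int \mathrm m^V_z\,d\mathrm m_{[H^{(1)}]}(z)$. Let $\mathcal N_0^\circ=\{(x_1,x_2,a)\in\mathbb R^+\times\mathbb R^+\times A: x_1^{-1}x_2^{-1}=\|a.e_1\|_{k_\infty}\|a.e_2\|_{k_\infty}\}$. For $(x_1,x_2,a)\in\mathcal N_0^\circ$ there is a unique $t>0$ with $x_i=\|ah^\Delta_t.e_i\|_{k_\infty}^{-1}$ for $i=1,2$. For a $K_0$-invariant $\varphi\in C_c^\infty(Y)$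 define, with this $t$, $$f_\varphi(x_1,x_2,a)=\int\varphi(ah_t^\Delta.y)\,d\mathrm m_{\varepsilon_0}(y),$$ $$f_\varphi(x_1,0,\infty)=\int\varphi\big(h^\Delta_{x_1^{-1/l}}.y\big)\,d\mathrm m^{U}_{\varepsilon_0}(y),\qquad f_\varphi(0,x_2,\infty)=\int\varphi\big(h^\Delta_{x_2^{1/l}}.y\big)\,d\mathrm m^{U^-}_{\varepsilon_0}(y).$$ **Proposition 2.3.** There exist $\delta,\delta'\in(0,\tfrac12)$ such that for every compact subset $\mathscr C$ of $Y$ there exists $C>1$ such that for every $K_0$-invariant $\varphi\in C_c^\infty(Y)$ supported on $\mathscr C$ and every $(x_1,x_2,a)\in\mathcal N_0^\circ$, $$|f_\varphi(x_1,x_2,a)-f_\varphi(x_1,0,\infty)|\le C\,\mathrm{Lip}(\varphi)\,x_2^{\delta'}\quad\text{if }x_1>x_2^{\delta},$$ $$|f_\varphi(x_1,x_2,a)-f_\varphi(0,x_2,\infty)|\le C\,\mathrm{Lip}(\varphi)\,x_1^{\delta'}\quad\text{if }x_2>x_1^{\delta}.$$ -/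

import Mathlib

open NumberField Matrix MeasureTheory
open scoped ENNReal ContDiff MatrixGroups

namespace AffineQuadric

/-- The positive real numbers. -/
abbrev PosReal : Type := {x : ℝ // 0 < x}

section Groups

variable (K : Type*) [Field K] [NumberField K]

/-- `k_∞ = k ⊗ ℝ`, identified with `ℝ ^ l₁ × ℂ ^ l₂`. -/
abbrev KInf : Type _ := mixedEmbedding.mixedSpace K

/-- `G = SL₂(k_∞)`. -/
abbrev GInf : Type _ := Matrix.SpecialLinearGroup (Fin 2) (KInf K)

open scoped Classical in
/-- The Borel σ-algebra of the Lie group `k_∞ˣ`. -/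
instance : BorelSpace (KInf K)ˣ := by
  refine ⟨?_⟩
  have h : (Units.instTopologicalSpaceUnits : TopologicalSpace (KInf K)ˣ) =
      TopologicalSpace.induced Units.val inferInstance :=
    (Units.isOpenEmbedding_val (R := KInf K)).isInducing.eq_induced
  rw [h, borel_comap, ← BorelSpace.measurable_eq (α := KInf K)]
  rfl

variable {K}

/-- A subgroup of `SL₂(k)` is arithmetic if it is commensurable with `SL₂(𝓞_k)`. -/
def IsArithmetic (Γ : Subgroup SL(2, K)) : Prop :=
  Subgroup.Commensurable Γ (Matrix.SpecialLinearGroup.map (n := Fin 2) (algebraMap (𝓞 K) K)).range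

/-- The image of `Γ ≤ SL₂(k)` in `G = SL₂(k_∞)`. -/
noncomputable def latticeOf (Γ : Subgroup SL(2, K)) : Subgroup (GInf K) :=
  Γ.map (Matrix.SpecialLinearGroup.map (n := Fin 2) (mixedEmbedding K))

/-- `Y = G / Γ`. -/
abbrev Y (Γ : Subgroup SL(2, K)) : Type _ := GInf K ⧸ latticeOf Γ

noncomputable instance (Γ : Subgroup SL(2, K)) : MeasurableSpace (Y Γ) := borel _

instance (Γ : Subgroup SL(2, K)) : BorelSpace (Y Γ) := ⟨rfl⟩

/-- The image `[g]` of `g ∈ G` in `Y`. -/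
noncomputable def toY (Γ : Subgroup SL(2, K)) (g : GInf K) : Y Γ := (g : GInf K ⧸ latticeOf Γ)

/-- The image `[E]` of a subgroup `E` of `G` in `Y`. -/
noncomputable def imageY (Γ : Subgroup SL(2, K)) (E : Subgroup (GInf K)) : Set (Y Γ) :=
  toY Γ '' (E : Set (GInf K))

variable (K) in
/-- The maximal compact subgroup `K₀ = SO₂(ℝ) ^ l₁ × SU₂ ^ l₂` of `G` (the star operation of `k_∞` is
trivial at the real places and complex conjugation at the complex places). -/
def K0 : Subgroup (GInf K) where
  carrier := {g | (g : Matrix (Fin 2) (Fin 2) (KInf K)) ∈ Matrix.unitaryGroup (Fin 2) (KInf K)}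
  one_mem' := by
    change ((1 : GInf K) : Matrix (Fin 2) (Fin 2) (KInf K)) ∈ Matrix.unitaryGroup (Fin 2) (KInf K)
    rw [Matrix.SpecialLinearGroup.coe_one]
    exact one_mem _
  mul_mem' := by
    intro a b ha hb
    change ((a * b : GInf K) : Matrix (Fin 2) (Fin 2) (KInf K)) ∈ Matrix.unitaryGroup (Fin 2) (KInf K)
    rw [Matrix.SpecialLinearGroup.coe_mul]
    exact mul_mem ha hb
  inv_mem' := by
    intro a ha
    have h1 : (star (a : Matrix (Fin 2) (Fin 2) (KInf K))) * a.1 = 1 :=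
      (Matrix.mem_unitaryGroup_iff'.1 ha)
    have h2 : a.1 * ((a⁻¹ : GInf K) : Matrix (Fin 2) (Fin 2) (KInf K)) = 1 := by
      have := congrArg (fun g : GInf K => (g : Matrix (Fin 2) (Fin 2) (KInf K)))
        (mul_inv_cancel a)
      simpa only [Matrix.SpecialLinearGroup.coe_mul, Matrix.SpecialLinearGroup.coe_one] using this
    have h3 : ((a⁻¹ : GInf K) : Matrix (Fin 2) (Fin 2) (KInf K)) = star a.1 :=
      (left_inv_eq_right_inv h1 h2).symm
    change ((a⁻¹ : GInf K) : Matrix (Fin 2) (Fin 2) (KInf K)) ∈ Matrix.unitaryGroup (Fin 2) (KInf K)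
    rw [h3]
    exact Unitary.star_mem ha

/-- `h_t = diag(t, t⁻¹)` for `t ∈ k_∞ˣ`; its range is the group `H`. -/
noncomputable def hDiag : (KInf K)ˣ →* GInf K where
  toFun t := ⟨!![(t : KInf K), 0; 0, ((t⁻¹ : (KInf K)ˣ) : KInf K)], by
    rw [Matrix.det_fin_two_of]; simp⟩
  map_one' := by
    refine Matrix.SpecialLinearGroup.ext _ _ fun i j => ?_; fin_cases i <;> fin_cases j <;> simp
  map_mul' s t := by
    apply Subtype.ext
    change _ = !![(s : KInf K), 0; 0, ((s⁻¹ : (KInf K)ˣ) : KInf K)] *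
      !![(t : KInf K), 0; 0, ((t⁻¹ : (KInf K)ˣ) : KInf K)]
    rw [Matrix.mul_fin_two]
    simp [mul_comm]

/-- `h^Δ_t = h_(t, …, t)` for `t > 0`. -/
noncomputable def hDelta (t : PosReal) : GInf K :=
  hDiag (Units.map (algebraMap ℝ (KInf K)).toMonoidHom (Units.mk0 t.1 t.2.ne'))

variable (K) in
/-- `H^(1)`, the elements `h_t` of `H` with `Nm(t) = ∏_real |t_i| ∏_complex |t_j|² = 1`. -/
noncomputable def H1 : Subgroup (GInf K) where
  carrier := {g | ∃ t : (KInf K)ˣ, mixedEmbedding.norm (t : KInf K) = 1 ∧ hDiag t = g}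
  one_mem' := ⟨1, by simp, map_one _⟩
  mul_mem' := by
    rintro _ _ ⟨s, hs, rfl⟩ ⟨t, ht, rfl⟩
    exact ⟨s * t, by simp [hs, ht], map_mul _ _ _⟩
  inv_mem' := by
    rintro _ ⟨t, ht, rfl⟩
    refine ⟨t⁻¹, ?_, map_inv _ _⟩
    have h : mixedEmbedding.norm (t : KInf K) *
        mixedEmbedding.norm ((t⁻¹ : (KInf K)ˣ) : KInf K) = 1 := by
      rw [← map_mul, Units.mul_inv, map_one]
    rwa [ht, one_mul] at h

/-- The upper unipotent matrix `u_r = u⁺_r`. -/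
noncomputable def uUp (r : KInf K) : GInf K := ⟨!![1, r; 0, 1], by rw [Matrix.det_fin_two_of]; simp⟩

/-- The lower unipotent matrix `u⁻_r`. -/
noncomputable def uLow (r : KInf K) : GInf K := ⟨!![1, 0; r, 1], by rw [Matrix.det_fin_two_of]; simp⟩

variable (K) in
/-- `U = U⁺ = {u_r : r ∈ k_∞}`. -/
def UUp : Subgroup (GInf K) where
  carrier := Set.range uUp
  one_mem' := ⟨0, by refine Matrix.SpecialLinearGroup.ext _ _ fun i j => ?_; fin_cases i <;> fin_cases j <;> simp [uUp]⟩
  mul_mem' := by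
    rintro _ _ ⟨r, rfl⟩ ⟨s, rfl⟩
    exact ⟨r + s, by
      apply Subtype.ext
      change _ = !![1, r; 0, 1] * !![1, s; 0, 1]
      rw [Matrix.mul_fin_two]
      simp [uUp, add_comm]⟩
  inv_mem' := by
    rintro _ ⟨r, rfl⟩
    exact ⟨-r, by
      apply Subtype.ext
      change _ = Matrix.adjugate !![1, r; 0, 1]
      rw [Matrix.adjugate_fin_two_of]
      simp [uUp]⟩

variable (K) in
/-- `U⁻ = {u⁻_r : r ∈ k_∞}`. -/
def ULow : Subgroup (GInf K) where
  carrier := Set.range uLow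
  one_mem' := ⟨0, by refine Matrix.SpecialLinearGroup.ext _ _ fun i j => ?_; fin_cases i <;> fin_cases j <;> simp [uLow]⟩
  mul_mem' := by
    rintro _ _ ⟨r, rfl⟩ ⟨s, rfl⟩
    exact ⟨r + s, by
      apply Subtype.ext
      change _ = !![1, 0; r, 1] * !![1, 0; s, 1]
      rw [Matrix.mul_fin_two]
      simp [uLow]⟩
  inv_mem' := by
    rintro _ ⟨r, rfl⟩
    exact ⟨-r, by
      apply Subtype.ext
      change _ = Matrix.adjugate !![1, 0; r, 1]
      rw [Matrix.adjugate_fin_two_of]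
      simp [uLow]⟩

/-- A family of real numbers indexed by the infinite places, as an element of `k_∞`. -/
noncomputable def ofPlaces (x : InfinitePlace K → ℝ) : KInf K := (fun w => x w.1, fun w => ((x w.1 : ℝ) : ℂ))

/-- `a_s` with components `½ [s + s⁻¹, s - s⁻¹; s - s⁻¹, s + s⁻¹]`; these form the set `A`. -/
noncomputable def aMat (s : InfinitePlace K → PosReal) : GInf K :=
  ⟨!![ofPlaces fun w => ((s w : ℝ) + (s w : ℝ)⁻¹) / 2, ofPlaces fun w => ((s w : ℝ) - (s w : ℝ)⁻¹) / 2;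
      ofPlaces fun w => ((s w : ℝ) - (s w : ℝ)⁻¹) / 2, ofPlaces fun w => ((s w : ℝ) + (s w : ℝ)⁻¹) / 2],
    by
      have key : ∀ w, ((s w : ℝ) + (s w : ℝ)⁻¹) / 2 * (((s w : ℝ) + (s w : ℝ)⁻¹) / 2) -
          ((s w : ℝ) - (s w : ℝ)⁻¹) / 2 * (((s w : ℝ) - (s w : ℝ)⁻¹) / 2) = 1 := by
        intro w
        have := (s w).2.ne'
        field_simp
        ring
      rw [Matrix.det_fin_two_of]
      ext w
      · exact key w.1
      · have := congrArg (fun x : ℝ => (x : ℂ)) (key w.1)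
        simp only [Complex.ofReal_sub, Complex.ofReal_mul, Complex.ofReal_one] at this
        exact this⟩

/-- `‖v‖_{k_∞}` for `v ∈ k_∞²`: the product over the infinite places of the Euclidean norms of the
components, squared at the complex places. -/
noncomputable def vecNorm (v : Fin 2 → KInf K) : ℝ :=
  ∏ w : InfinitePlace K, √(∑ i, mixedEmbedding.normAtPlace w (v i) ^ 2) ^ w.mult

/-- `‖g.e₁‖_{k_∞}`. -/
noncomputable def norm1 (g : GInf K) : ℝ := vecNorm (g.1 *ᵥ ![1, 0])

/-- `‖g.e₂‖_{k_∞}`. -/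
noncomputable def norm2 (g : GInf K) : ℝ := vecNorm (g.1 *ᵥ ![0, 1])

end Groups

section Measures

variable {K : Type*} [Field K] [NumberField K]

variable (K) in
/-- `H[ε]`, as a subset of `k_∞ˣ ≅ H`: the `exp t` with `|t_i| < ε` at the real places, and real and
imaginary part of `t_j` less than `ε` in absolute value at the complex places. -/
def hBox (ε : ℝ) : Set (KInf K)ˣ :=
  {x | ∃ t : KInf K, (∀ w, |t.1 w| < ε) ∧ (∀ w, |(t.2 w).re| < ε ∧ |(t.2 w).im| < ε) ∧
    (x : KInf K) = (fun w => Real.exp (t.1 w), fun w => Complex.exp (t.2 w))}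

/-- The maps `H[ε] × U^±/(U^± ∩ Γ) → Y`, `(h, y) ↦ h.y`, are injective, where `U^±/(U^± ∩ Γ)` is identified
with `[U^±]`. -/
def BoxInjective (Γ : Subgroup SL(2, K)) (ε : ℝ) : Prop :=
  Set.InjOn (fun p : (KInf K)ˣ × Y Γ => hDiag p.1 • p.2) (hBox K ε ×ˢ imageY Γ (UUp K)) ∧
  Set.InjOn (fun p : (KInf K)ˣ × Y Γ => hDiag p.1 • p.2) (hBox K ε ×ˢ imageY Γ (ULow K))

/-- `μ` is an `E`-invariant probability measure on `Y` carried by `[E] = EΓ/Γ`. -/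
def IsHomogeneous (Γ : Subgroup SL(2, K)) (E : Subgroup (GInf K)) (μ : Measure (Y Γ)) : Prop :=
  IsProbabilityMeasure μ ∧ (∀ g ∈ E, μ.map (fun y => g • y) = μ) ∧ μ (imageY Γ E)ᶜ = 0

open Classical in
/-- `m_[E]`, the (unique) `E`-invariant probability measure on `EΓ/Γ`, as a measure on `Y`. It exists
for `E = H^(1), U, U⁻`, since then `EΓ/Γ` is compact. -/
noncomputable def homMeasure (Γ : Subgroup SL(2, K)) (E : Subgroup (GInf K)) : Measure (Y Γ) :=
  if h : ∃ μ, IsHomogeneous Γ E μ then h.choose else 0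

variable (K) in
/-- `m_{H[ε]}`: the Haar measure of `H ≅ k_∞ˣ` restricted to `H[ε]` and normalized to a probability
measure. -/
noncomputable def boxMeasure (ε : ℝ) : Measure (KInf K)ˣ :=
  ProbabilityTheory.cond Measure.haar (hBox K ε)

/-- `m_z`, the normalized Haar measure on `H[ε].z`. -/
noncomputable def mz (Γ : Subgroup SL(2, K)) (ε : ℝ) (z : Y Γ) : Measure (Y Γ) :=
  (boxMeasure K ε).map fun h => hDiag h • z

/-- `m_ε = ∫ m_z dm_[H^(1)](z)`. -/
noncomputable def mEps (Γ : Subgroup SL(2, K)) (ε : ℝ) : Measure (Y Γ) :=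
  (homMeasure Γ (H1 K)).bind (mz Γ ε)

open Classical in
/-- A lift to `H^(1)` of a point of `[H^(1)]` (and the value `1` at all other points of `Y`). -/
noncomputable def lift (Γ : Subgroup SL(2, K)) (z : Y Γ) : GInf K :=
  if h : ∃ g ∈ H1 K, toY Γ g = z then h.choose else 1

/-- `m_z^V` for `V = U` or `V = U⁻`: the image of `m_{H[ε]} ⊗ m_[V]` under `(h, y) ↦ h_z h.y`, where `h_z` is
a lift of `z` to `H^(1)`. -/
noncomputable def mzUnip (Γ : Subgroup SL(2, K)) (V : Subgroup (GInf K)) (ε : ℝ) (z : Y Γ) :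
    Measure (Y Γ) :=
  ((boxMeasure K ε).prod (homMeasure Γ V)).map fun p => (lift Γ z * hDiag p.1) • p.2

/-- `m_ε^V = ∫ m_z^V dm_[H^(1)](z)`. -/
noncomputable def mEpsUnip (Γ : Subgroup SL(2, K)) (V : Subgroup (GInf K)) (ε : ℝ) : Measure (Y Γ) :=
  (homMeasure Γ (H1 K)).bind (mzUnip Γ V ε)

variable (K) in
/-- `𝒩₀°`: the triples `(x₁, x₂, a_s)` with `x₁⁻¹ x₂⁻¹ = ‖a_s.e₁‖ ‖a_s.e₂‖`. -/
def N0 : Set (PosReal × PosReal × (InfinitePlace K → PosReal)) :=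
  {p | (p.1 : ℝ)⁻¹ * (p.2.1 : ℝ)⁻¹ = norm1 (aMat p.2.2) * norm2 (aMat p.2.2)}

lemma norm1_aMat_pos (s : InfinitePlace K → PosReal) : 0 < norm1 (aMat s) := by
  refine Finset.prod_pos fun w _ => pow_pos (Real.sqrt_pos.2 ?_) _
  rw [Fin.sum_univ_two]
  have hs : 0 < ((s w : ℝ) + (s w : ℝ)⁻¹) / 2 := by
    have := (s w).2
    positivity
  have h0 : 0 < mixedEmbedding.normAtPlace w
      (((aMat s).1 *ᵥ ![1, 0]) 0) := by
    have e : ((aMat s).1 *ᵥ ![1, 0]) 0 =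
        ofPlaces fun w => ((s w : ℝ) + (s w : ℝ)⁻¹) / 2 := by
      simp [aMat, Matrix.mulVec, dotProduct, Fin.sum_univ_two]
    rw [e]
    rcases w.isReal_or_isComplex with hw | hw
    · rw [mixedEmbedding.normAtPlace_apply_of_isReal hw]
      simpa only [ofPlaces, norm_pos_iff] using hs.ne'
    · rw [mixedEmbedding.normAtPlace_apply_of_isComplex hw]
      simpa only [ofPlaces, norm_pos_iff, ne_eq, Complex.ofReal_eq_zero] using hs.ne'
  positivity

/-- The `t > 0` with `x₁ = ‖a_s h^Δ_t.e₁‖⁻¹`, namely `t = (x₁ ‖a_s.e₁‖)^(-1/l)` with `l = [k : ℚ]`. -/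
noncomputable def tParam (x₁ : PosReal) (s : InfinitePlace K → PosReal) : PosReal :=
  ⟨((x₁ : ℝ) * norm1 (aMat s)) ^ (-(1 : ℝ) / Module.finrank ℚ K),
    Real.rpow_pos_of_pos (mul_pos x₁.2 (norm1_aMat_pos s)) _⟩

lemma vecNorm_smul (c : ℝ) (hc : 0 < c) (v : Fin 2 → KInf K) :
    vecNorm (fun i => v i * algebraMap ℝ (KInf K) c) = c ^ Module.finrank ℚ K * vecNorm v := by
  rw [← InfinitePlace.sum_mult_eq, ← Finset.prod_pow_eq_pow_sum, vecNorm, vecNorm,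
    ← Finset.prod_mul_distrib]
  refine Finset.prod_congr rfl fun w _ => ?_
  have hw : mixedEmbedding.normAtPlace w (algebraMap ℝ (KInf K) c) = c := by
    rcases w.isReal_or_isComplex with hw | hw
    · rw [mixedEmbedding.normAtPlace_apply_of_isReal hw]
      simp [abs_of_pos hc]
    · rw [mixedEmbedding.normAtPlace_apply_of_isComplex hw]
      simp [abs_of_pos hc]
  rw [← mul_pow]
  congr 1
  simp_rw [map_mul, hw, mul_pow, ← Finset.sum_mul]
  rw [Real.sqrt_mul' _ (sq_nonneg c), Real.sqrt_sq hc.le, mul_comm]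

lemma norm1_mul_hDelta (g : GInf K) (t : PosReal) :
    norm1 (g * hDelta t) = (t : ℝ) ^ Module.finrank ℚ K * norm1 g := by
  rw [norm1, norm1, ← vecNorm_smul _ t.2]
  congr 1
  funext i
  change ((g.1 * (hDelta t).1) *ᵥ ![1, 0]) i = _
  have e : ((hDelta t).1 : Matrix (Fin 2) (Fin 2) (KInf K)) 0 0 = algebraMap ℝ (KInf K) t := rfl
  have e0 : ((hDelta t).1 : Matrix (Fin 2) (Fin 2) (KInf K)) 1 0 = 0 := rfl
  simp only [Matrix.mulVec, dotProduct, Fin.sum_univ_two, Matrix.mul_apply, e, e0]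
  simp

lemma norm2_mul_hDelta (g : GInf K) (t : PosReal) :
    norm2 (g * hDelta t) = ((t : ℝ) ^ Module.finrank ℚ K)⁻¹ * norm2 g := by
  rw [norm2, norm2, ← inv_pow, ← vecNorm_smul _ (inv_pos.2 t.2)]
  congr 1
  funext i
  change ((g.1 * (hDelta t).1) *ᵥ ![0, 1]) i = _
  have e : ((hDelta t).1 : Matrix (Fin 2) (Fin 2) (KInf K)) 1 1 =
      algebraMap ℝ (KInf K) (t : ℝ)⁻¹ := rfl
  have e0 : ((hDelta t).1 : Matrix (Fin 2) (Fin 2) (KInf K)) 0 1 = 0 := rfl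
  simp only [Matrix.mulVec, dotProduct, Fin.sum_univ_two, Matrix.mul_apply, e, e0]
  simp

/-- On `𝒩₀°`, `tParam` is the unique `t > 0` with `x_i = ‖a_s h^Δ_t.e_i‖⁻¹` for `i = 1, 2`. -/
lemma tParam_spec {x₁ x₂ : PosReal} {s : InfinitePlace K → PosReal} (h : (x₁, x₂, s) ∈ N0 K)
    (t : PosReal) :
    ((x₁ : ℝ) = (norm1 (aMat s * hDelta t))⁻¹ ∧ (x₂ : ℝ) = (norm2 (aMat s * hDelta t))⁻¹) ↔
      t = tParam x₁ s := by
  have hl : Module.finrank ℚ K ≠ 0 := Module.finrank_pos.ne'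
  have hl' : (Module.finrank ℚ K : ℝ) ≠ 0 := by exact_mod_cast hl
  have h1 := norm1_aMat_pos s
  have hx1 := x₁.2
  have hx2 := x₂.2
  have h : (x₁ : ℝ)⁻¹ * (x₂ : ℝ)⁻¹ = norm1 (aMat s) * norm2 (aMat s) := h
  have key : ((tParam x₁ s : PosReal) : ℝ) ^ Module.finrank ℚ K =
      ((x₁ : ℝ) * norm1 (aMat s))⁻¹ := by
    change (((x₁ : ℝ) * norm1 (aMat s)) ^ (-(1 : ℝ) / Module.finrank ℚ K)) ^
      Module.finrank ℚ K = _
    rw [← Real.rpow_natCast, ← Real.rpow_mul (mul_pos hx1 h1).le, div_mul_cancel₀ _ hl',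
      Real.rpow_neg_one]
  rw [norm1_mul_hDelta, norm2_mul_hDelta]
  constructor
  · rintro ⟨e, -⟩
    apply Subtype.ext
    refine (pow_left_inj₀ t.2.le (tParam x₁ s).2.le hl).1 ?_
    rw [key, e]
    field_simp
  · rintro rfl
    rw [key]
    have h2 : norm2 (aMat s) = (x₁ : ℝ)⁻¹ * (x₂ : ℝ)⁻¹ * (norm1 (aMat s))⁻¹ := by
      rw [h]; field_simp
    rw [h2]
    constructor <;> field_simp

/-- `f_φ(x₁, x₂, a_s) = ∫ φ(a_s h^Δ_t.y) dm_ε(y)` on `𝒩₀°`, with `t` the unique positive number such that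
`x₁ = ‖a_s h^Δ_t.e₁‖⁻¹` and `x₂ = ‖a_s h^Δ_t.e₂‖⁻¹` (`x₂` is determined by `x₁` and `s` there). -/
noncomputable def f (Γ : Subgroup SL(2, K)) (ε : ℝ) (φ : Y Γ → ℝ) (x₁ _x₂ : PosReal)
    (s : InfinitePlace K → PosReal) : ℝ :=
  ∫ y, φ ((aMat s * hDelta (tParam x₁ s)) • y) ∂(mEps Γ ε)

/-- The boundary value `f_φ(x₁, 0, ∞)`. -/
noncomputable def fBdry1 (Γ : Subgroup SL(2, K)) (ε : ℝ) (φ : Y Γ → ℝ) (x₁ : PosReal) : ℝ :=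
  ∫ y, φ (hDelta (K := K) ⟨(x₁ : ℝ) ^ (-(1 : ℝ) / Module.finrank ℚ K), Real.rpow_pos_of_pos x₁.2 _⟩ • y)
    ∂(mEpsUnip Γ (UUp K) ε)

/-- The boundary value `f_φ(0, x₂, ∞)`. -/
noncomputable def fBdry2 (Γ : Subgroup SL(2, K)) (ε : ℝ) (φ : Y Γ → ℝ) (x₂ : PosReal) : ℝ :=
  ∫ y, φ (hDelta (K := K) ⟨(x₂ : ℝ) ^ ((1 : ℝ) / Module.finrank ℚ K), Real.rpow_pos_of_pos x₂.2 _⟩ • y)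
    ∂(mEpsUnip Γ (ULow K) ε)

end Measures

section Functions

variable {K : Type*} [Field K] [NumberField K]

/-- The entries of `g ∈ G`, a point of the real vector space `M₂(k_∞)`. -/
noncomputable def entries (g : GInf K) : Fin 2 → Fin 2 → KInf K := fun i j => g.1 i j

open scoped Classical in
/-- `φ` is smooth on `Y`: its lift to the closed submanifold `G` of `M₂(k_∞)` is the restriction of a smooth
function on `M₂(k_∞)`. -/
def IsSmooth {Γ : Subgroup SL(2, K)} (φ : Y Γ → ℝ) : Prop :=
  ∃ F : (Fin 2 → Fin 2 → KInf K) → ℝ, ContDiff ℝ ∞ F ∧ ∀ g : GInf K, F (entries g) = φ (toY Γ g)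

/-- `φ` is left `K₀`-invariant. -/
def IsK0Invariant {Γ : Subgroup SL(2, K)} (φ : Y Γ → ℝ) : Prop :=
  ∀ b ∈ K0 K, ∀ y, φ (b • y) = φ y

open scoped Classical in
/-- The velocity `γ'(s) γ(s)⁻¹` of a curve in `G`. -/
noncomputable def velocity (γ : ℝ → GInf K) (s : ℝ) : Matrix (Fin 2) (Fin 2) (KInf K) :=
  Matrix.of (deriv (fun r => entries (γ r)) s) * ((γ s)⁻¹ : GInf K).1

open scoped Classical in
/-- The distance on `G` of the right invariant Riemannian metric given by the inner product `B`:
the infimum of the lengths `∫₀¹ B(γ'γ⁻¹, γ'γ⁻¹)^(1/2)` of the `C¹` curves from `g` to `g'`. -/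
noncomputable def distG (B : LinearMap.BilinForm ℝ (Matrix (Fin 2) (Fin 2) (KInf K)))
    (g g' : GInf K) : ℝ≥0∞ :=
  ⨅ γ : {γ : ℝ → GInf K // ContDiff ℝ 1 (fun r => entries (γ r)) ∧ γ 0 = g ∧ γ 1 = g'},
    ∫⁻ s in Set.Icc (0 : ℝ) 1, ENNReal.ofReal √(B (velocity γ.1 s) (velocity γ.1 s))

/-- The quotient metric on `Y = G / Γ`. -/
noncomputable def distY {Γ : Subgroup SL(2, K)}
    (B : LinearMap.BilinForm ℝ (Matrix (Fin 2) (Fin 2) (KInf K))) (y y' : Y Γ) : ℝ≥0∞ :=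
  ⨅ p : {p : GInf K × GInf K // toY Γ p.1 = y ∧ toY Γ p.2 = y'}, distG B p.1.1 p.1.2

/-- `Lip(φ)`, the Lipschitz constant of `φ` for the quotient metric. -/
noncomputable def lipConst {Γ : Subgroup SL(2, K)}
    (B : LinearMap.BilinForm ℝ (Matrix (Fin 2) (Fin 2) (KInf K))) (φ : Y Γ → ℝ) : ℝ≥0∞ :=
  ⨆ (y : Y Γ) (y' : Y Γ), ENNReal.ofReal |φ y - φ y'| / distY B y y'

end Functions

end AffineQuadric

set_option linter.unusedSectionVars false

namespace AffineQuadric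

section Shift

variable {G : Type*} [CommGroup G] [MeasurableSpace G] [MeasurableMul G] {μ : Measure G}
  [μ.IsMulLeftInvariant]

/-- If the translates `g ^ j • F` are linearly ordered (`F ∩ g ^ i • F ⊆ g • F` for `1 ≤ i < n`), then the sets
`g ^ j • (F \ g • F)` are disjoint. Translates are written as preimages. -/
@[to_additive]
theorem measure_diff_mul_le (F V : Set G) (hF : MeasurableSet F) (g : G) (n : ℕ)
    (hV : ∀ j < n, ∀ x ∈ F, g ^ j * x ∈ V)
    (hconv : ∀ i < n, 1 ≤ i → ∀ x ∈ F, (g ^ i)⁻¹ * x ∈ F → g⁻¹ * x ∈ F) :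
    n * μ {x | x ∈ F ∧ g⁻¹ * x ∉ F} ≤ μ V := by
  set E : Set G := {x | x ∈ F ∧ g⁻¹ * x ∉ F} with hE
  have hEm : MeasurableSet E :=
    hF.inter ((measurable_const_mul g⁻¹ hF).compl)
  let T : ℕ → Set G := fun j => (fun x => (g ^ j)⁻¹ * x) ⁻¹' E
  have hTm : ∀ j, MeasurableSet (T j) := fun j => measurable_const_mul _ hEm
  have hTμ : ∀ j, μ (T j) = μ E := fun j => measure_preimage_mul μ _ _
  have key : ∀ i j, i < j → j < n → Disjoint (T i) (T j) := by
    intro i j hij hj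
    rw [Set.disjoint_left]
    rintro x ⟨h1, h2⟩ ⟨h3, -⟩
    apply h2
    refine hconv (j - i) (by omega) (by omega) _ h1 ?_
    have : (g ^ (j - i))⁻¹ * ((g ^ i)⁻¹ * x) = (g ^ j)⁻¹ * x := by
      rw [← mul_assoc, ← mul_inv, ← pow_add]
      congr 3; omega
    rw [this]
    exact h3
  have hd : Set.PairwiseDisjoint (↑(Finset.range n)) T := by
    intro i hi j hj hij
    simp only [Finset.coe_range, Set.mem_Iio] at hi hj
    rcases lt_or_gt_of_ne hij with h | h
    · exact key i j h hj
    · exact (key j i h hi).symm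
  have hsum := measure_biUnion_finset (μ := μ) hd fun j _ => hTm j
  simp only [hTμ, Finset.sum_const, Finset.card_range, nsmul_eq_mul] at hsum
  rw [← hsum]
  refine measure_mono ?_
  intro x hx
  simp only [Set.mem_iUnion, Finset.mem_range] at hx
  obtain ⟨j, hj, hx⟩ := hx
  have := hV j hj _ hx.1
  simpa using this

/-- Replacing `g x` by `g (h * x)` in an integral over `F` costs at most `sup |g|` times the measure of
the two differences of `F` and its translate. -/
@[to_additive]
theorem abs_setIntegral_mul_sub_le (F : Set G) (hF : MeasurableSet F) (hfin : μ F ≠ ⊤) (h : G) (g : G → ℝ)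
    (hg : Measurable g) (S : ℝ) (hS0 : 0 ≤ S) (hS : ∀ x, x ∈ F → |g x| ≤ S) (hS' : ∀ x ∈ F, |g (h * x)| ≤ S) (c : ℝ)
    (h1 : μ {x | x ∈ F ∧ h⁻¹ * x ∉ F} ≤ ENNReal.ofReal c)
    (h2 : μ {x | x ∈ F ∧ (h⁻¹)⁻¹ * x ∉ F} ≤ ENNReal.ofReal c) (hc : 0 ≤ c) :
    |(∫ x in F, g (h * x) ∂μ) - ∫ x in F, g x ∂μ| ≤ 2 * S * c := by
  set F' : Set G := (fun x => h⁻¹ * x) ⁻¹' F with hF'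
  have hF'm : MeasurableSet F' := measurable_const_mul _ hF
  have hF'μ : μ F' = μ F := measure_preimage_mul μ _ _
  have e1 : (∫ x in F, g (h * x) ∂μ) = ∫ x in F', g x ∂μ := by
    rw [← integral_indicator hF, ← integral_indicator hF'm, ← integral_mul_left_eq_self _ h⁻¹]
    congr 1
    funext x
    simp only [Set.indicator, mul_inv_cancel_left]
    rfl
  have bF' : ∀ x ∈ F', |g x| ≤ S := by
    intro x hx
    have := hS' _ hx
    simpa using this
  have d1 : μ (F \ F') ≤ ENNReal.ofReal c := h1
  have d2 : μ (F' \ F) ≤ ENNReal.ofReal c := by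
    refine le_trans (le_of_eq ?_) h2
    rw [← measure_preimage_mul μ h (F' \ F)]
    congr 1
    ext x
    simp [hF']
  have iF : IntegrableOn g F μ := by
    refine Measure.integrableOn_of_bounded (M := S) hfin hg.aestronglyMeasurable ?_
    filter_upwards [ae_restrict_mem hF] with x hx using hS x hx
  have iF' : IntegrableOn g F' μ := by
    refine Measure.integrableOn_of_bounded (M := S) (hF'μ ▸ hfin) hg.aestronglyMeasurable ?_
    filter_upwards [ae_restrict_mem hF'm] with x hx using bF' x hx
  have s1 := integral_inter_add_sdiff hF'm iF
  have s2 := integral_inter_add_sdiff hF iF'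
  rw [Set.inter_comm] at s2
  have b1 : |∫ x in F \ F', g x ∂μ| ≤ S * c := by
    have := norm_setIntegral_le_of_norm_le_const (μ := μ) (s := F \ F') (f := g) (C := S)
      (d1.trans_lt ENNReal.ofReal_lt_top) (fun x hx => hS x hx.1)
    refine this.trans (mul_le_mul_of_nonneg_left ?_ hS0)
    exact ENNReal.toReal_le_of_le_ofReal hc d1
  have b2 : |∫ x in F' \ F, g x ∂μ| ≤ S * c := by
    have := norm_setIntegral_le_of_norm_le_const (μ := μ) (s := F' \ F) (f := g) (C := S)
      (d2.trans_lt ENNReal.ofReal_lt_top) (fun x hx => bF' x hx.1)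
    refine this.trans (mul_le_mul_of_nonneg_left ?_ hS0)
    exact ENNReal.toReal_le_of_le_ofReal hc d2
  rw [e1, ← s1, ← s2]
  rw [abs_le] at *
  constructor <;> linarith [b1.1, b1.2, b2.1, b2.2]

@[to_additive]
theorem abs_integral_cond_mul_sub_le (F V : Set G) (hF : MeasurableSet F) (hFV : F ⊆ V) (hVfin : μ V ≠ ⊤)
    (h : G) (n : ℕ) (hn : 0 < n)
    (hV : ∀ h', h' = h ∨ h' = h⁻¹ → ∀ j < n, ∀ x ∈ F, h' ^ j * x ∈ V)
    (hconv : ∀ h', h' = h ∨ h' = h⁻¹ → ∀ i < n, 1 ≤ i → ∀ x ∈ F, (h' ^ i)⁻¹ * x ∈ F → h'⁻¹ * x ∈ F)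
    (g : G → ℝ) (hg : Measurable g) (S : ℝ) (hS0 : 0 ≤ S)
    (hS : ∀ x, x ∈ F → |g x| ≤ S) (hS' : ∀ x ∈ F, |g (h * x)| ≤ S) :
    |(∫ x, g (h * x) ∂(ProbabilityTheory.cond μ F)) - ∫ x, g x ∂(ProbabilityTheory.cond μ F)| ≤
      2 * S * ((μ V).toReal / n * (μ F).toReal⁻¹) := by
  have hfin : μ F ≠ ⊤ := ne_top_of_le_ne_top hVfin (measure_mono hFV)
  have hn' : (0 : ℝ) < n := by exact_mod_cast hn
  have hb : ∀ h', h' = h ∨ h' = h⁻¹ →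
      μ {x | x ∈ F ∧ h'⁻¹ * x ∉ F} ≤ ENNReal.ofReal ((μ V).toReal / n) := by
    intro h' hh'
    have := measure_diff_mul_le (μ := μ) F V hF h' n (hV h' hh') (hconv h' hh')
    rw [ENNReal.ofReal_div_of_pos hn', ENNReal.ofReal_toReal hVfin, ENNReal.ofReal_natCast,
      ENNReal.le_div_iff_mul_le (Or.inl (by exact_mod_cast hn.ne')) (Or.inl (ENNReal.natCast_ne_top n)),
      mul_comm]
    exact this
  have main := abs_setIntegral_mul_sub_le (μ := μ) F hF hfin h g hg S hS0 hS hS' ((μ V).toReal / n)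
    (hb h (Or.inl rfl)) (hb h⁻¹ (Or.inr rfl)) (by positivity)
  simp only [ProbabilityTheory.cond, integral_smul_measure, smul_eq_mul]
  rw [← mul_sub, abs_mul, ENNReal.toReal_inv, abs_of_nonneg (by positivity)]
  calc _ ≤ (μ F).toReal⁻¹ * (2 * S * ((μ V).toReal / n)) :=
        mul_le_mul_of_nonneg_left main (by positivity)
    _ = _ := by ring

end Shift

section Places

open scoped Classical
open NumberField.mixedEmbedding

variable {K : Type*} [Field K] [NumberField K]

theorem normAtPlace_le_norm (w : InfinitePlace K) (x : KInf K) : normAtPlace w x ≤ ‖x‖ := by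
  rw [norm_eq_sup'_normAtPlace]
  exact Finset.le_sup' (fun w => normAtPlace w x) (Finset.mem_univ w)

theorem norm_le_iff_normAtPlace {x : KInf K} {c : ℝ} : ‖x‖ ≤ c ↔ ∀ w, normAtPlace w x ≤ c := by
  rw [norm_eq_sup'_normAtPlace, Finset.sup'_le_iff]
  simp

theorem ext_normAtPlace {x y : KInf K} (h : ∀ w, normAtPlace w (x - y) = 0) : x = y :=
  sub_eq_zero.1 (forall_normAtPlace_eq_zero_iff.1 h)

theorem norm_mul_le_KInf (x y : KInf K) : ‖x * y‖ ≤ ‖x‖ * ‖y‖ := by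
  rw [norm_le_iff_normAtPlace]
  intro w
  rw [map_mul]
  exact mul_le_mul (normAtPlace_le_norm w x) (normAtPlace_le_norm w y) (normAtPlace_nonneg w y)
    (norm_nonneg x)

theorem isPlace_induction {p : InfinitePlace K → Prop} (h1 : ∀ w : {w : InfinitePlace K // w.IsReal}, p w)
    (h2 : ∀ w : {w : InfinitePlace K // w.IsComplex}, p w) (w : InfinitePlace K) : p w := by
  rcases w.isReal_or_isComplex with h | h
  · exact h1 ⟨w, h⟩
  · exact h2 ⟨w, h⟩

theorem normAtPlace_ofPlaces (x : InfinitePlace K → ℝ) (w : InfinitePlace K) :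
    normAtPlace w (ofPlaces x) = |x w| := by
  rcases w.isReal_or_isComplex with hw | hw
  · rw [normAtPlace_apply_of_isReal hw]; rfl
  · rw [normAtPlace_apply_of_isComplex hw]; simp [ofPlaces]

theorem ofPlaces_mul (x y : InfinitePlace K → ℝ) :
    ofPlaces (fun w => x w * y w) = ofPlaces x * ofPlaces y := by
  ext w <;> simp [ofPlaces]

theorem ofPlaces_add (x y : InfinitePlace K → ℝ) :
    ofPlaces (fun w => x w + y w) = ofPlaces x + ofPlaces y := by
  ext w <;> simp [ofPlaces]

theorem ofPlaces_neg (x : InfinitePlace K → ℝ) :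
    ofPlaces (fun w => - x w) = - ofPlaces x := by
  ext w <;> simp [ofPlaces]

theorem ofPlaces_one : ofPlaces (fun _ : InfinitePlace K => (1 : ℝ)) = 1 := by
  ext w <;> simp [ofPlaces]

theorem ofPlaces_const (c : ℝ) : ofPlaces (fun _ : InfinitePlace K => c) = algebraMap ℝ (KInf K) c := by
  ext w <;> simp [ofPlaces]

/-- The unit of `k_∞` with given nonzero real components. -/
noncomputable def unitOfPlaces (x : InfinitePlace K → ℝ) (hx : ∀ w, x w ≠ 0) : (KInf K)ˣ where
  val := ofPlaces x
  inv := ofPlaces fun w => (x w)⁻¹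
  val_inv := by rw [← ofPlaces_mul, ← ofPlaces_one]; congr 1; funext w; exact mul_inv_cancel₀ (hx w)
  inv_val := by rw [← ofPlaces_mul, ← ofPlaces_one]; congr 1; funext w; exact inv_mul_cancel₀ (hx w)

/-- The idempotent of `k_∞` that projects to the place `w`. -/
noncomputable def placeIdem (w : InfinitePlace K) : KInf K := ofPlaces (Pi.single w 1)

theorem normAtPlace_placeIdem_self (w : InfinitePlace K) : normAtPlace w (placeIdem w) = 1 := by
  simp [placeIdem, normAtPlace_ofPlaces]

theorem normAtPlace_placeIdem_of_ne {w w' : InfinitePlace K} (h : w' ≠ w) :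
    normAtPlace w' (placeIdem w) = 0 := by
  simp [placeIdem, normAtPlace_ofPlaces, h]

theorem norm_placeIdem_mul (w : InfinitePlace K) (x : KInf K) :
    ‖placeIdem w * x‖ ≤ normAtPlace w x := by
  rw [norm_le_iff_normAtPlace]
  intro w'
  rw [map_mul]
  rcases eq_or_ne w' w with rfl | h
  · rw [normAtPlace_placeIdem_self, one_mul]
  · rw [normAtPlace_placeIdem_of_ne h, zero_mul]; exact normAtPlace_nonneg _ _

theorem norm_placeIdem_mul_sub_le (w : InfinitePlace K) (x : KInf K) (c : ℝ) (hc : 0 ≤ c)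
    (h : ∀ w', w' ≠ w → normAtPlace w' x ≤ c) : ‖placeIdem w * x - x‖ ≤ c := by
  have e : placeIdem w * x - x = (placeIdem w - 1) * x := by ring
  rw [norm_le_iff_normAtPlace]
  intro w'
  rw [e, map_mul]
  have e2 : (placeIdem w - 1 : KInf K) = ofPlaces fun v => (Pi.single w (1:ℝ) : InfinitePlace K → ℝ) v + (- 1) := by
    rw [ofPlaces_add, ofPlaces_neg, ofPlaces_one, placeIdem]; ring
  rw [e2, normAtPlace_ofPlaces]
  rcases eq_or_ne w' w with rfl | hw
  · simpa using hc
  · simpa [hw] using h w' hw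

theorem placeIdem_mul_self (w : InfinitePlace K) : (placeIdem w * placeIdem w : KInf K) = placeIdem w := by
  rw [placeIdem, ← ofPlaces_mul]
  congr 1
  funext v
  rcases eq_or_ne v w with rfl | h
  · simp
  · simp [h]

theorem normAtPlace_unit_ne_zero (w : InfinitePlace K) (x : (KInf K)ˣ) : normAtPlace w (x : KInf K) ≠ 0 := by
  intro h
  have := map_mul (normAtPlace w) (x : KInf K) ((x⁻¹ : (KInf K)ˣ) : KInf K)
  rw [Units.mul_inv, map_one, h, zero_mul] at this
  exact one_ne_zero this

theorem normAtPlace_unit_pos (w : InfinitePlace K) (x : (KInf K)ˣ) : 0 < normAtPlace w (x : KInf K) :=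
  (normAtPlace_nonneg _ _).lt_of_ne (normAtPlace_unit_ne_zero w x).symm

theorem normAtPlace_unit_inv (w : InfinitePlace K) (x : (KInf K)ˣ) :
    normAtPlace w ((x⁻¹ : (KInf K)ˣ) : KInf K) = (normAtPlace w (x : KInf K))⁻¹ := by
  have := map_mul (normAtPlace w) (x : KInf K) ((x⁻¹ : (KInf K)ˣ) : KInf K)
  rw [Units.mul_inv, map_one] at this
  exact eq_inv_of_mul_eq_one_right this.symm

theorem normAtPlace_unit_zpow (w : InfinitePlace K) (x : (KInf K)ˣ) (m : ℤ) :
    normAtPlace w ((x ^ m : (KInf K)ˣ) : KInf K) = (normAtPlace w (x : KInf K)) ^ m := by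
  cases m with
  | ofNat n => simp
  | negSucc n => rw [zpow_negSucc, zpow_negSucc, normAtPlace_unit_inv]; simp

theorem normAtPlace_eq_zero_of_ne_placeIdem {w w' : InfinitePlace K} (h : w' ≠ w) (x : KInf K) :
    normAtPlace w' (placeIdem w * x) = 0 := by
  rw [map_mul, normAtPlace_placeIdem_of_ne h, zero_mul]

theorem normAtPlace_algebraMap (w : InfinitePlace K) (c : ℝ) :
    normAtPlace w (algebraMap ℝ (KInf K) c) = |c| := by
  rw [← ofPlaces_const, normAtPlace_ofPlaces]

end Places

section Exponential

open scoped Classical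
open NumberField.mixedEmbedding

variable {K : Type*} [Field K] [NumberField K]

/-- The exponential map `k_∞ → k_∞ˣ`. -/
noncomputable def expU (t : KInf K) : (KInf K)ˣ where
  val := (fun w => Real.exp (t.1 w), fun w => Complex.exp (t.2 w))
  inv := (fun w => Real.exp (-t.1 w), fun w => Complex.exp (-t.2 w))
  val_inv := by ext w <;> simp [← Real.exp_add, ← Complex.exp_add]
  inv_val := by ext w <;> simp [← Real.exp_add, ← Complex.exp_add]

theorem expU_add (s t : KInf K) : expU (s + t) = expU s * expU t := by
  ext w <;> simp [expU, Real.exp_add, Complex.exp_add]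

theorem expU_zero : expU (0 : KInf K) = 1 := by
  ext w <;> simp [expU]

theorem expU_neg (t : KInf K) : expU (-t) = (expU t)⁻¹ := by
  rw [eq_inv_iff_mul_eq_one, ← expU_add, neg_add_cancel, expU_zero]

theorem expU_nsmul (n : ℕ) (t : KInf K) : expU (n • t) = expU t ^ n := by
  induction n with
  | zero => simp [expU_zero]
  | succ n ih => rw [succ_nsmul, expU_add, ih, pow_succ]

theorem expU_zsmul (m : ℤ) (t : KInf K) : expU (m • t) = expU t ^ m := by
  cases m with
  | ofNat n => simpa using expU_nsmul n t
  | negSucc n => rw [negSucc_zsmul, zpow_negSucc, expU_neg, expU_nsmul]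

theorem continuous_expU : Continuous (expU : KInf K → (KInf K)ˣ) := by
  rw [Units.continuous_iff]
  constructor
  · change Continuous fun t : KInf K => ((fun w => Real.exp (t.1 w), fun w => Complex.exp (t.2 w)) : KInf K)
    fun_prop
  · change Continuous fun t : KInf K => ((fun w => Real.exp (-t.1 w), fun w => Complex.exp (-t.2 w)) : KInf K)
    fun_prop

theorem normAtPlace_expU_sub_one_sub_le (t : KInf K) (ht : ‖t‖ ≤ 1) (w : InfinitePlace K) :
    normAtPlace w ((expU t : KInf K) - 1 - t) ≤ normAtPlace w t ^ 2 := by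
  have h := (normAtPlace_le_norm w t).trans ht
  rcases w.isReal_or_isComplex with hw | hw
  · rw [normAtPlace_apply_of_isReal hw] at h ⊢
    rw [normAtPlace_apply_of_isReal hw, Real.norm_eq_abs, Real.norm_eq_abs, sq_abs]
    exact Real.abs_exp_sub_one_sub_id_le h
  · rw [normAtPlace_apply_of_isComplex hw] at h ⊢
    rw [normAtPlace_apply_of_isComplex hw]
    exact Complex.norm_exp_sub_one_sub_id_le h

/-- The open box in `k_∞` whose exponential is `H[ε]`. -/
def cube (K : Type*) [Field K] [NumberField K] (ε : ℝ) : Set (KInf K) :=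
  {t | (∀ w, |t.1 w| < ε) ∧ ∀ w, |(t.2 w).re| < ε ∧ |(t.2 w).im| < ε}

theorem hBox_eq_image (ε : ℝ) : hBox K ε = expU '' cube K ε := by
  ext x
  constructor
  · rintro ⟨t, h1, h2, h3⟩
    exact ⟨t, ⟨h1, h2⟩, Units.ext h3.symm⟩
  · rintro ⟨t, ⟨h1, h2⟩, rfl⟩
    exact ⟨t, h1, h2, rfl⟩

theorem mem_cube_of_norm_lt {t : KInf K} {ε : ℝ} (h : ‖t‖ < ε) : t ∈ cube K ε := by
  constructor
  · intro w
    have := (normAtPlace_le_norm w.1 t).trans_lt h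
    rwa [normAtPlace_apply_of_isReal w.2] at this
  · intro w
    have := (normAtPlace_le_norm w.1 t).trans_lt h
    rw [normAtPlace_apply_of_isComplex w.2] at this
    exact ⟨(Complex.abs_re_le_norm _).trans_lt this, (Complex.abs_im_le_norm _).trans_lt this⟩

theorem cube_add {s t : KInf K} {a b : ℝ} (hs : s ∈ cube K a) (ht : t ∈ cube K b) : s + t ∈ cube K (a + b) :=
  ⟨fun w => (abs_add_le _ _).trans_lt (add_lt_add (hs.1 w) (ht.1 w)), fun w =>
    ⟨(abs_add_le _ _).trans_lt (add_lt_add (hs.2 w).1 (ht.2 w).1),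
      (abs_add_le _ _).trans_lt (add_lt_add (hs.2 w).2 (ht.2 w).2)⟩⟩

theorem cube_mono {a b : ℝ} (h : a ≤ b) : cube K a ⊆ cube K b := fun _ ht =>
  ⟨fun w => (ht.1 w).trans_le h, fun w => ⟨(ht.2 w).1.trans_le h, (ht.2 w).2.trans_le h⟩⟩

theorem hBox_mono {a b : ℝ} (h : a ≤ b) : hBox K a ⊆ hBox K b := by
  rw [hBox_eq_image, hBox_eq_image]
  exact Set.image_mono (cube_mono h)

theorem convex_cube (ε : ℝ) : Convex ℝ (cube K ε) := by
  intro s hs t ht a b ha hb hab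
  have key : ∀ x y : ℝ, |x| < ε → |y| < ε → |a * x + b * y| < ε := by
    intro x y hx hy
    have := (convex_ball (0 : ℝ) ε) (x := x) (by simpa using hx) (y := y) (by simpa using hy) ha hb hab
    simpa using this
  exact ⟨fun w => key _ _ (hs.1 w) (ht.1 w), fun w =>
    ⟨by simpa using key _ _ (hs.2 w).1 (ht.2 w).1, by simpa using key _ _ (hs.2 w).2 (ht.2 w).2⟩⟩

theorem isOpen_cube (ε : ℝ) : IsOpen (cube K ε) := by
  have : cube K ε = (⋂ w, {t : KInf K | |t.1 w| < ε}) ∩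
      ⋂ w, ({t : KInf K | |(t.2 w).re| < ε} ∩ {t : KInf K | |(t.2 w).im| < ε}) := by
    ext t; simp [cube]
  rw [this]
  refine IsOpen.inter (isOpen_iInter_of_finite fun w => ?_) (isOpen_iInter_of_finite fun w => IsOpen.inter ?_ ?_)
  · exact isOpen_lt (by fun_prop) continuous_const
  · exact isOpen_lt (by fun_prop) continuous_const
  · exact isOpen_lt (by fun_prop) continuous_const

theorem injOn_expU : Set.InjOn expU (cube K 3) := by
  intro s hs t ht h
  have h' : (expU s : KInf K) = expU t := by rw [h]
  have h1 : (fun w => Real.exp (s.1 w)) = fun w => Real.exp (t.1 w) := congrArg Prod.fst h'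
  have h2 : (fun w => Complex.exp (s.2 w)) = fun w => Complex.exp (t.2 w) := congrArg Prod.snd h'
  have hpi := Real.pi_gt_three
  ext w
  · exact Real.exp_injective (congrFun h1 w)
  · have a := abs_lt.1 (hs.2 w).2
    have b := abs_lt.1 (ht.2 w).2
    exact Complex.exp_inj_of_neg_pi_lt_of_le_pi (by linarith) (by linarith) (by linarith) (by linarith)
      (congrFun h2 w)

theorem cube_subset_closedBall (ε : ℝ) : cube K ε ⊆ Metric.closedBall 0 (2 * ε) := by
  intro t ht
  rw [mem_closedBall_zero_iff, norm_le_iff_normAtPlace]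
  refine isPlace_induction ?_ ?_
  · intro w
    rw [normAtPlace_apply_of_isReal w.2]
    have := ht.1 w
    rw [Real.norm_eq_abs]
    linarith [abs_nonneg (t.1 w)]
  · intro w
    rw [normAtPlace_apply_of_isComplex w.2]
    have := ht.2 w
    have h2 := Complex.norm_le_abs_re_add_abs_im (t.2 w)
    change ‖t.2 w‖ ≤ _
    linarith [this.1, this.2]

theorem haar_hBox_lt_top (ε : ℝ) : (Measure.haar : Measure (KInf K)ˣ) (hBox K ε) < ⊤ := by
  refine (measure_mono ?_).trans_lt
    ((isCompact_closedBall (0 : KInf K) (2 * ε)).image continuous_expU).measure_lt_top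
  rw [hBox_eq_image]
  exact Set.image_mono (cube_subset_closedBall ε)

theorem measurableSet_hBox {ε : ℝ} (hε : ε ≤ 3) : MeasurableSet (hBox K ε) := by
  rw [hBox_eq_image]
  exact (isOpen_cube ε).measurableSet.image_of_continuousOn_injOn continuous_expU.continuousOn
    (injOn_expU.mono (cube_mono hε))

theorem normAtPlace_hBox {η : (KInf K)ˣ} {ε : ℝ} (hη : η ∈ hBox K ε) (w : InfinitePlace K) :
    normAtPlace w (η : KInf K) ≤ Real.exp ε ∧ Real.exp (-ε) ≤ normAtPlace w (η : KInf K) := by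
  rw [hBox_eq_image] at hη
  obtain ⟨t, ht, rfl⟩ := hη
  rcases w.isReal_or_isComplex with hw | hw
  · rw [normAtPlace_apply_of_isReal hw]
    have := abs_lt.1 (ht.1 ⟨w, hw⟩)
    change ‖Real.exp (t.1 ⟨w, hw⟩)‖ ≤ _ ∧ _ ≤ ‖Real.exp (t.1 ⟨w, hw⟩)‖
    rw [Real.norm_eq_abs, Real.abs_exp]
    exact ⟨Real.exp_le_exp.2 this.2.le, Real.exp_le_exp.2 this.1.le⟩
  · rw [normAtPlace_apply_of_isComplex hw]
    have := abs_lt.1 (ht.2 ⟨w, hw⟩).1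
    change ‖Complex.exp (t.2 ⟨w, hw⟩)‖ ≤ _ ∧ _ ≤ ‖Complex.exp (t.2 ⟨w, hw⟩)‖
    rw [Complex.norm_exp]
    exact ⟨Real.exp_le_exp.2 this.2.le, Real.exp_le_exp.2 this.1.le⟩

end Exponential

section BoxShift

open scoped Classical
open NumberField.mixedEmbedding

variable {K : Type*} [Field K] [NumberField K]

theorem inv_natFloor_le {r : ℝ} (hr : 1 ≤ r) : 0 < ⌊r⌋₊ ∧ ((⌊r⌋₊ : ℝ))⁻¹ ≤ 2 / r := by
  have h1 : 1 ≤ ⌊r⌋₊ := Nat.one_le_floor_iff r |>.2 hr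
  have h2 := Nat.lt_floor_add_one r
  have h3 : (1 : ℝ) ≤ ⌊r⌋₊ := by exact_mod_cast h1
  refine ⟨h1, ?_⟩
  rw [inv_le_comm₀ (by linarith) (by positivity), inv_div]
  linarith

theorem exists_integral_boxMeasure_shift_le {ε : ℝ} (hε1 : ε < 1) :
    ∃ C : ℝ, 0 ≤ C ∧ ∀ ζ : KInf K, ‖ζ‖ ≤ 1 → ∀ g : (KInf K)ˣ → ℝ, Measurable g → ∀ S : ℝ, 0 ≤ S →
      (∀ x ∈ hBox K 2, |g x| ≤ S) →
      |(∫ x, g (expU ζ * x) ∂(boxMeasure K ε)) - ∫ x, g x ∂(boxMeasure K ε)| ≤ C * S * ‖ζ‖ := by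
  set V := ((Measure.haar : Measure (KInf K)ˣ) (hBox K 2)).toReal with hV
  set F := ((Measure.haar : Measure (KInf K)ˣ) (hBox K ε)).toReal with hF
  refine ⟨4 * (V * F⁻¹), by positivity, ?_⟩
  intro ζ hζ g hg S hS0 hS
  rcases eq_or_ne ζ 0 with rfl | hne
  · simp [expU_zero]
  have hpos : 0 < ‖ζ‖ := norm_pos_iff.2 hne
  obtain ⟨hn0, hn⟩ := inv_natFloor_le (r := 1 / ‖ζ‖) (by rwa [le_div_iff₀ hpos, one_mul])
  set n := ⌊1 / ‖ζ‖⌋₊ with hndef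
  have hn1 : (n : ℝ) * ‖ζ‖ ≤ 1 := by
    rw [← le_div_iff₀ hpos]; exact Nat.floor_le (by positivity)
  have htr : ∀ ζ' : KInf K, ‖ζ'‖ = ‖ζ‖ → ∀ j < n, ∀ x ∈ hBox K ε, expU ζ' ^ j * x ∈ hBox K 2 := by
    intro ζ' hζ' j hj x hx
    rw [hBox_eq_image] at hx ⊢
    obtain ⟨t, ht, rfl⟩ := hx
    refine ⟨j • ζ' + t, ?_, by rw [expU_add, expU_nsmul]⟩
    have h1 : ‖j • ζ'‖ < 1 := by
      refine (norm_nsmul_le (n := j) (a := ζ')).trans_lt ?_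
      rw [hζ']
      refine lt_of_lt_of_le ?_ hn1
      exact mul_lt_mul_of_pos_right (by exact_mod_cast hj) hpos
    exact cube_mono (by linarith) (cube_add (mem_cube_of_norm_lt h1) ht)
  have hcv : ∀ ζ' : KInf K, ‖ζ'‖ = ‖ζ‖ → ∀ i < n, 1 ≤ i → ∀ x ∈ hBox K ε, (expU ζ' ^ i)⁻¹ * x ∈ hBox K ε →
      (expU ζ')⁻¹ * x ∈ hBox K ε := by
    intro ζ' hζ' i hi hi1 x hx hx'
    rw [hBox_eq_image] at hx hx' ⊢
    obtain ⟨t, ht, rfl⟩ := hx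
    obtain ⟨t', ht', h'⟩ := hx'
    rw [← expU_nsmul, ← expU_neg, ← expU_add] at h'
    have hi0 : (0 : ℝ) < i := by exact_mod_cast hi1
    have hnorm : ‖-(i • ζ')‖ < 1 := by
      rw [norm_neg]
      refine (norm_nsmul_le (n := i) (a := ζ')).trans_lt ?_
      rw [hζ']
      refine lt_of_lt_of_le ?_ hn1
      exact mul_lt_mul_of_pos_right (by exact_mod_cast hi) hpos
    have e := injOn_expU (cube_mono (by linarith) ht')
      (cube_mono (by linarith) (cube_add (mem_cube_of_norm_lt hnorm) ht)) h'
    refine ⟨-ζ' + t, ?_, by rw [expU_add, expU_neg]⟩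
    have hc := convex_cube (K := K) ε ht ht' (a := 1 - (i : ℝ)⁻¹) (b := (i : ℝ)⁻¹)
      (by rw [sub_nonneg]; exact inv_le_one_of_one_le₀ (by exact_mod_cast hi1)) (by positivity) (by ring)
    convert hc using 1
    rw [e, smul_add, smul_neg, ← Nat.cast_smul_eq_nsmul ℝ, smul_smul, inv_mul_cancel₀ hi0.ne', one_smul,
      sub_smul, one_smul]
    abel
  have key := abs_integral_cond_mul_sub_le (μ := (Measure.haar : Measure (KInf K)ˣ)) (hBox K ε) (hBox K 2)
    (measurableSet_hBox (by linarith)) (hBox_mono (by linarith)) (haar_hBox_lt_top 2).ne (expU ζ) n hn0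
    (by
      rintro h' (rfl | rfl)
      · exact htr ζ rfl
      · rw [← expU_neg]; exact htr (-ζ) (norm_neg ζ))
    (by
      rintro h' (rfl | rfl)
      · exact hcv ζ rfl
      · rw [← expU_neg]; exact hcv (-ζ) (norm_neg ζ))
    g hg S hS0 (fun x hx => hS x (hBox_mono (by linarith) hx)) (fun x hx => by
      refine hS _ ?_
      have := hBox_eq_image (K := K) ε ▸ hx
      obtain ⟨t, ht, rfl⟩ := this
      rw [hBox_eq_image]
      refine ⟨ζ + t, ?_, expU_add _ _⟩
      have h1 : ζ ∈ cube K (2 - ε) := mem_cube_of_norm_lt (by linarith)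
      have := cube_add h1 ht
      rwa [sub_add_cancel] at this)
  refine key.trans ?_
  rw [← hV, ← hF, div_eq_mul_inv]
  have hV0 : 0 ≤ V := by positivity
  have hF0 : 0 ≤ F := by positivity
  have : V * (n : ℝ)⁻¹ ≤ V * (2 * ‖ζ‖) := by
    refine mul_le_mul_of_nonneg_left ?_ hV0
    refine hn.trans (le_of_eq ?_)
    rw [div_div_eq_mul_div, div_one]
  calc 2 * S * (V * (n : ℝ)⁻¹ * F⁻¹) ≤ 2 * S * (V * (2 * ‖ζ‖) * F⁻¹) := by gcongr
    _ = _ := by ring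

theorem integral_boxMeasure_ball_nonempty (κ : ℝ) (hκ : 0 < κ) :
    IsProbabilityMeasure (ProbabilityTheory.cond (volume : Measure (KInf K)) (Metric.ball 0 κ)) :=
  ProbabilityTheory.cond_isProbabilityMeasure_of_finite (Metric.measure_ball_pos _ _ hκ).ne'
    measure_ball_lt_top.ne

theorem exists_integral_ball_shift_le :
    ∃ C : ℝ, 0 ≤ C ∧ ∀ κ : ℝ, 0 < κ → ∀ ζ : KInf K, ∀ g : KInf K → ℝ, Measurable g → ∀ S : ℝ, 0 ≤ S →
      (∀ x, |g x| ≤ S) →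
      |(∫ x, g (ζ + x) ∂(ProbabilityTheory.cond volume (Metric.ball 0 κ))) -
        ∫ x, g x ∂(ProbabilityTheory.cond volume (Metric.ball 0 κ))| ≤ C * S * (‖ζ‖ / κ) := by
  refine ⟨4 * 2 ^ Module.finrank ℝ (KInf K), by positivity, ?_⟩
  intro κ hκ ζ g hg S hS0 hS
  have hprob := integral_boxMeasure_ball_nonempty (K := K) κ hκ
  rcases eq_or_ne ζ 0 with rfl | hne
  · simp
  have hpos : 0 < ‖ζ‖ := norm_pos_iff.2 hne
  rcases lt_or_ge κ ‖ζ‖ with hlt | hle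
  · have h1 : ∀ h : KInf K → ℝ, (∀ x, |h x| ≤ S) →
        |∫ x, h x ∂(ProbabilityTheory.cond (volume : Measure (KInf K)) (Metric.ball 0 κ))| ≤ S := by
      intro h hh
      simpa using norm_integral_le_of_norm_le_const
        (μ := ProbabilityTheory.cond (volume : Measure (KInf K)) (Metric.ball 0 κ)) (C := S)
        (f := h) (Filter.Eventually.of_forall hh)
    have h2 : 1 ≤ ‖ζ‖ / κ := by rw [le_div_iff₀ hκ]; linarith
    have h3 : (1 : ℝ) ≤ 2 ^ Module.finrank ℝ (KInf K) := one_le_pow₀ (by norm_num)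
    have a := h1 (fun x => g (ζ + x)) (fun x => hS _)
    have b := h1 g hS
    calc _ ≤ |∫ x, g (ζ + x) ∂(ProbabilityTheory.cond (volume : Measure (KInf K)) (Metric.ball 0 κ))| +
          |∫ x, g x ∂(ProbabilityTheory.cond (volume : Measure (KInf K)) (Metric.ball 0 κ))| := abs_sub _ _
      _ ≤ S + S := add_le_add a b
      _ ≤ 4 * 1 * S * 1 := by linarith
      _ ≤ _ := by gcongr
  obtain ⟨hn0, hn⟩ := inv_natFloor_le (r := κ / ‖ζ‖) (by rwa [le_div_iff₀ hpos, one_mul])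
  set n := ⌊κ / ‖ζ‖⌋₊ with hndef
  have hn1 : (n : ℝ) * ‖ζ‖ ≤ κ := by
    rw [← le_div_iff₀ hpos]; exact Nat.floor_le (by positivity)
  have htr : ∀ ζ' : KInf K, ‖ζ'‖ = ‖ζ‖ → ∀ j < n, ∀ x ∈ Metric.ball (0 : KInf K) κ,
      j • ζ' + x ∈ Metric.ball (0 : KInf K) (2 * κ) := by
    intro ζ' hζ' j hj x hx
    rw [mem_ball_zero_iff] at hx ⊢
    refine (norm_add_le _ _).trans_lt ?_
    have h1 : ‖j • ζ'‖ ≤ κ := by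
      refine (norm_nsmul_le (n := j) (a := ζ')).trans ?_
      rw [hζ']
      refine le_trans ?_ hn1
      exact mul_le_mul_of_nonneg_right (by exact_mod_cast hj.le) hpos.le
    linarith
  have hcv : ∀ ζ' : KInf K, ∀ i < n, 1 ≤ i → ∀ x ∈ Metric.ball (0 : KInf K) κ,
      -(i • ζ') + x ∈ Metric.ball (0 : KInf K) κ → -ζ' + x ∈ Metric.ball (0 : KInf K) κ := by
    intro ζ' i hi hi1 x hx hx'
    have hi0 : (0 : ℝ) < i := by exact_mod_cast hi1
    have hcb : Convex ℝ (Metric.ball (0 : KInf K) κ) := convex_ball 0 κ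
    have hc := hcb hx hx' (a := 1 - (i : ℝ)⁻¹) (b := (i : ℝ)⁻¹)
      (by rw [sub_nonneg]; exact inv_le_one_of_one_le₀ (by exact_mod_cast hi1)) (by positivity) (by ring)
    convert hc using 1
    rw [smul_add, smul_neg, ← Nat.cast_smul_eq_nsmul ℝ, smul_smul, inv_mul_cancel₀ hi0.ne', one_smul,
      sub_smul, one_smul]
    abel
  have key := abs_integral_cond_add_sub_le (μ := (volume : Measure (KInf K))) (Metric.ball 0 κ)
    (Metric.ball 0 (2 * κ)) measurableSet_ball (Metric.ball_subset_ball (by linarith))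
    measure_ball_lt_top.ne ζ n hn0
    (by
      rintro h' (rfl | rfl)
      · exact htr _ rfl
      · exact htr (-ζ) (norm_neg ζ))
    (fun h' _ => hcv h')
    g hg S hS0 (fun x _ => hS x) (fun x _ => hS _)
  refine key.trans ?_
  have hvol : (volume (Metric.ball (0 : KInf K) (2 * κ))).toReal =
      2 ^ Module.finrank ℝ (KInf K) * (volume (Metric.ball (0 : KInf K) κ)).toReal := by
    rw [Measure.addHaar_ball_mul _ _ (by norm_num), ENNReal.toReal_mul, ENNReal.toReal_ofReal (by positivity)]
  have hb : (volume (Metric.ball (0 : KInf K) κ)).toReal ≠ 0 :=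
    (ENNReal.toReal_pos (Metric.measure_ball_pos _ _ hκ).ne' measure_ball_lt_top.ne).ne'
  rw [hvol, div_eq_mul_inv]
  calc _ = 2 * S * 2 ^ Module.finrank ℝ (KInf K) * (n : ℝ)⁻¹ := by field_simp
    _ ≤ 2 * S * 2 ^ Module.finrank ℝ (KInf K) * (2 / (κ / ‖ζ‖)) := by gcongr
    _ = _ := by field_simp; ring

end BoxShift

section Minkowski

open scoped Classical
open NumberField.mixedEmbedding

variable {K : Type*} [Field K] [NumberField K]

/-- Minkowski's theorem for the lattices `σ 𝓞`, where `σ` has norm one. -/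
theorem exists_ringOfIntegers_mul_le : ∃ c : ℝ, 0 < c ∧ ∀ σ : (KInf K)ˣ,
    mixedEmbedding.norm (σ : KInf K) = 1 → ∀ f : InfinitePlace K → ℝ, (∀ w, 0 < f w) →
      1 ≤ ∏ w, f w ^ w.mult →
      ∃ a : 𝓞 K, a ≠ 0 ∧ ∀ w, normAtPlace w ((σ : KInf K) * mixedEmbedding K a) ≤ c * f w := by
  set B := (minkowskiBound K ↑1).toReal with hB
  have hB0 : 0 ≤ B := ENNReal.toReal_nonneg
  refine ⟨B + 1, by positivity, ?_⟩
  intro σ hσ f hf hprod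
  set g : InfinitePlace K → NNReal := fun w =>
    ⟨(B + 1) * f w / normAtPlace w (σ : KInf K), by
      have := hf w
      have := normAtPlace_unit_pos w σ
      positivity⟩ with hg
  have hN : ∏ w, normAtPlace w (σ : KInf K) ^ w.mult = 1 := by
    rw [← mixedEmbedding.norm_apply, hσ]
  have hge : (B + 1) ≤ ((∏ w, g w ^ w.mult : NNReal) : ℝ) := by
    push_cast
    have e : ∀ w, ((g w : ℝ)) ^ w.mult =
        (B + 1) ^ w.mult * f w ^ w.mult / normAtPlace w (σ : KInf K) ^ w.mult := by
      intro w
      change ((B + 1) * f w / normAtPlace w (σ : KInf K)) ^ w.mult = _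
      rw [div_pow, mul_pow]
    simp_rw [e]
    rw [Finset.prod_div_distrib, Finset.prod_mul_distrib, hN, div_one, Finset.prod_pow_eq_pow_sum,
      InfinitePlace.sum_mult_eq]
    have h1 : B + 1 ≤ (B + 1) ^ Module.finrank ℚ K :=
      le_self_pow₀ (by linarith) Module.finrank_pos.ne'
    calc B + 1 = (B + 1) * 1 := (mul_one _).symm
      _ ≤ _ := mul_le_mul h1 hprod zero_le_one (by positivity)
  have hlt : minkowskiBound K ↑1 < volume (convexBodyLT K g) := by
    rw [convexBodyLT_volume]
    have h1 : minkowskiBound K ↑1 < ((∏ w, g w ^ w.mult : NNReal) : ℝ≥0∞) := by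
      rw [← ENNReal.ofReal_toReal (minkowskiBound_lt_top K ↑1).ne, ← hB,
        ← ENNReal.ofReal_coe_nnreal, ENNReal.ofReal_lt_ofReal_iff (by linarith)]
      linarith
    refine h1.trans_le ?_
    refine le_mul_of_one_le_left zero_le ?_
    exact_mod_cast one_le_convexBodyLTFactor K
  obtain ⟨a, ha, hlt⟩ := exists_ne_zero_mem_ringOfIntegers_lt K hlt
  refine ⟨a, ha, fun w => ?_⟩
  have h := (hlt w).le
  change w (a : K) ≤ (B + 1) * f w / normAtPlace w (σ : KInf K) at h
  rw [map_mul, normAtPlace_apply]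
  rwa [le_div_iff₀ (normAtPlace_unit_pos w σ), mul_comm] at h

end Minkowski

section FundamentalDomain

open scoped Classical
open NumberField.mixedEmbedding

variable {K : Type*} [Field K] [NumberField K]

variable (K) in
/-- The uniform probability measure on a fundamental domain of `𝓞` in `k_∞`. -/
noncomputable def fundMeasure : Measure (KInf K) :=
  ProbabilityTheory.cond volume (ZSpan.fundamentalDomain (latticeBasis K))

instance : IsProbabilityMeasure (fundMeasure K) :=
  ProbabilityTheory.cond_isProbabilityMeasure_of_finite
    (ZSpan.measure_fundamentalDomain_ne_zero (latticeBasis K))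
    (ZSpan.fundamentalDomain_isBounded (latticeBasis K)).measure_lt_top.ne

variable (K) in
theorem exists_ae_fundMeasure_norm_le : ∃ D : ℝ, 0 < D ∧ ∀ᵐ p ∂(fundMeasure K), ‖p‖ ≤ D := by
  obtain ⟨D, hD⟩ := (ZSpan.fundamentalDomain_isBounded (latticeBasis K)).exists_norm_le
  refine ⟨max D 1, by positivity, ?_⟩
  have := ProbabilityTheory.ae_cond_mem (μ := (volume : Measure (KInf K)))
    (ZSpan.fundamentalDomain_measurableSet (latticeBasis K))
  filter_upwards [this] with p hp
  exact (hD p hp).trans (le_max_left _ _)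

theorem isProbabilityMeasure_ball {κ : ℝ} (hκ : 0 < κ) :
    IsProbabilityMeasure (ProbabilityTheory.cond (volume : Measure (KInf K)) (Metric.ball 0 κ)) :=
  integral_boxMeasure_ball_nonempty κ hκ

end FundamentalDomain

section Integrals

variable {α β : Type*} [MeasurableSpace α] [MeasurableSpace β]

theorem abs_integral_le_of_ae_le {μ : Measure α} [IsProbabilityMeasure μ] {f : α → ℝ} {C : ℝ}
    (h : ∀ᵐ x ∂μ, |f x| ≤ C) : |∫ x, f x ∂μ| ≤ C := by
  simpa using norm_integral_le_of_norm_le_const (μ := μ) (f := f) h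

theorem integrable_of_abs_le {μ : Measure α} [IsFiniteMeasure μ] {f : α → ℝ} (hf : Measurable f) {C : ℝ}
    (h : ∀ x, |f x| ≤ C) : Integrable f μ :=
  Integrable.of_bound hf.aestronglyMeasurable C (Filter.Eventually.of_forall h)

theorem abs_integral_sub_le {μ : Measure α} [IsProbabilityMeasure μ] {f g : α → ℝ} (hf : Integrable f μ)
    (hg : Integrable g μ) {C : ℝ} (h : ∀ᵐ x ∂μ, |f x - g x| ≤ C) :
    |(∫ x, f x ∂μ) - ∫ x, g x ∂μ| ≤ C := by
  rw [← integral_sub hf hg]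
  exact abs_integral_le_of_ae_le h

theorem measurable_integral_right {ν : Measure β} [SFinite ν] {f : α → β → ℝ}
    (hf : Measurable (Function.uncurry f)) : Measurable fun x => ∫ y, f x y ∂ν :=
  (hf.stronglyMeasurable.integral_prod_right (ν := ν)).measurable

theorem measurable_integral_left {μ : Measure α} [SFinite μ] {f : α → β → ℝ}
    (hf : Measurable (Function.uncurry f)) : Measurable fun y => ∫ x, f x y ∂μ :=
  (hf.stronglyMeasurable.integral_prod_left (μ := μ)).measurable

theorem integral_integral_swap_of_bounded {μ : Measure α} {ν : Measure β} [IsFiniteMeasure μ]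
    [IsFiniteMeasure ν] {f : α → β → ℝ} (hf : Measurable (Function.uncurry f)) {C : ℝ}
    (h : ∀ x y, |f x y| ≤ C) : ∫ x, ∫ y, f x y ∂ν ∂μ = ∫ y, ∫ x, f x y ∂μ ∂ν :=
  integral_integral_swap (integrable_of_abs_le hf fun p => h p.1 p.2)

end Integrals

section Core

open scoped Classical
open NumberField.mixedEmbedding

variable {K : Type*} [Field K] [NumberField K]

theorem normAtPlace_inv (w : InfinitePlace K) (v : KInf K) : normAtPlace w v⁻¹ = (normAtPlace w v)⁻¹ := by
  rcases w.isReal_or_isComplex with hw | hw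
  · rw [normAtPlace_apply_of_isReal hw, normAtPlace_apply_of_isReal hw]
    exact norm_inv _
  · rw [normAtPlace_apply_of_isComplex hw, normAtPlace_apply_of_isComplex hw]
    exact norm_inv _

theorem placeIdem_mul_mul_inv (w : InfinitePlace K) (v : KInf K) (h : normAtPlace w v ≠ 0) :
    placeIdem w * (v * v⁻¹) = placeIdem w := by
  apply ext_normAtPlace
  intro w'
  have e : placeIdem w * (v * v⁻¹) - placeIdem w = placeIdem w * (v * v⁻¹ - 1) := by ring
  rw [e]
  rcases eq_or_ne w' w with rfl | hw'
  · have : normAtPlace w' (v * v⁻¹ - 1) = 0 := by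
      rcases w'.isReal_or_isComplex with hw | hw
      · rw [normAtPlace_apply_of_isReal hw] at h ⊢
        change ‖v.1 ⟨w', hw⟩ * (v.1 ⟨w', hw⟩)⁻¹ - 1‖ = 0
        rw [mul_inv_cancel₀ (norm_ne_zero_iff.1 h), sub_self, norm_zero]
      · rw [normAtPlace_apply_of_isComplex hw] at h ⊢
        change ‖v.2 ⟨w', hw⟩ * (v.2 ⟨w', hw⟩)⁻¹ - 1‖ = 0
        rw [mul_inv_cancel₀ (norm_ne_zero_iff.1 h), sub_self, norm_zero]
    rw [map_mul, this, mul_zero]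
  · exact normAtPlace_eq_zero_of_ne_placeIdem hw' _

/-- The average of a function of mean zero modulo a lattice over a long segment (or square) in the direction
of one place `w`, if the lattice contains a sublattice `γ 𝓞` with a fundamental domain which is small
at the places different from `w` and not too long at `w`. -/
theorem abs_integral_ball_le (C₃ : ℝ) (hC₃ : ∀ κ : ℝ, 0 < κ → ∀ ζ : KInf K, ∀ g : KInf K → ℝ, Measurable g →
      ∀ S : ℝ, 0 ≤ S → (∀ x, |g x| ≤ S) →
      |(∫ x, g (ζ + x) ∂(ProbabilityTheory.cond volume (Metric.ball 0 κ))) -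
        ∫ x, g x ∂(ProbabilityTheory.cond volume (Metric.ball 0 κ))| ≤ C₃ * S * (‖ζ‖ / κ))
    (hC₃0 : 0 ≤ C₃)
    (D₀ : ℝ) (hD₀0 : 0 < D₀) (hD₀ : ∀ᵐ p ∂(fundMeasure K), ‖p‖ ≤ D₀)
    (h : KInf K → ℝ) (hcont : Continuous h) (S L : ℝ) (hS0 : 0 ≤ S) (hL : 0 ≤ L) (hS : ∀ r, |h r| ≤ S)
    (hlip : ∀ r r', |h r - h r'| ≤ L * ‖r - r'‖) (γ : KInf K)
    (hmean : ∀ q, ∫ p, h (q + γ * p) ∂(fundMeasure K) = 0) (w : InfinitePlace K) (v : KInf K)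
    (hv : normAtPlace w v ≠ 0) (A₁ A₂ : ℝ) (hA₁ : normAtPlace w γ ≤ A₁)
    (hA₂ : ∀ w', w' ≠ w → normAtPlace w' γ ≤ A₂) (hA₂0 : 0 ≤ A₂) (κ : ℝ) (hκ : 0 < κ) (q : KInf K) :
    |∫ ζ, h (q + placeIdem w * v * ζ) ∂(ProbabilityTheory.cond volume (Metric.ball 0 κ))| ≤
      C₃ * S * (A₁ * D₀ / normAtPlace w v / κ) + L * (A₂ * D₀) := by
  have hprob := isProbabilityMeasure_ball (K := K) hκ
  set β := ProbabilityTheory.cond (volume : Measure (KInf K)) (Metric.ball 0 κ) with hβ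
  have hv0 : 0 < normAtPlace w v := (normAtPlace_nonneg _ _).lt_of_ne hv.symm
  have hfm : Measurable (Function.uncurry fun (ζ p : KInf K) => h (q + placeIdem w * v * ζ + γ * p)) := by
    apply Continuous.measurable
    fun_prop
  have hzero : ∫ p, ∫ ζ, h (q + placeIdem w * v * ζ + γ * p) ∂β ∂(fundMeasure K) = 0 := by
    rw [← integral_integral_swap_of_bounded (f := fun ζ p => h (q + placeIdem w * v * ζ + γ * p)) hfm
      fun x y => hS _]
    simp [hmean]
  have hkey : ∀ᵐ p ∂(fundMeasure K), |(∫ ζ, h (q + placeIdem w * v * ζ) ∂β) -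
      ∫ ζ, h (q + placeIdem w * v * ζ + γ * p) ∂β| ≤
      C₃ * S * (A₁ * D₀ / normAtPlace w v / κ) + L * (A₂ * D₀) := by
    filter_upwards [hD₀] with p hp
    set x : KInf K := placeIdem w * (v⁻¹ * (γ * p)) with hx
    have hxn : ‖x‖ ≤ A₁ * D₀ / normAtPlace w v := by
      refine (norm_placeIdem_mul _ _).trans ?_
      rw [map_mul, map_mul, normAtPlace_inv, inv_mul_eq_div]
      refine div_le_div_of_nonneg_right ?_ hv0.le
      exact mul_le_mul hA₁ ((normAtPlace_le_norm w p).trans hp) (normAtPlace_nonneg _ _)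
        ((normAtPlace_nonneg _ _).trans hA₁)
    have h1 := hC₃ κ hκ x (fun ζ => h (q + placeIdem w * v * ζ))
      (by apply Continuous.measurable; fun_prop) S hS0 (fun _ => hS _)
    have e1 : ∀ ζ, q + placeIdem w * v * (x + ζ) = q + placeIdem w * v * ζ + placeIdem w * (γ * p) := by
      intro ζ
      have : placeIdem w * v * x = placeIdem w * (γ * p) := by
        calc placeIdem w * v * x = (placeIdem w * placeIdem w) * (v * v⁻¹) * (γ * p) := by rw [hx]; ring
          _ = _ := by rw [placeIdem_mul_self, placeIdem_mul_mul_inv w v hv]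
      rw [mul_add, this]; ring
    simp only [e1] at h1
    have h2 : |(∫ ζ, h (q + placeIdem w * v * ζ + placeIdem w * (γ * p)) ∂β) -
        ∫ ζ, h (q + placeIdem w * v * ζ + γ * p) ∂β| ≤ L * (A₂ * D₀) := by
      refine abs_integral_sub_le (integrable_of_abs_le (Continuous.measurable (by fun_prop)) fun _ => hS _)
        (integrable_of_abs_le (Continuous.measurable (by fun_prop)) fun _ => hS _) ?_
      refine Filter.Eventually.of_forall fun ζ => (hlip _ _).trans ?_
      refine mul_le_mul_of_nonneg_left ?_ hL
      rw [add_sub_add_left_eq_sub]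
      refine norm_placeIdem_mul_sub_le w _ _ (by positivity) fun w' hw' => ?_
      rw [map_mul]
      exact mul_le_mul (hA₂ w' hw') ((normAtPlace_le_norm _ _).trans hp) (normAtPlace_nonneg _ _) hA₂0
    have h3 : C₃ * S * (‖x‖ / κ) ≤ C₃ * S * (A₁ * D₀ / normAtPlace w v / κ) := by gcongr
    rw [abs_le] at *
    constructor <;> linarith [h1.1, h1.2, h2.1, h2.2]
  have hi2 : Integrable (fun p => ∫ ζ, h (q + placeIdem w * v * ζ + γ * p) ∂β) (fundMeasure K) := by
    refine integrable_of_abs_le (measurable_integral_left hfm) (C := S) fun p => ?_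
    exact abs_integral_le_of_ae_le (Filter.Eventually.of_forall fun _ => hS _)
  have := abs_integral_sub_le (integrable_const (μ := fundMeasure K)
    (∫ ζ, h (q + placeIdem w * v * ζ) ∂β)) hi2 hkey
  rwa [hzero, sub_zero, integral_const, probReal_univ, one_smul] at this

end Core

section Core

open scoped Classical
open NumberField.mixedEmbedding

variable {K : Type*} [Field K] [NumberField K]

instance (ε : ℝ) : IsFiniteMeasure (boxMeasure K ε) := by
  unfold boxMeasure; infer_instance

instance (ε : ℝ) : IsZeroOrProbabilityMeasure (boxMeasure K ε) := by
  unfold boxMeasure; infer_instance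

theorem abs_integral_boxMeasure_le {ε : ℝ} (hε : ε ≤ 3) {f : (KInf K)ˣ → ℝ} {C : ℝ} (hC : 0 ≤ C)
    (h : ∀ η ∈ hBox K ε, |f η| ≤ C) : |∫ η, f η ∂(boxMeasure K ε)| ≤ C := by
  have h1 : ∀ᵐ η ∂(boxMeasure K ε), ‖f η‖ ≤ C := by
    filter_upwards [ProbabilityTheory.ae_cond_mem (measurableSet_hBox hε)] with η hη using h η hη
  have h2 := norm_integral_le_of_norm_le_const h1
  refine h2.trans (mul_le_of_le_one_right hC ?_)
  exact measureReal_le_one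

theorem exists_dilation_bounds (w₀ : InfinitePlace K) (M : ℝ) (hM : 1 ≤ M) :
    1 ≤ ∏ w, (if w = w₀ then M else M ^ (-(1 : ℝ) / Module.finrank ℚ K)) ^ w.mult := by
  have hM0 : 0 < M := by linarith
  set l := Module.finrank ℚ K with hl
  have hl0 : (0 : ℝ) < l := by exact_mod_cast Module.finrank_pos
  set x := M ^ (-(1 : ℝ) / l) with hx
  have hx0 : 0 < x := Real.rpow_pos_of_pos hM0 _
  have e : ∀ w : InfinitePlace K, (if w = w₀ then M else x) ^ w.mult =
      x ^ w.mult * (if w = w₀ then (M / x) ^ w₀.mult else 1) := by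
    intro w
    split_ifs with h
    · rw [h, div_pow, mul_div_cancel₀ _ (pow_pos hx0 _).ne']
    · rw [mul_one]
  simp_rw [e]
  rw [Finset.prod_mul_distrib, Finset.prod_ite_eq' Finset.univ w₀, if_pos (Finset.mem_univ _),
    Finset.prod_pow_eq_pow_sum, InfinitePlace.sum_mult_eq, ← hl]
  have h1 : x ^ l = M⁻¹ := by
    rw [hx, ← Real.rpow_natCast, ← Real.rpow_mul hM0.le, div_mul_cancel₀ _ hl0.ne', Real.rpow_neg_one]
  have hx1 : x ≤ 1 := Real.rpow_le_one_of_one_le_of_nonpos hM (by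
    rw [neg_div]; exact neg_nonpos.2 (by positivity))
  have h2 : M ≤ M / x := le_div_self hM0.le hx0 hx1
  have h3 : M ≤ (M / x) ^ w₀.mult := h2.trans (le_self_pow₀ (hM.trans h2) InfinitePlace.mult_pos.ne')
  rw [h1, inv_mul_eq_div, le_div_iff₀ hM0, one_mul]
  exact h3

theorem normAtPlace_zpow_hBox {m : ℤ} (hm : m = 2 ∨ m = -2) {η : (KInf K)ˣ} {ε : ℝ} (hε : ε ≤ 1) (hη : η ∈ hBox K ε)
    (w : InfinitePlace K) :
    normAtPlace w ((η ^ m : (KInf K)ˣ) : KInf K) ≤ Real.exp 2 ∧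
      Real.exp (-2) ≤ normAtPlace w ((η ^ m : (KInf K)ˣ) : KInf K) := by
  obtain ⟨h1, h2⟩ := normAtPlace_hBox (hBox_mono hε hη) w
  set x := normAtPlace w (η : KInf K) with hx
  have hx0 : 0 < x := (Real.exp_pos _).trans_le h2
  have hs : Real.exp (-1) ^ 2 ≤ x ^ 2 ∧ x ^ 2 ≤ Real.exp 1 ^ 2 := by
    constructor <;> gcongr
  rw [← Real.exp_nat_mul, ← Real.exp_nat_mul] at hs
  norm_num at hs
  rw [normAtPlace_unit_zpow]
  rcases hm with rfl | rfl
  · exact_mod_cast hs.symm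
  · have e : x ^ (-2 : ℤ) = (x ^ 2)⁻¹ := by rw [_root_.zpow_neg]; norm_cast
    rw [e]
    constructor
    · rw [inv_le_comm₀ (by positivity) (Real.exp_pos _), ← Real.exp_neg]; exact hs.1
    · rw [le_inv_comm₀ (Real.exp_pos _) (by positivity), ← Real.exp_neg, neg_neg]; exact hs.2

/-- A Lipschitz function of mean zero modulo the lattices `σ d 𝓞` is bounded, uniformly for `σ` of norm one. -/
theorem abs_le_of_mean_zero (c D₀ : ℝ) (hD₀ : ∀ᵐ p ∂(fundMeasure K), ‖p‖ ≤ D₀)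
    (h : KInf K → ℝ) (hcont : Continuous h) (S₀ L : ℝ) (hL : 0 ≤ L) (hS₀ : ∀ r, |h r| ≤ S₀)
    (hlip : ∀ r r', |h r - h r'| ≤ L * ‖r - r'‖) (γ : KInf K) (hc : 0 ≤ c) (hγ : ∀ w, normAtPlace w γ ≤ c)
    (hmean : ∀ q, ∫ p, h (q + γ * p) ∂(fundMeasure K) = 0) (q : KInf K) : |h q| ≤ L * (c * D₀) := by
  have := abs_integral_sub_le (integrable_const (μ := fundMeasure K) (h q))
    (integrable_of_abs_le (μ := fundMeasure K) (f := fun p => h (q + γ * p))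
      (Continuous.measurable (by fun_prop)) fun _ => hS₀ _) (C := L * (c * D₀)) ?_
  · rwa [hmean, sub_zero, integral_const, probReal_univ, one_smul] at this
  · filter_upwards [hD₀] with p hp
    refine (hlip _ _).trans (mul_le_mul_of_nonneg_left ?_ hL)
    rw [sub_add_cancel_left, norm_neg]
    exact (norm_mul_le_KInf _ _).trans (mul_le_mul (norm_le_iff_normAtPlace.2 hγ) hp (norm_nonneg _) hc)

theorem error_terms_le (C₂ C₃ P E B D₀ L L₂ θ : ℝ) (hC₂ : 0 ≤ C₂) (hC₃ : 0 ≤ C₃) (hP : 0 ≤ P) (hE : 0 ≤ E) (hB : 0 ≤ B)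
    (hD : 0 ≤ D₀) (hL : 0 ≤ L) (hL₂ : 0 ≤ L₂) (hθ : 0 ≤ θ) (hPe : B * D₀ = P) :
    C₂ * (L * P) * θ + ((L₂ * θ + L * (E * θ)) + (C₃ * (L * P) * (E * B * D₀ * θ) + L * (B * θ * D₀))) ≤
      (P + (C₂ * P + 1 + E + C₃ * P * (E * B * D₀) + P)) * (L + L₂) * θ := by
  subst hPe
  have h1 : 0 ≤ C₂ * (B * D₀) := by positivity
  have h3 : 0 ≤ C₃ * (B * D₀) * (E * B * D₀) := by positivity
  have h4 : 0 ≤ B * D₀ := by positivity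
  have : 0 ≤ ((B * D₀) * (L + L₂) + L + (C₂ * (B * D₀) + E + C₃ * (B * D₀) * (E * B * D₀) + B * D₀) * L₂) * θ := by
    positivity
  linarith

set_option maxHeartbeats 1000000 in
theorem exists_equidistribution_bound {m : ℤ} (hm : m = 2 ∨ m = -2) {ε : ℝ} (hε1 : ε < 1) (d : ℕ) :
    ∃ C : ℝ, 0 ≤ C ∧ ∀ σ : (KInf K)ˣ, mixedEmbedding.norm (σ : KInf K) = 1 →
      ∀ D : (KInf K)ˣ → KInf K → ℝ, Continuous (Function.uncurry D) → ∀ S₀ : ℝ, (∀ η r, |D η r| ≤ S₀) →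
      ∀ L L₂ : ℝ, 0 ≤ L → 0 ≤ L₂ → (∀ η ∈ hBox K 2, ∀ r r', |D η r - D η r'| ≤ L * ‖r - r'‖) →
      (∀ η ζ r, |D (expU ζ * η) r - D η r| ≤ L₂ * ‖ζ‖) →
      (∀ a : 𝓞 K, a ≠ 0 → ∀ η q,
        ∫ p, D η (q + (σ : KInf K) * (d * mixedEmbedding K a) * p) ∂(fundMeasure K) = 0) →
      ∀ R : KInf K, |∫ η, D η ((η ^ m : (KInf K)ˣ) * R) ∂(boxMeasure K ε)| ≤ C * L ∧
        ∀ w, 1 ≤ normAtPlace w R → |∫ η, D η ((η ^ m : (KInf K)ˣ) * R) ∂(boxMeasure K ε)| ≤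
          C * (L + L₂) * normAtPlace w R ^ (-(1 / (6 * (Module.finrank ℚ K : ℝ)))) := by
  obtain ⟨c, hc, hmink⟩ := exists_ringOfIntegers_mul_le (K := K)
  obtain ⟨C₂, hC₂, hbox⟩ := exists_integral_boxMeasure_shift_le (K := K) hε1
  obtain ⟨C₃, hC₃, hball⟩ := exists_integral_ball_shift_le (K := K)
  obtain ⟨D₀, hD₀0, hD₀⟩ := exists_ae_fundMeasure_norm_le K
  set B := d * c with hB
  have hB0 : 0 ≤ B := by positivity
  refine ⟨B * D₀ + (C₂ * (B * D₀) + 1 + Real.exp 2 + C₃ * (B * D₀) * (Real.exp 2 * B * D₀) + B * D₀),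
    by positivity, ?_⟩
  intro σ hσ D hD S₀ hS₀ L L₂ hL hL₂ hlip hlip₂ hmean R
  have hcontη : ∀ η, Continuous (D η) := fun η => hD.comp (by fun_prop : Continuous fun r => (η, r))
  set S := L * (B * D₀) with hSdef
  have hS0 : 0 ≤ S := by positivity
  have hγw : ∀ (a : 𝓞 K) (w : InfinitePlace K) (x : ℝ), normAtPlace w ((σ : KInf K) * mixedEmbedding K a) ≤ c * x →
      normAtPlace w ((σ : KInf K) * (d * mixedEmbedding K a)) ≤ B * x := by
    intro a w x hx
    have e : (σ : KInf K) * (d * mixedEmbedding K a) = algebraMap ℝ (KInf K) d * (σ * mixedEmbedding K a) := by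
      rw [map_natCast]; ring
    rw [e, map_mul, normAtPlace_algebraMap, Nat.abs_cast, hB, mul_assoc]
    exact mul_le_mul_of_nonneg_left hx (by positivity)
  have hS : ∀ η ∈ hBox K 2, ∀ r, |D η r| ≤ S := by
    intro η hη r
    obtain ⟨a, ha, hb⟩ := hmink σ hσ (fun _ => 1) (fun _ => one_pos) (by simp)
    exact abs_le_of_mean_zero B D₀ hD₀ (D η) (hcontη η) S₀ L hL (hS₀ η) (hlip η hη) _ hB0
      (fun w => by simpa using hγw a w 1 (hb w)) (hmean a ha η) r
  have hpc : Continuous fun η : (KInf K)ˣ => ((η ^ m : (KInf K)ˣ) : KInf K) :=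
    Units.continuous_val.comp (continuous_zpow m)
  have htriv : |∫ η, D η ((η ^ m : (KInf K)ˣ) * R) ∂(boxMeasure K ε)| ≤ L * (B * D₀) :=
    abs_integral_boxMeasure_le (by linarith) hS0 fun η hη => hS η (hBox_mono (by linarith) hη) _
  refine ⟨htriv.trans ?_, ?_⟩
  · rw [mul_comm L]
    refine mul_le_mul_of_nonneg_right ?_ hL
    have : 0 ≤ C₂ * (B * D₀) + 1 + Real.exp 2 + C₃ * (B * D₀) * (Real.exp 2 * B * D₀) + B * D₀ := by positivity
    linarith
  intro w hw
  set ρ := normAtPlace w R with hρ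
  have hρ0 : 0 < ρ := by linarith
  set l : ℝ := (Module.finrank ℚ K : ℝ) with hl
  have hl1 : 1 ≤ l := by
    rw [hl]; exact_mod_cast (Module.finrank_pos : 0 < Module.finrank ℚ K)
  set θ := ρ ^ (-(1 / (6 * l))) with hθ
  have hle : ∀ e : ℝ, e ≤ -(1 / 6) → ρ ^ e ≤ θ := by
    intro e he
    refine Real.rpow_le_rpow_of_exponent_le hw (he.trans ?_)
    rw [neg_le_neg_iff]
    exact one_div_le_one_div_of_le (by norm_num) (by linarith)
  set κ := ρ ^ (-(2 / 3 : ℝ)) / 2 with hκ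
  have hκ0 : 0 < κ := by positivity
  have hκθ : κ ≤ θ := by
    have h1 := hle (-(2/3)) (by norm_num)
    have h2 : 0 < ρ ^ (-(2 / 3 : ℝ)) := by positivity
    linarith
  have hκ2 : κ ≤ 1 / 2 := by
    have : ρ ^ (-(2 / 3 : ℝ)) ≤ 1 := Real.rpow_le_one_of_one_le_of_nonpos hw (by norm_num)
    linarith
  set M := ρ ^ (1 / 6 : ℝ) with hM
  have hM1 : 1 ≤ M := Real.one_le_rpow hw (by norm_num)
  obtain ⟨a, ha, hb⟩ := hmink σ hσ (fun w' => if w' = w then M else M ^ (-(1 : ℝ) / l))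
    (fun w' => by split_ifs <;> positivity) (exists_dilation_bounds w M hM1)
  have hMl : M ^ (-(1 : ℝ) / l) = θ := by
    rw [hM, ← Real.rpow_mul hρ0.le, hθ]; congr 1; field_simp
  set γ : KInf K := (σ : KInf K) * (d * mixedEmbedding K a) with hγ
  have hγ1 : normAtPlace w γ ≤ B * M := hγw a w M (by simpa using hb w)
  have hγ2 : ∀ w', w' ≠ w → normAtPlace w' γ ≤ B * θ := fun w' hw' =>
    hγw a w' θ (by simpa [hw', hMl] using hb w')
  set μ := boxMeasure K ε with hμ
  have hprob := isProbabilityMeasure_ball (K := K) hκ0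
  set β := ProbabilityTheory.cond (volume : Measure (KInf K)) (Metric.ball 0 κ) with hβ
  set e : KInf K := placeIdem w with he
  have hen : ∀ ζ : KInf K, ‖e * ζ‖ ≤ ‖ζ‖ := fun ζ => (norm_placeIdem_mul w ζ).trans (normAtPlace_le_norm w ζ)
  let g : (KInf K)ˣ → ℝ := fun η => D η ((η ^ m : (KInf K)ˣ) * R)
  have hgc : Continuous g := hD.comp (continuous_id.prodMk (hpc.mul continuous_const))
  have hgs : Continuous (Function.uncurry fun (ζ : KInf K) (η : (KInf K)ˣ) => g (expU (e * ζ) * η)) := by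
    refine hgc.comp ?_
    refine (continuous_expU.comp ?_).mul continuous_snd
    exact continuous_const.mul continuous_fst
  have hβmem : ∀ᵐ ζ ∂β, ‖ζ‖ < κ := by
    filter_upwards [ProbabilityTheory.ae_cond_mem (μ := (volume : Measure (KInf K)))
      (s := Metric.ball 0 κ) measurableSet_ball] with ζ hζ
    simpa using hζ
  have step1 : |(∫ ζ, ∫ η, g (expU (e * ζ) * η) ∂μ ∂β) - ∫ η, g η ∂μ| ≤ C₂ * S * κ := by
    have h1 := abs_integral_sub_le (μ := β) (f := fun ζ => ∫ η, g (expU (e * ζ) * η) ∂μ)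
      (g := fun _ => ∫ η, g η ∂μ) ?_ (integrable_const _) (C := C₂ * S * κ) ?_
    · rwa [integral_const, probReal_univ, one_smul] at h1
    · refine integrable_of_abs_le (measurable_integral_right hgs.measurable) (C := S₀) fun ζ => ?_
      exact abs_integral_boxMeasure_le (by linarith) ((abs_nonneg _).trans (hS₀ 1 0)) fun η _ => hS₀ _ _
    · filter_upwards [hβmem] with ζ hζ
      have h2 := hbox (e * ζ) ((hen ζ).trans (by linarith)) g hgc.measurable S hS0 fun η hη => hS η hη _
      refine h2.trans (mul_le_mul_of_nonneg_left ((hen ζ).trans hζ.le) (by positivity))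
  have step2 : (∫ ζ, ∫ η, g (expU (e * ζ) * η) ∂μ ∂β) = ∫ η, ∫ ζ, g (expU (e * ζ) * η) ∂β ∂μ :=
    integral_integral_swap_of_bounded hgs.measurable fun _ _ => hS₀ _ _
  have hmR : |(m : ℝ)| = 2 := by rcases hm with rfl | rfl <;> norm_num
  have step3 : ∀ η ∈ hBox K ε, |∫ ζ, g (expU (e * ζ) * η) ∂β| ≤
      (L₂ * θ + L * (Real.exp 2 * θ)) + (C₃ * S * (Real.exp 2 * B * D₀ * θ) + L * (B * θ * D₀)) := by
    intro η hη
    obtain ⟨hη1, hη2⟩ := normAtPlace_zpow_hBox hm hε1.le hη w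
    set N := normAtPlace w ((η ^ m : (KInf K)ˣ) : KInf K) with hN
    have hN0 : 0 < N := (Real.exp_pos _).trans_le hη2
    set q : KInf K := ((η ^ m : (KInf K)ˣ) : KInf K) * R with hq
    set v : KInf K := m • q with hv
    have hvn : normAtPlace w v = 2 * (N * ρ) := by
      rw [hv, ← Int.cast_smul_eq_zsmul ℝ, normAtPlace_smul, hmR, hq, map_mul]
    have hη' : η ∈ hBox K 2 := hBox_mono (by linarith) hη
    have hlin : |(∫ ζ, g (expU (e * ζ) * η) ∂β) - ∫ ζ, D η (q + e * v * ζ) ∂β| ≤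
        L₂ * θ + L * (Real.exp 2 * θ) := by
      refine abs_integral_sub_le
        (integrable_of_abs_le (C := S₀) ?_ fun ζ => hS₀ _ _)
        (integrable_of_abs_le (C := S₀) ?_ fun ζ => hS₀ _ _) ?_
      · exact (hgs.comp (by fun_prop : Continuous fun ζ : KInf K => (ζ, η))).measurable
      · exact ((hcontη η).comp (by fun_prop : Continuous fun ζ : KInf K => q + e * v * ζ)).measurable
      · filter_upwards [hβmem] with ζ hζ
        set t : KInf K := m • (e * ζ) with ht
        have htn : ‖t‖ ≤ 2 * κ := by
          rw [ht, ← Int.cast_smul_eq_zsmul ℝ, _root_.norm_smul, Real.norm_eq_abs, hmR]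
          have := hen ζ
          linarith
        have hgv : g (expU (e * ζ) * η) = D (expU (e * ζ) * η) ((expU t : KInf K) * q) := by
          change D _ _ = D _ _
          congr 1
          rw [mul_zpow, ← expU_zsmul, Units.val_mul, hq, mul_assoc]
        have b1 := hlip₂ η (e * ζ) ((expU t : KInf K) * q)
        have b2 := hlip η hη' ((expU t : KInf K) * q) (q + e * v * ζ)
        have hdiff : (expU t : KInf K) * q - (q + e * v * ζ) = ((expU t : KInf K) - 1 - t) * q := by
          rw [hv, ht]
          simp only [zsmul_eq_mul]
          ring
        have hnd : ‖(expU t : KInf K) * q - (q + e * v * ζ)‖ ≤ Real.exp 2 * θ := by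
          rw [hdiff, norm_le_iff_normAtPlace]
          intro w'
          have h1 := normAtPlace_expU_sub_one_sub_le t (by linarith) w'
          rcases eq_or_ne w' w with rfl | hw'
          · rw [map_mul, hq, map_mul, ← hN, ← hρ]
            have h2 : normAtPlace w' t ^ 2 ≤ (2 * κ) ^ 2 :=
              pow_le_pow_left₀ (normAtPlace_nonneg _ _) ((normAtPlace_le_norm _ _).trans htn) 2
            have h3 : (2 * κ) ^ 2 * ρ ≤ θ := by
              have : (2 * κ) ^ 2 * ρ = ρ ^ (-(1 / 3) : ℝ) := by
                rw [hκ, mul_div_cancel₀ _ (two_ne_zero' ℝ), ← Real.rpow_natCast, ← Real.rpow_mul hρ0.le]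
                nth_rewrite 2 [← Real.rpow_one ρ]
                rw [← Real.rpow_add hρ0]
                norm_num
              rw [this]
              exact hle _ (by norm_num)
            calc _ ≤ (2 * κ) ^ 2 * (Real.exp 2 * ρ) := by
                  refine mul_le_mul (h1.trans h2) ?_ (by positivity) (by positivity)
                  exact mul_le_mul_of_nonneg_right hη1 hρ0.le
              _ = Real.exp 2 * ((2 * κ) ^ 2 * ρ) := by ring
              _ ≤ _ := by gcongr
          · have h0 : normAtPlace w' t = 0 := by
              rw [ht, ← Int.cast_smul_eq_zsmul ℝ, normAtPlace_smul,
                normAtPlace_eq_zero_of_ne_placeIdem hw', mul_zero]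
            rw [h0] at h1
            rw [map_mul]
            have h2 : normAtPlace w' ((expU t : KInf K) - 1 - t) = 0 :=
              le_antisymm (by simpa using h1) (normAtPlace_nonneg _ _)
            rw [h2, zero_mul]
            positivity
        change |g (expU (e * ζ) * η) - _| ≤ _
        rw [hgv]
        have b3 : L₂ * ‖e * ζ‖ ≤ L₂ * θ := by
          refine mul_le_mul_of_nonneg_left ?_ hL₂
          linarith [hen ζ]
        have b4 : L * ‖(expU t : KInf K) * q - (q + e * v * ζ)‖ ≤ L * (Real.exp 2 * θ) := by gcongr
        rw [abs_le] at b1 b2 ⊢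
        constructor <;> linarith [b1.1, b1.2, b2.1, b2.2]
    have hmain := abs_integral_ball_le C₃ hball hC₃ D₀ hD₀0 hD₀ (D η) (hcontη η) S L hS0 hL (hS η hη')
      (hlip η hη') γ (hmean a ha η) w v (by rw [hvn]; positivity) (B * M) (B * θ) hγ1 hγ2 (by positivity)
      κ hκ0 q
    have hfrac : B * M * D₀ / normAtPlace w v / κ ≤ Real.exp 2 * B * D₀ * θ := by
      rw [hvn]
      have h1 : M / (ρ * (2 * κ)) ≤ θ := by
        have : M / (ρ * (2 * κ)) = ρ ^ (-(1 / 6) : ℝ) := by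
          rw [hM, hκ, mul_div_cancel₀ _ (two_ne_zero' ℝ)]
          nth_rewrite 2 [← Real.rpow_one ρ]
          rw [← Real.rpow_add hρ0, ← Real.rpow_sub hρ0]
          norm_num
        rw [this]
        exact hle _ le_rfl
      have h2 : N⁻¹ ≤ Real.exp 2 := by
        rw [inv_le_comm₀ hN0 (Real.exp_pos _), ← Real.exp_neg]; exact hη2
      calc B * M * D₀ / (2 * (N * ρ)) / κ = N⁻¹ * B * D₀ * (M / (ρ * (2 * κ))) := by field_simp
        _ ≤ Real.exp 2 * B * D₀ * θ := by gcongr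
    have hmain' : |∫ ζ, D η (q + e * v * ζ) ∂β| ≤ C₃ * S * (Real.exp 2 * B * D₀ * θ) + L * (B * θ * D₀) := by
      refine hmain.trans ?_
      gcongr
    rw [abs_le] at hlin hmain' ⊢
    constructor <;> linarith [hlin.1, hlin.2, hmain'.1, hmain'.2]
  have hθ0 : 0 < θ := by positivity
  have step4 : |∫ η, ∫ ζ, g (expU (e * ζ) * η) ∂β ∂μ| ≤
      (L₂ * θ + L * (Real.exp 2 * θ)) + (C₃ * S * (Real.exp 2 * B * D₀ * θ) + L * (B * θ * D₀)) :=
    abs_integral_boxMeasure_le (by linarith) (by positivity) step3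
  rw [step2] at step1
  have step5 : |∫ η, g η ∂μ| ≤ C₂ * S * θ + ((L₂ * θ + L * (Real.exp 2 * θ)) +
      (C₃ * S * (Real.exp 2 * B * D₀ * θ) + L * (B * θ * D₀))) := by
    have : C₂ * S * κ ≤ C₂ * S * θ := by gcongr
    rw [abs_le] at step1 step4 ⊢
    constructor <;> linarith [step1.1, step1.2, step4.1, step4.2]
  refine step5.trans ?_
  rw [hSdef]
  exact error_terms_le C₂ C₃ (B * D₀) (Real.exp 2) B D₀ L L₂ θ hC₂ hC₃ (by positivity) (Real.exp_pos 2).le hB0 hD₀0.le hL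
    hL₂ hθ0.le rfl

end Core

section Unipotent

open scoped Classical
open NumberField.mixedEmbedding

variable {K : Type*} [Field K] [NumberField K]

/-- The one-parameter unipotent groups: upper triangular for `true`, lower triangular for `false`. -/
noncomputable def unip (b : Bool) (r : KInf K) : GInf K := bif b then uUp r else uLow r

variable (K) in
/-- The group `U` for `true`, the group `U⁻` for `false`. -/
noncomputable def unipGroup (b : Bool) : Subgroup (GInf K) := bif b then UUp K else ULow K

/-- The exponent `k` in `h_t u_r = u_(t ^ k r) h_t`. -/
def unipExp (b : Bool) : ℤ := bif b then 2 else -2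

theorem unipExp_eq (b : Bool) : unipExp b = 2 ∨ unipExp b = -2 := by
  cases b
  · exact Or.inr rfl
  · exact Or.inl rfl

theorem mem_unipGroup {b : Bool} {g : GInf K} : g ∈ unipGroup K b ↔ ∃ r, unip b r = g := by
  cases b <;> exact Iff.rfl

theorem val_mk_mul (A B : GInf K) : (A * B).1 = A.1 * B.1 := rfl

theorem unip_add (b : Bool) (r s : KInf K) : unip b (r + s) = unip b r * unip b s := by
  apply Subtype.ext
  rw [val_mk_mul]
  cases b
  · change !![1, 0; r + s, 1] = !![1, 0; r, 1] * !![1, 0; s, 1]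
    rw [Matrix.mul_fin_two]; simp
  · change !![1, r + s; 0, 1] = !![1, r; 0, 1] * !![1, s; 0, 1]
    rw [Matrix.mul_fin_two]; simp [add_comm]

theorem unip_zero (b : Bool) : unip b (0 : KInf K) = 1 := by
  have := unip_add b (0 : KInf K) 0
  rw [add_zero] at this
  exact left_eq_mul.1 this

theorem unip_nsmul (b : Bool) (n : ℕ) (r : KInf K) : unip b (n • r) = unip b r ^ n := by
  induction n with
  | zero => simp [unip_zero]
  | succ n ih => rw [succ_nsmul, unip_add, ih, pow_succ]

theorem hDiag_mul_unip (b : Bool) (η : (KInf K)ˣ) (r : KInf K) :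
    hDiag η * unip b r = unip b (((η ^ unipExp b : (KInf K)ˣ) : KInf K) * r) * hDiag η := by
  apply Subtype.ext
  rw [val_mk_mul, val_mk_mul]
  cases b
  · change !![(η : KInf K), 0; 0, ((η⁻¹ : (KInf K)ˣ) : KInf K)] * !![1, 0; r, 1] =
      !![1, 0; ((η ^ (-2 : ℤ) : (KInf K)ˣ) : KInf K) * r, 1] * !![(η : KInf K), 0; 0, ((η⁻¹ : (KInf K)ˣ) : KInf K)]
    have e : ((η ^ (-2 : ℤ) : (KInf K)ˣ) : KInf K) = ((η⁻¹ : (KInf K)ˣ) : KInf K) * ((η⁻¹ : (KInf K)ˣ) : KInf K) := by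
      rw [_root_.zpow_neg]; norm_cast; rw [pow_two, mul_inv]
    rw [e, Matrix.mul_fin_two, Matrix.mul_fin_two]
    have h : ((η⁻¹ : (KInf K)ˣ) : KInf K) * (η : KInf K) = 1 := Units.inv_mul η
    simp only [mul_one, mul_zero, add_zero, zero_mul, zero_add, one_mul]
    have k : ((η⁻¹ : (KInf K)ˣ) : KInf K) * ((η⁻¹ : (KInf K)ˣ) : KInf K) * r * (η : KInf K) =
        ((η⁻¹ : (KInf K)ˣ) : KInf K) * r := by
      linear_combination (((η⁻¹ : (KInf K)ˣ) : KInf K) * r) * h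
    rw [k]
  · change !![(η : KInf K), 0; 0, ((η⁻¹ : (KInf K)ˣ) : KInf K)] * !![1, r; 0, 1] =
      !![1, ((η ^ (2 : ℤ) : (KInf K)ˣ) : KInf K) * r; 0, 1] * !![(η : KInf K), 0; 0, ((η⁻¹ : (KInf K)ˣ) : KInf K)]
    have e : ((η ^ (2 : ℤ) : (KInf K)ˣ) : KInf K) = (η : KInf K) * (η : KInf K) := by
      norm_cast; rw [pow_two]
    rw [e, Matrix.mul_fin_two, Matrix.mul_fin_two]
    have h : ((η⁻¹ : (KInf K)ˣ) : KInf K) * (η : KInf K) = 1 := Units.inv_mul η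
    simp only [mul_one, mul_zero, add_zero, zero_mul, zero_add, one_mul]
    have k : (η : KInf K) * (η : KInf K) * r * ((η⁻¹ : (KInf K)ˣ) : KInf K) = (η : KInf K) * r := by
      linear_combination ((η : KInf K) * r) * h
    rw [k]

theorem continuous_unip (b : Bool) : Continuous (unip b : KInf K → GInf K) := by
  refine Continuous.subtype_mk (f := fun r => (unip b r).1) ?_ fun r => (unip b r).2
  refine continuous_matrix fun i j => ?_
  cases b
  · change Continuous fun r : KInf K => (!![1, 0; r, 1] : Matrix _ _ _) i j
    fin_cases i <;> fin_cases j <;> first | exact continuous_const | exact continuous_id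
  · change Continuous fun r : KInf K => (!![1, r; 0, 1] : Matrix _ _ _) i j
    fin_cases i <;> fin_cases j <;> first | exact continuous_const | exact continuous_id

theorem continuous_hDiag : Continuous (hDiag : (KInf K)ˣ → GInf K) := by
  refine Continuous.subtype_mk (f := fun r => (hDiag r).1) ?_ fun r => (hDiag r).2
  refine continuous_matrix fun i j => ?_
  change Continuous fun η : (KInf K)ˣ => (!![(η : KInf K), 0; 0, ((η⁻¹ : (KInf K)ˣ) : KInf K)] : Matrix _ _ _) i j
  fin_cases i <;> fin_cases j
  · exact Units.continuous_val (M := KInf K)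
  · exact continuous_const
  · exact continuous_const
  · exact (Units.continuous_val (M := KInf K)).comp continuous_inv

end Unipotent

section Topology

open scoped Classical
open NumberField.mixedEmbedding

variable {K : Type*} [Field K] [NumberField K]

instance : SecondCountableTopology (KInf K)ˣ :=
  (Units.isOpenEmbedding_val (R := KInf K)).isEmbedding.secondCountableTopology

instance : PolishSpace (KInf K)ˣ :=
  have := (Units.isOpenEmbedding_val (R := KInf K)).isOpen_range.polishSpace
  (Units.isOpenEmbedding_val (R := KInf K)).isEmbedding.toHomeomorph.isClosedEmbedding.polishSpace

instance : SecondCountableTopology (GInf K) := by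
  have : SecondCountableTopology (Matrix (Fin 2) (Fin 2) (KInf K)) :=
    inferInstanceAs (SecondCountableTopology (Fin 2 → Fin 2 → KInf K))
  exact (Matrix.SpecialLinearGroup.isClosedEmbedding_val (n := Fin 2) (R := KInf K)).isEmbedding.secondCountableTopology

instance (Γ : Subgroup SL(2, K)) : SecondCountableTopology (Y Γ) :=
  inferInstanceAs (SecondCountableTopology (GInf K ⧸ latticeOf Γ))

variable (K) in
/-- `SL₂(𝓞)` as a subgroup of `SL₂(k)`. -/
noncomputable def integralGroup : Subgroup SL(2, K) :=
  (Matrix.SpecialLinearGroup.map (n := Fin 2) (algebraMap (𝓞 K) K)).range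

theorem mem_integerLattice {x : KInf K} :
    x ∈ mixedEmbedding.integerLattice K ↔ ∃ o : 𝓞 K, mixedEmbedding K o = x := Iff.rfl

theorem discreteTopology_latticeOf_integralGroup : DiscreteTopology (latticeOf (integralGroup K)) := by
  have hmem : ∀ g : latticeOf (integralGroup K), ∀ i j, g.1.1 i j ∈ mixedEmbedding.integerLattice K := by
    rintro ⟨g, x, ⟨y, rfl⟩, rfl⟩ i j
    exact mem_integerLattice.2 ⟨y.1 i j, rfl⟩
  let e : latticeOf (integralGroup K) → Fin 2 → Fin 2 → mixedEmbedding.integerLattice K :=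
    fun g i j => ⟨g.1.1 i j, hmem g i j⟩
  refine DiscreteTopology.of_continuous_injective (f := e) ?_ ?_
  · refine continuous_pi fun i => continuous_pi fun j => Continuous.subtype_mk ?_ _
    exact (continuous_apply_apply i j).comp ((Matrix.SpecialLinearGroup.isClosedEmbedding_val (n := Fin 2) (R := KInf K)).continuous.comp
      continuous_subtype_val)
  · intro g h hgh
    refine Subtype.ext (Subtype.ext ?_)
    ext1 i j
    exact congrArg Subtype.val (congrFun (congrFun hgh i) j)

theorem commensurable_latticeOf {Γ : Subgroup SL(2, K)} (hΓ : IsArithmetic Γ) :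
    Subgroup.Commensurable (latticeOf Γ) (latticeOf (integralGroup K)) := by
  have hinj : Function.Injective (Matrix.SpecialLinearGroup.map (n := Fin 2) (mixedEmbedding K)) := by
    intro g h hgh
    refine Subtype.ext ?_
    ext1 i j
    have := congrArg (fun x : GInf K => x.1 i j) hgh
    exact mixedEmbedding_injective K this
  constructor
  · rw [latticeOf, latticeOf, Subgroup.relIndex_map_map_of_injective _ _ hinj]; exact hΓ.1
  · rw [latticeOf, latticeOf, Subgroup.relIndex_map_map_of_injective _ _ hinj]; exact hΓ.2

theorem isClosed_latticeOf {Γ : Subgroup SL(2, K)} (hΓ : IsArithmetic Γ) :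
    IsClosed (latticeOf Γ : Set (GInf K)) := by
  have h1 := discreteTopology_latticeOf_integralGroup (K := K)
  have h2 : DiscreteTopology (latticeOf Γ) := (commensurable_latticeOf hΓ).discreteTopology_iff.2 h1
  exact Subgroup.isClosed_of_discrete

theorem t2Space_Y {Γ : Subgroup SL(2, K)} (hΓ : IsArithmetic Γ) : T2Space (Y Γ) := by
  rw [t2Space_iff_of_isOpenQuotientMap (QuotientGroup.isOpenQuotientMap_mk (N := latticeOf Γ))]
  have : {q : GInf K × GInf K | (q.1 : GInf K ⧸ latticeOf Γ) = q.2} =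
      (fun q : GInf K × GInf K => q.1⁻¹ * q.2) ⁻¹' (latticeOf Γ) := by
    ext q
    exact QuotientGroup.eq
  rw [this]
  exact (isClosed_latticeOf hΓ).preimage (by fun_prop)

theorem continuous_toY (Γ : Subgroup SL(2, K)) : Continuous (toY Γ) := QuotientGroup.continuous_mk

theorem smul_toY (Γ : Subgroup SL(2, K)) (g h : GInf K) : g • toY Γ h = toY Γ (g * h) := rfl

theorem toY_mul_of_mem {Γ : Subgroup SL(2, K)} {g h : GInf K} (hh : h ∈ latticeOf Γ) : toY Γ (g * h) = toY Γ g :=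
  QuotientGroup.mk_mul_of_mem g hh

instance (Γ : Subgroup SL(2, K)) : ContinuousSMul (GInf K) (Y Γ) :=
  inferInstanceAs (ContinuousSMul (GInf K) (GInf K ⧸ latticeOf Γ))

theorem exists_unip_mem_latticeOf {Γ : Subgroup SL(2, K)} (hΓ : IsArithmetic Γ) :
    ∃ d : ℕ, d ≠ 0 ∧ ∀ (b : Bool) (o : 𝓞 K), unip b ((d : KInf K) * mixedEmbedding K o) ∈ latticeOf Γ := by
  have h := (commensurable_latticeOf hΓ).1
  set n := (latticeOf Γ).relIndex (latticeOf (integralGroup K)) with hn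
  refine ⟨n.factorial, n.factorial_ne_zero, fun b o => ?_⟩
  have hmem : unip b (mixedEmbedding K o) ∈ latticeOf (integralGroup K) := by
    let y : SL(2, 𝓞 K) := bif b then ⟨!![1, o; 0, 1], by simp⟩ else ⟨!![1, 0; o, 1], by simp⟩
    refine ⟨Matrix.SpecialLinearGroup.map (n := Fin 2) (algebraMap (𝓞 K) K) y, ⟨y, rfl⟩, ?_⟩
    refine Subtype.ext ?_
    ext1 i j
    change mixedEmbedding K (algebraMap (𝓞 K) K (y.1 i j)) = _
    cases b
    · change mixedEmbedding K (algebraMap (𝓞 K) K ((!![1, 0; o, 1] : Matrix _ _ _) i j)) =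
        (!![1, 0; mixedEmbedding K o, 1] : Matrix _ _ _) i j
      fin_cases i <;> fin_cases j <;> simp
    · change mixedEmbedding K (algebraMap (𝓞 K) K ((!![1, o; 0, 1] : Matrix _ _ _) i j)) =
        (!![1, mixedEmbedding K o; 0, 1] : Matrix _ _ _) i j
      fin_cases i <;> fin_cases j <;> simp
  have hp := Subgroup.pow_mem_of_relIndex_ne_zero_of_dvd h hmem (n := n.factorial)
    fun m hm hmn => Nat.dvd_factorial hm hmn
  rw [← unip_nsmul, nsmul_eq_mul] at hp
  exact hp.1

end Topology

section HomogeneousMeasure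

open scoped Classical Pointwise
open NumberField.mixedEmbedding

variable {K : Type*} [Field K] [NumberField K]

theorem fundMeasure_preimage_add (A : Set (KInf K)) (hA : MeasurableSet A)
    (hper : ∀ (o : 𝓞 K) (x : KInf K), mixedEmbedding K o + x ∈ A ↔ x ∈ A) (r : KInf K) :
    fundMeasure K ((fun p => r + p) ⁻¹' A) = fundMeasure K A := by
  have hP := fundamentalDomain_integerLattice K
  set P := ZSpan.fundamentalDomain (latticeBasis K) with hPdef
  have hPm : MeasurableSet P := ZSpan.fundamentalDomain_measurableSet (latticeBasis K)
  have hP' : IsAddFundamentalDomain (mixedEmbedding.integerLattice K) (r +ᵥ P) volume := hP.vadd_of_comm r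
  have : VAddInvariantMeasure (mixedEmbedding.integerLattice K) (mixedSpace K) volume :=
    ⟨fun g s _ => measure_preimage_add volume g.1 s⟩
  have h1 : volume (A ∩ (r +ᵥ P)) = volume (A ∩ P) := by
    refine hP'.measure_set_eq hP hA fun g => ?_
    obtain ⟨o, ho⟩ := mem_integerLattice.1 g.2
    ext x
    change g.1 + x ∈ A ↔ x ∈ A
    rw [← ho]
    exact hper o x
  rw [fundMeasure, ProbabilityTheory.cond_apply hPm, ProbabilityTheory.cond_apply hPm]
  congr 1
  have h2 : P ∩ (fun p => r + p) ⁻¹' A = (fun p => r + p) ⁻¹' (A ∩ (r +ᵥ P)) := by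
    ext x
    simp only [Set.mem_inter_iff, Set.mem_preimage, Set.mem_vadd_set_iff_neg_vadd_mem, vadd_eq_add,
      neg_add_cancel_left]
    exact and_comm
  rw [h2, measure_preimage_add, h1, Set.inter_comm]

/-- The image in `Y` of the uniform measure on the box `q + c P` of unipotent matrices. -/
noncomputable def unipMeasure (Γ : Subgroup SL(2, K)) (b : Bool) (c q : KInf K) : Measure (Y Γ) :=
  (fundMeasure K).map fun p => toY Γ (unip b (q + c * p))

variable {Γ : Subgroup SL(2, K)} {b : Bool}

theorem continuous_toY_unip (c q : KInf K) : Continuous fun p : KInf K => toY Γ (unip b (q + c * p)) :=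
  (continuous_toY Γ).comp ((continuous_unip b).comp (by fun_prop))

instance (c q : KInf K) : IsProbabilityMeasure (unipMeasure Γ b c q) :=
  Measure.isProbabilityMeasure_map (continuous_toY_unip c q).measurable.aemeasurable

theorem unipMeasure_eq {c : KInf K} (hc : IsUnit c)
    (hΓ : ∀ o : 𝓞 K, unip b (c * mixedEmbedding K o) ∈ latticeOf Γ) (q : KInf K) :
    unipMeasure Γ b c q = unipMeasure Γ b c 0 := by
  obtain ⟨c, rfl⟩ := hc
  ext s hs
  rw [unipMeasure, unipMeasure, Measure.map_apply (continuous_toY_unip _ _).measurable hs,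
    Measure.map_apply (continuous_toY_unip _ _).measurable hs]
  set A : Set (KInf K) := (fun p => toY Γ (unip b (0 + (c : KInf K) * p))) ⁻¹' s with hA
  have := fundMeasure_preimage_add A ((continuous_toY_unip _ _).measurable hs) (fun o x => by
    have : toY Γ (unip b (0 + (c : KInf K) * (mixedEmbedding K o + x))) = toY Γ (unip b (0 + (c : KInf K) * x)) := by
      rw [zero_add, zero_add, mul_add, add_comm, unip_add, toY_mul_of_mem (hΓ o)]
    rw [hA, Set.mem_preimage, Set.mem_preimage, this]) ((c⁻¹ : (KInf K)ˣ) * q)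
  rw [← this]
  congr 1
  ext p
  simp only [Set.mem_preimage, hA, mul_add, zero_add, Units.mul_inv_cancel_left]

theorem isHomogeneous_unipMeasure (hT : T2Space (Y Γ)) {c : KInf K} (hc : IsUnit c)
    (hΓ : ∀ o : 𝓞 K, unip b (c * mixedEmbedding K o) ∈ latticeOf Γ) :
    IsHomogeneous Γ (unipGroup K b) (unipMeasure Γ b c 0) := by
  refine ⟨inferInstance, ?_, ?_⟩
  · intro g hg
    obtain ⟨r, rfl⟩ := mem_unipGroup.1 hg
    rw [unipMeasure, Measure.map_map (continuous_const_smul _).measurable (continuous_toY_unip _ _).measurable]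
    rw [← unipMeasure, ← unipMeasure_eq hc hΓ r, unipMeasure]
    congr 1
    funext p
    simp only [Function.comp_apply, zero_add, smul_toY, unip_add]
  · set P := closure (ZSpan.fundamentalDomain (latticeBasis K)) with hP
    have hPc : IsCompact P := (ZSpan.fundamentalDomain_isBounded (latticeBasis K)).isCompact_closure
    set S := (fun p : KInf K => toY Γ (unip b (0 + c * p))) '' P with hS
    have hSm : MeasurableSet S := (hPc.image (continuous_toY_unip c 0)).isClosed.measurableSet
    have hsub : (imageY Γ (unipGroup K b))ᶜ ⊆ Sᶜ := by
      rw [Set.compl_subset_compl]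
      rintro _ ⟨p, -, rfl⟩
      exact ⟨_, mem_unipGroup.2 ⟨_, rfl⟩, rfl⟩
    refine measure_mono_null hsub ?_
    rw [unipMeasure, Measure.map_apply (continuous_toY_unip c 0).measurable hSm.compl]
    have : ∀ᵐ p ∂(fundMeasure K), p ∈ ZSpan.fundamentalDomain (latticeBasis K) :=
      ProbabilityTheory.ae_cond_mem (ZSpan.fundamentalDomain_measurableSet (latticeBasis K))
    rw [← nonpos_iff_eq_zero]
    refine (measure_mono ?_).trans (le_of_eq (ae_iff.1 this))
    intro p hp hp'
    exact hp ⟨p, subset_closure hp', rfl⟩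

theorem IsHomogeneous.eq_unipMeasure {μ : Measure (Y Γ)} (hμ : IsHomogeneous Γ (unipGroup K b) μ) {c : KInf K}
    (hc : IsUnit c) (hΓ : ∀ o : 𝓞 K, unip b (c * mixedEmbedding K o) ∈ latticeOf Γ) (q : KInf K) :
    μ = unipMeasure Γ b c q := by
  obtain ⟨hprob, hinv, hnull⟩ := hμ
  rw [unipMeasure_eq hc hΓ q]
  ext s hs
  have hact : Continuous fun x : KInf K × Y Γ => unip b (c * x.1) • x.2 :=
    ((continuous_unip b).comp (continuous_const.mul continuous_fst)).smul continuous_snd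
  have hT : MeasurableSet ((fun x : KInf K × Y Γ => unip b (c * x.1) • x.2) ⁻¹' s) := hact.measurable hs
  have e1 := Measure.prod_apply (μ := fundMeasure K) (ν := μ) hT
  have e2 := Measure.prod_apply_symm (μ := fundMeasure K) (ν := μ) hT
  have e3 : ∀ p : KInf K, μ (Prod.mk p ⁻¹' ((fun x : KInf K × Y Γ => unip b (c * x.1) • x.2) ⁻¹' s)) = μ s := by
    intro p
    conv_rhs => rw [← hinv (unip b (c * p)) (mem_unipGroup.2 ⟨_, rfl⟩)]
    rw [Measure.map_apply (continuous_const_smul _).measurable hs]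
    rfl
  have e4 : ∀ᵐ y ∂μ, fundMeasure K ((fun x => (x, y)) ⁻¹' ((fun x : KInf K × Y Γ => unip b (c * x.1) • x.2) ⁻¹' s)) =
      unipMeasure Γ b c 0 s := by
    have hmem : ∀ᵐ y ∂μ, y ∈ imageY Γ (unipGroup K b) := ae_iff.2 hnull
    filter_upwards [hmem] with y hy
    obtain ⟨g, hg, rfl⟩ := hy
    obtain ⟨r, rfl⟩ := mem_unipGroup.1 hg
    rw [← unipMeasure_eq hc hΓ r, unipMeasure, Measure.map_apply (continuous_toY_unip c r).measurable hs]
    congr 1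
    ext p
    simp only [Set.mem_preimage, smul_toY, ← unip_add, add_comm]
  rw [lintegral_congr_ae (Filter.Eventually.of_forall e3), lintegral_const, measure_univ, mul_one] at e1
  rw [lintegral_congr_ae e4, lintegral_const, measure_univ, mul_one] at e2
  rw [← e1, e2]

theorem homMeasure_spec {E : Subgroup (GInf K)} (h : ∃ μ, IsHomogeneous Γ E μ) :
    IsHomogeneous Γ E (homMeasure Γ E) := by
  rw [homMeasure, dif_pos h]
  exact h.choose_spec

theorem homMeasure_unipGroup (hT : T2Space (Y Γ)) {c : KInf K} (hc : IsUnit c)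
    (hΓ : ∀ o : 𝓞 K, unip b (c * mixedEmbedding K o) ∈ latticeOf Γ) (q : KInf K) :
    homMeasure Γ (unipGroup K b) = unipMeasure Γ b c q :=
  (homMeasure_spec ⟨_, isHomogeneous_unipMeasure hT hc hΓ⟩).eq_unipMeasure hc hΓ q

/-- Elements of `Γ ∩ H` preserve the invariant measure of `[U]`. -/
theorem map_hDiag_homMeasure (hT : T2Space (Y Γ)) {c : KInf K} (hc : IsUnit c)
    (hΓ : ∀ o : 𝓞 K, unip b (c * mixedEmbedding K o) ∈ latticeOf Γ) {t : (KInf K)ˣ}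
    (ht : hDiag t ∈ latticeOf Γ) :
    (homMeasure Γ (unipGroup K b)).map (fun y => hDiag t • y) = homMeasure Γ (unipGroup K b) := by
  set s : (KInf K)ˣ := t ^ unipExp b with hs
  have hc' : IsUnit ((s : KInf K) * c) := s.isUnit.mul hc
  have hΓ' : ∀ o : 𝓞 K, unip b ((s : KInf K) * c * mixedEmbedding K o) ∈ latticeOf Γ := by
    intro o
    have := mul_mem (mul_mem ht (hΓ o)) (inv_mem ht)
    rwa [hDiag_mul_unip, mul_inv_cancel_right, ← hs, ← mul_assoc] at this
  conv_lhs => rw [homMeasure_unipGroup hT hc hΓ 0]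
  rw [homMeasure_unipGroup hT hc' hΓ' 0, unipMeasure, unipMeasure,
    Measure.map_map (continuous_const_smul _).measurable (continuous_toY_unip _ _).measurable]
  congr 1
  funext p
  simp only [Function.comp_apply, zero_add, smul_toY]
  rw [hDiag_mul_unip, toY_mul_of_mem ht, mul_assoc]

end HomogeneousMeasure

section Bind

variable {α β γ : Type*} [MeasurableSpace α] [MeasurableSpace β] [MeasurableSpace γ]

theorem integral_bind_of_bounded {m : Measure α} [IsFiniteMeasure m] {κ : α → Measure β} (hκ : AEMeasurable κ m)
    (h1 : ∀ a, κ a Set.univ ≤ 1) {f : β → ℝ} (hf : Measurable f) {C : ℝ} (hC : ∀ y, |f y| ≤ C) :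
    Integrable (fun a => ∫ y, f y ∂(κ a)) m ∧ ∫ y, f y ∂(m.bind κ) = ∫ a, ∫ y, f y ∂(κ a) ∂m := by
  have hk := hκ.measurable_mk
  let κ' : ProbabilityTheory.Kernel α β := ⟨hκ.mk, hk⟩
  have hae : ∀ᵐ a ∂m, κ a = κ' a := hκ.ae_eq_mk
  have h0 : m.bind κ = m.bind κ' := Measure.bind_congr_right hae
  have hcongr : (fun a => ∫ y, f y ∂(κ a)) =ᵐ[m] fun a => ∫ y, f y ∂(κ' a) := by
    filter_upwards [hae] with a ha; rw [ha]
  have hbd : ∀ a, ‖∫ y, f y ∂(κ a)‖ ≤ |C| := by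
    intro a
    have : IsFiniteMeasure (κ a) := ⟨(h1 a).trans_lt ENNReal.one_lt_top⟩
    refine (norm_integral_le_of_norm_le_const (C := |C|)
      (Filter.Eventually.of_forall fun y => (hC y).trans (le_abs_self C))).trans ?_
    refine mul_le_of_le_one_right (abs_nonneg C) ?_
    exact ENNReal.toReal_le_of_le_ofReal zero_le_one (by simpa using h1 a)
  refine ⟨?_, ?_⟩
  · refine Integrable.of_bound ?_ |C| (Filter.Eventually.of_forall hbd)
    exact ⟨_, hf.stronglyMeasurable.integral_kernel (κ := κ'), hcongr⟩
  · have hfin : IsFiniteMeasure (m.bind κ) := by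
      refine ⟨?_⟩
      rw [Measure.bind_apply MeasurableSet.univ hκ]
      refine (lintegral_mono h1).trans_lt ?_
      rw [lintegral_const, one_mul]
      exact measure_lt_top m _
    have hint : Integrable f (m.bind κ) := integrable_of_abs_le hf hC
    rw [h0] at hint ⊢
    rw [integral_congr_ae hcongr]
    rw [Measure.comp_eq_comp_const_apply] at hint ⊢
    rw [ProbabilityTheory.Kernel.integral_comp hint]
    simp

theorem aemeasurable_of_comp [StandardBorelSpace α] [MeasurableSpace.CountablySeparated β] {μ : Measure β} {e : α → β}
    {g : β → γ} (he : Measurable e) (hge : Measurable fun x => g (e x)) (hμ : μ (Set.range e)ᶜ = 0) :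
    AEMeasurable g μ := by
  have : MeasurableSpace.CountablySeparated (Set.range e) :=
    MeasurableSpace.CountablySeparated.subtype_iff.2
      (HasCountableSeparatingOn.mono (t₁ := Set.univ) (p₁ := MeasurableSet) (fun _ h => h) (Set.subset_univ _))
  have hres := (he.measurable_comp_iff_restrict (g := g)).1 hge
  obtain ⟨T, hTm, hT0, hsub⟩ : ∃ T : Set β, MeasurableSet T ∧ μ Tᶜ = 0 ∧ T ⊆ Set.range e := by
    refine ⟨(toMeasurable μ (Set.range e)ᶜ)ᶜ, (measurableSet_toMeasurable _ _).compl, ?_, ?_⟩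
    · rw [compl_compl, measure_toMeasurable, hμ]
    · exact Set.compl_subset_comm.1 (subset_toMeasurable μ (Set.range e)ᶜ)
  have hμr : μ.restrict T = μ := Measure.restrict_eq_self_of_ae_mem (ae_iff.2 hT0)
  have hmeas : Measurable fun x : T => g x := hres.comp (measurable_inclusion hsub)
  have key : AEMeasurable g (μ.restrict T) := aemeasurable_restrict_of_measurable_subtype hTm hmeas
  rwa [hμr] at key

theorem measurable_map_of_uncurry (μ : Measure α) [SFinite μ] {F : γ → α → β}
    (hF : Measurable (Function.uncurry F)) : Measurable fun x => μ.map (F x) := by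
  refine Measure.measurable_of_measurable_coe _ fun s hs => ?_
  have : (fun x => (μ.map (F x)) s) = fun x => μ (Prod.mk x ⁻¹' (Function.uncurry F ⁻¹' s)) := by
    funext x
    rw [Measure.map_apply hF.of_uncurry_left hs]
    rfl
  rw [this]
  exact measurable_measure_prodMk_left (hF hs)

theorem map_univ_le_one (μ : Measure α) (h : μ Set.univ ≤ 1) (F : α → β) : (μ.map F) Set.univ ≤ 1 := by
  by_cases hF : AEMeasurable F μ
  · rwa [Measure.map_apply_of_aemeasurable hF MeasurableSet.univ]
  · rw [Measure.map_of_not_aemeasurable hF]; simp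

end Bind

section Disintegration

open scoped Classical
open NumberField.mixedEmbedding

variable {K : Type*} [Field K] [NumberField K] {Γ : Subgroup SL(2, K)} {b : Bool}

theorem measurable_mz (ε : ℝ) : Measurable (mz Γ ε) := by
  refine measurable_map_of_uncurry (boxMeasure K ε) (F := fun (z : Y Γ) (h : (KInf K)ˣ) => hDiag h • z) ?_
  refine Continuous.measurable ?_
  exact (continuous_hDiag.comp continuous_snd).smul continuous_fst

theorem measurable_map_hDiag (ε : ℝ) (μ : Measure (Y Γ)) [IsFiniteMeasure μ] :
    Measurable fun τ : (KInf K)ˣ => ((boxMeasure K ε).prod μ).map fun p => (hDiag τ * hDiag p.1) • p.2 := by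
  refine measurable_map_of_uncurry ((boxMeasure K ε).prod μ)
    (F := fun (τ : (KInf K)ˣ) (p : (KInf K)ˣ × Y Γ) => (hDiag τ * hDiag p.1) • p.2) ?_
  refine Continuous.measurable ?_
  have h1 := continuous_hDiag (K := K)
  exact ((h1.comp continuous_fst).mul (h1.comp (continuous_fst.comp continuous_snd))).smul
    (continuous_snd.comp continuous_snd)

theorem lift_spec {z : Y Γ} (hz : z ∈ imageY Γ (H1 K)) :
    ∃ τ : (KInf K)ˣ, mixedEmbedding.norm (τ : KInf K) = 1 ∧ lift Γ z = hDiag τ ∧ toY Γ (hDiag τ) = z := by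
  have h : ∃ g ∈ H1 K, toY Γ g = z := hz
  have hl : lift Γ z = h.choose := by rw [lift, dif_pos h]
  obtain ⟨⟨τ, hτ, hτ'⟩, h2⟩ := h.choose_spec
  exact ⟨τ, hτ, by rw [hl, hτ'], by rw [hτ', h2]⟩

theorem mzUnip_toY (hT : T2Space (Y Γ)) {c : KInf K} (hc : IsUnit c)
    (hΓ : ∀ o : 𝓞 K, unip b (c * mixedEmbedding K o) ∈ latticeOf Γ) (ε : ℝ) {τ : (KInf K)ˣ}
    (hτ : mixedEmbedding.norm (τ : KInf K) = 1) :
    mzUnip Γ (unipGroup K b) ε (toY Γ (hDiag τ)) =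
      ((boxMeasure K ε).prod (homMeasure Γ (unipGroup K b))).map fun p => (hDiag τ * hDiag p.1) • p.2 := by
  have hprob : IsProbabilityMeasure (homMeasure Γ (unipGroup K b)) :=
    (homMeasure_spec ⟨_, isHomogeneous_unipMeasure hT hc hΓ⟩).1
  obtain ⟨τ', hτ', hl, hz⟩ := lift_spec (Γ := Γ) (z := toY Γ (hDiag τ)) ⟨_, ⟨τ, hτ, rfl⟩, rfl⟩
  have hmem : hDiag (τ⁻¹ * τ') ∈ latticeOf Γ := by
    rw [map_mul, map_inv]
    exact QuotientGroup.eq.1 hz.symm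
  have hinv := map_hDiag_homMeasure hT hc hΓ hmem
  set μ := homMeasure Γ (unipGroup K b) with hμ
  have hms : Measurable fun y : Y Γ => hDiag (τ⁻¹ * τ') • y := (continuous_const_smul _).measurable
  have hprod : (boxMeasure K ε).prod μ =
      ((boxMeasure K ε).prod μ).map (Prod.map id fun y => hDiag (τ⁻¹ * τ') • y) := by
    rw [← Measure.map_prod_map _ _ measurable_id hms, Measure.map_id, hinv]
  rw [mzUnip, hl]
  conv_rhs => rw [hprod]
  have hm2 : Measurable fun p : (KInf K)ˣ × Y Γ => (hDiag τ * hDiag p.1) • p.2 := by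
    refine Continuous.measurable ?_
    exact (continuous_const.mul (continuous_hDiag.comp continuous_fst)).smul continuous_snd
  rw [Measure.map_map hm2 (measurable_id.prodMap hms)]
  congr 1
  funext p
  simp only [Function.comp_apply, Prod.map_fst, Prod.map_snd, id, smul_smul]
  congr 1
  rw [← map_mul, ← map_mul, ← map_mul]
  congr 1
  rw [mul_mul_mul_comm, mul_inv_cancel, one_mul, mul_comm]

theorem aemeasurable_mzUnip (hT : T2Space (Y Γ)) {c : KInf K} (hc : IsUnit c)
    (hΓ : ∀ o : 𝓞 K, unip b (c * mixedEmbedding K o) ∈ latticeOf Γ) (ε : ℝ) {μ : Measure (Y Γ)}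
    (hμ : IsHomogeneous Γ (H1 K) μ) : AEMeasurable (mzUnip Γ (unipGroup K b) ε) μ := by
  have hprob : IsProbabilityMeasure (homMeasure Γ (unipGroup K b)) :=
    (homMeasure_spec ⟨_, isHomogeneous_unipMeasure hT hc hΓ⟩).1
  have hclosed : IsClosed {τ : (KInf K)ˣ | mixedEmbedding.norm (τ : KInf K) = 1} := by
    refine isClosed_singleton.preimage (f := fun τ : (KInf K)ˣ => mixedEmbedding.norm (τ : KInf K)) ?_
    exact (mixedEmbedding.continuous_norm K).comp Units.continuous_val
  have hSB : StandardBorelSpace {τ : (KInf K)ˣ // mixedEmbedding.norm (τ : KInf K) = 1} :=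
    hclosed.measurableSet.standardBorel
  refine aemeasurable_of_comp (e := fun τ : {τ : (KInf K)ˣ // mixedEmbedding.norm (τ : KInf K) = 1} =>
    toY Γ (hDiag τ.1)) ?_ ?_ ?_
  · exact ((continuous_toY Γ).comp (continuous_hDiag.comp continuous_subtype_val)).measurable
  · have e : (fun τ : {τ : (KInf K)ˣ // mixedEmbedding.norm (τ : KInf K) = 1} =>
        mzUnip Γ (unipGroup K b) ε (toY Γ (hDiag τ.1))) = fun τ =>
        ((boxMeasure K ε).prod (homMeasure Γ (unipGroup K b))).map fun p => (hDiag τ.1 * hDiag p.1) • p.2 := by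
      funext τ
      exact mzUnip_toY hT hc hΓ ε τ.2
    rw [e]
    exact (measurable_map_hDiag ε (homMeasure Γ (unipGroup K b))).comp measurable_subtype_coe
  · refine measure_mono_null (Set.compl_subset_compl.2 ?_) hμ.2.2
    rintro _ ⟨_, ⟨τ, hτ, rfl⟩, rfl⟩
    exact ⟨⟨τ, hτ⟩, rfl⟩

end Disintegration

section OrbitBound

open scoped Classical
open NumberField.mixedEmbedding

variable {K : Type*} [Field K] [NumberField K] {Γ : Subgroup SL(2, K)} {b : Bool}

theorem normAtPlace_zpow_hBox_le {m : ℤ} (hm : m = 2 ∨ m = -2) {η : (KInf K)ˣ} {ε : ℝ} (hη : η ∈ hBox K ε)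
    (w : InfinitePlace K) : normAtPlace w ((η ^ m : (KInf K)ˣ) : KInf K) ≤ Real.exp (2 * ε) := by
  obtain ⟨h1, h2⟩ := normAtPlace_hBox hη w
  have hx0 : 0 < normAtPlace w (η : KInf K) := normAtPlace_unit_pos w η
  have e : Real.exp (2 * ε) = Real.exp ε ^ 2 := by rw [← Real.exp_nat_mul]; norm_num
  rw [normAtPlace_unit_zpow, e]
  rcases hm with rfl | rfl
  · exact_mod_cast pow_le_pow_left₀ hx0.le h1 2
  · have e' : normAtPlace w (η : KInf K) ^ (-2 : ℤ) = ((normAtPlace w (η : KInf K))⁻¹) ^ 2 := by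
      rw [_root_.zpow_neg, inv_pow]; norm_cast
    rw [e']
    refine pow_le_pow_left₀ (by positivity) ?_ 2
    rw [inv_le_comm₀ hx0 (Real.exp_pos _), ← Real.exp_neg]
    exact h2

theorem unip_mul_hDiag (b : Bool) (r : KInf K) (η : (KInf K)ˣ) :
    unip b r * hDiag η = hDiag η * unip b (((η ^ (-unipExp b) : (KInf K)ˣ) : KInf K) * r) := by
  rw [hDiag_mul_unip, ← mul_assoc, ← Units.val_mul, ← _root_.zpow_add, add_neg_cancel, zpow_zero, Units.val_one, one_mul]

set_option maxHeartbeats 600000 in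
/-- Comparison of a translate of the closed orbit `H[ε] τ Γ` by `h_x u_R` with its limit, uniformly in `τ`. -/
theorem exists_orbit_bound_at (hΓ : IsArithmetic Γ) (b : Bool) {ε : ℝ} (hε1 : ε < 1) :
    ∃ C : ℝ, 0 ≤ C ∧ ∀ φ : Y Γ → ℝ, Continuous φ → ∀ S₀ : ℝ, (∀ y, |φ y| ≤ S₀) → ∀ A : ℝ, 0 ≤ A →
      (∀ (r : KInf K) (y : Y Γ), |φ (unip b r • y) - φ y| ≤ A * ‖r‖) → (∀ (ζ : KInf K) (y : Y Γ), |φ (hDiag (expU ζ) • y) - φ y| ≤ A * ‖ζ‖) →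
      ∀ (x : (KInf K)ˣ) (T : ℝ), (∀ w, normAtPlace w ((x ^ unipExp b : (KInf K)ˣ) : KInf K) ≤ T) →
      ∀ (τ : (KInf K)ˣ), mixedEmbedding.norm (τ : KInf K) = 1 → ∀ R : KInf K,
      |(∫ η, φ ((hDiag x * unip b R) • hDiag η • toY Γ (hDiag τ)) ∂(boxMeasure K ε)) -
        ∫ η, ∫ y, φ (hDiag x • (hDiag τ * hDiag η) • y) ∂(homMeasure Γ (unipGroup K b)) ∂(boxMeasure K ε)| ≤
          C * (A * T) ∧
      ∀ w, 1 ≤ normAtPlace w R →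
        |(∫ η, φ ((hDiag x * unip b R) • hDiag η • toY Γ (hDiag τ)) ∂(boxMeasure K ε)) -
          ∫ η, ∫ y, φ (hDiag x • (hDiag τ * hDiag η) • y) ∂(homMeasure Γ (unipGroup K b)) ∂(boxMeasure K ε)| ≤
          C * (A * T + A) * normAtPlace w R ^ (-(1 / (6 * (Module.finrank ℚ K : ℝ)))) := by
  have hT2 := t2Space_Y hΓ
  obtain ⟨d, hd, hdΓ⟩ := exists_unip_mem_latticeOf hΓ
  have hm : -unipExp b = 2 ∨ -unipExp b = -2 := by
    rcases unipExp_eq b with h | h <;> rw [h] <;> simp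
  obtain ⟨C, hC, hcore⟩ := exists_equidistribution_bound (K := K) hm hε1 d
  refine ⟨C * Real.exp 4, by positivity, ?_⟩
  intro φ hφ S₀ hS₀ A hA hU hH x T hT τ hτ R
  have hT0 : 0 ≤ T := by
    obtain ⟨w⟩ : Nonempty (InfinitePlace K) := inferInstance
    exact (normAtPlace_nonneg w _).trans (hT w)
  set μ := homMeasure Γ (unipGroup K b) with hμ
  have hda : ∀ a : 𝓞 K, a ≠ 0 → IsUnit ((d : KInf K) * mixedEmbedding K a) := by
    intro a ha
    have h1 : IsUnit ((d : K) * (a : K)) := by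
      rw [isUnit_iff_ne_zero]
      exact mul_ne_zero (by exact_mod_cast hd) (by exact_mod_cast ha)
    have := h1.map (mixedEmbedding K)
    rwa [map_mul, map_natCast] at this
  have hdaΓ : ∀ a o : 𝓞 K, unip b ((d : KInf K) * mixedEmbedding K a * mixedEmbedding K o) ∈ latticeOf Γ := by
    intro a o
    have := hdΓ b (a * o)
    rwa [show ((a * o : 𝓞 K) : K) = (a : K) * (o : K) from rfl, map_mul, ← mul_assoc] at this
  have hprob : IsProbabilityMeasure μ :=
    (homMeasure_spec ⟨_, isHomogeneous_unipMeasure hT2 (hda 1 one_ne_zero) (hdaΓ 1)⟩).1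
  set σ : (KInf K)ˣ := τ ^ unipExp b with hσ
  have hσ1 : mixedEmbedding.norm (σ : KInf K) = 1 := by
    have : ∀ n : ℕ, mixedEmbedding.norm ((τ ^ n : (KInf K)ˣ) : KInf K) = 1 := by
      intro n; rw [Units.val_pow_eq_pow_val, map_pow, hτ, one_pow]
    have hinv : mixedEmbedding.norm ((τ⁻¹ : (KInf K)ˣ) : KInf K) = 1 := by
      have h := map_mul mixedEmbedding.norm (τ : KInf K) ((τ⁻¹ : (KInf K)ˣ) : KInf K)
      rw [Units.mul_inv, map_one, hτ, one_mul] at h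
      exact h.symm
    rw [hσ]
    rcases unipExp_eq b with h | h
    · rw [h]; exact this 2
    · rw [h, show (-2 : ℤ) = -((2 : ℕ) : ℤ) from rfl, _root_.zpow_neg, ← _root_.inv_zpow, zpow_natCast,
        Units.val_pow_eq_pow_val, map_pow, hinv, one_pow]
  have h1 := continuous_hDiag (K := K)
  have h2 := continuous_unip (K := K) b
  let Φ : (KInf K)ˣ → KInf K → ℝ := fun η r => φ (toY Γ (hDiag x * hDiag η * unip b r * hDiag τ))
  let M : (KInf K)ˣ → ℝ := fun η => ∫ y, φ (hDiag x • (hDiag τ * hDiag η) • y) ∂μ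
  have hΦc : Continuous (Function.uncurry Φ) := by
    refine hφ.comp ((continuous_toY Γ).comp ?_)
    exact ((continuous_const.mul (h1.comp continuous_fst)).mul (h2.comp continuous_snd)).mul continuous_const
  have hint : ∀ η, Integrable (fun y => φ (hDiag x • (hDiag τ * hDiag η) • y)) μ := fun η =>
    integrable_of_abs_le (hφ.comp ((continuous_const_smul _).comp (continuous_const_smul _))).measurable
      fun _ => hS₀ _
  have hMc : Continuous M := by
    refine continuous_of_dominated (bound := fun _ => S₀) (fun η => (hint η).aestronglyMeasurable) ?_
      (integrable_const _) ?_
    · exact fun η => Filter.Eventually.of_forall fun y => hS₀ _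
    · refine Filter.Eventually.of_forall fun y => hφ.comp ?_
      exact (continuous_const_smul (hDiag x)).comp
        ((continuous_const.mul h1).smul (continuous_const : Continuous fun _ : (KInf K)ˣ => y))
  have hMS : ∀ η, |M η| ≤ S₀ := fun η => abs_integral_le_of_ae_le (Filter.Eventually.of_forall fun y => hS₀ _)
  have hMlip : ∀ η ζ, |M (expU ζ * η) - M η| ≤ A * ‖ζ‖ := by
    intro η ζ
    refine abs_integral_sub_le (hint _) (hint _) (Filter.Eventually.of_forall fun y => ?_)
    have e : hDiag x • (hDiag τ * hDiag (expU ζ * η)) • y =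
        hDiag (expU ζ) • hDiag x • (hDiag τ * hDiag η) • y := by
      simp only [smul_smul, ← map_mul]
      congr 2
      simp only [mul_left_comm]
    rw [e]
    exact hH _ _
  let D : (KInf K)ˣ → KInf K → ℝ := fun η r => Φ η r - M η
  have key := hcore σ hσ1 D (hΦc.sub (hMc.comp continuous_fst)) (S₀ + S₀)
    (fun η r => (abs_sub _ _).trans (add_le_add (hS₀ _) (hMS η)))
    (A * (T * Real.exp 4)) (A + A) (by positivity) (by positivity) ?_ ?_ ?_ R
  · have hrew : (∫ η, φ ((hDiag x * unip b R) • hDiag η • toY Γ (hDiag τ)) ∂(boxMeasure K ε)) -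
        ∫ η, M η ∂(boxMeasure K ε) =
        ∫ η, D η (((η ^ (-unipExp b) : (KInf K)ˣ) : KInf K) * R) ∂(boxMeasure K ε) := by
      have e : ∀ η : (KInf K)ˣ, φ ((hDiag x * unip b R) • hDiag η • toY Γ (hDiag τ)) =
          Φ η (((η ^ (-unipExp b) : (KInf K)ˣ) : KInf K) * R) := by
        intro η
        change _ = φ (toY Γ _)
        rw [smul_toY, smul_toY]
        congr 2
        rw [mul_assoc (hDiag x) (hDiag η), ← unip_mul_hDiag, mul_assoc, mul_assoc, mul_assoc]
      simp only [e]
      have hc : Continuous fun η : (KInf K)ˣ => ((η ^ (-unipExp b) : (KInf K)ˣ) : KInf K) * R :=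
        ((Units.continuous_val (M := KInf K)).comp (continuous_zpow (-unipExp b))).mul continuous_const
      have hc' : Continuous fun η : (KInf K)ˣ => (η, ((η ^ (-unipExp b) : (KInf K)ˣ) : KInf K) * R) :=
        continuous_id.prodMk hc
      have i1 : Integrable (fun η => Φ η (((η ^ (-unipExp b) : (KInf K)ˣ) : KInf K) * R)) (boxMeasure K ε) :=
        integrable_of_abs_le (hΦc.comp hc').measurable fun η => hS₀ _
      have i2 : Integrable M (boxMeasure K ε) := integrable_of_abs_le hMc.measurable hMS
      exact (integral_sub i1 i2).symm
    change |_ - ∫ η, M η ∂(boxMeasure K ε)| ≤ _ ∧ ∀ w, _ → |_ - ∫ η, M η ∂(boxMeasure K ε)| ≤ _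
    rw [hrew]
    refine ⟨key.1.trans (le_of_eq (by ring)), fun w hw => (key.2 w hw).trans ?_⟩
    refine mul_le_mul_of_nonneg_right ?_ (Real.rpow_nonneg (normAtPlace_nonneg _ _) _)
    have hexp : (2 : ℝ) ≤ Real.exp 4 := by
      have := Real.add_one_le_exp (4 : ℝ); linarith
    calc C * (A * (T * Real.exp 4) + (A + A)) = C * (A * T * Real.exp 4 + A * 2) := by ring
      _ ≤ C * (A * T * Real.exp 4 + A * Real.exp 4) := by gcongr
      _ = _ := by ring
  · intro η hη r r'
    have e : hDiag x * hDiag η * unip b r * hDiag τ =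
        unip b ((((x * η) ^ unipExp b : (KInf K)ˣ) : KInf K) * (r - r')) * (hDiag x * hDiag η * unip b r' * hDiag τ) := by
      rw [← map_mul, ← mul_assoc, ← mul_assoc, ← hDiag_mul_unip, mul_assoc (hDiag (x * η)) (unip b (r - r')),
        ← unip_add, sub_add_cancel]
    have hΦ : D η r - D η r' = φ (unip b ((((x * η) ^ unipExp b : (KInf K)ˣ) : KInf K) * (r - r')) •
        toY Γ (hDiag x * hDiag η * unip b r' * hDiag τ)) - φ (toY Γ (hDiag x * hDiag η * unip b r' * hDiag τ)) := by
      rw [smul_toY, ← e]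
      change φ _ - M η - (φ _ - M η) = _
      ring
    rw [hΦ]
    refine (hU _ _).trans ?_
    rw [mul_assoc]
    refine mul_le_mul_of_nonneg_left ?_ hA
    rw [norm_le_iff_normAtPlace]
    intro w
    rw [map_mul, mul_zpow, Units.val_mul, map_mul]
    have h3 := normAtPlace_zpow_hBox_le (unipExp_eq b) hη w
    rw [show (2 : ℝ) * 2 = 4 by norm_num] at h3
    exact mul_le_mul (mul_le_mul (hT w) h3 (normAtPlace_nonneg _ _) hT0) (normAtPlace_le_norm _ _)
      (normAtPlace_nonneg _ _) (by positivity)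
  · intro η ζ r
    have hΦ : |Φ (expU ζ * η) r - Φ η r| ≤ A * ‖ζ‖ := by
      have e : hDiag x * hDiag (expU ζ * η) * unip b r * hDiag τ =
          hDiag (expU ζ) * (hDiag x * hDiag η * unip b r * hDiag τ) := by
        rw [← map_mul, ← map_mul, mul_left_comm x, map_mul hDiag (expU ζ)]
        simp only [mul_assoc]
      change |φ (toY Γ _) - φ (toY Γ _)| ≤ _
      rw [e, ← smul_toY]
      exact hH _ _
    have hM := hMlip η ζ
    change |Φ (expU ζ * η) r - M (expU ζ * η) - (Φ η r - M η)| ≤ _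
    rw [abs_le] at *
    constructor <;> linarith [hΦ.1, hΦ.2, hM.1, hM.2]
  · intro a ha η q
    have hm0 := homMeasure_unipGroup hT2 (hda a ha) (hdaΓ a) (((σ⁻¹ : (KInf K)ˣ) : KInf K) * q)
    have hM : M η = ∫ p, Φ η (q + (σ : KInf K) * ((d : KInf K) * mixedEmbedding K a) * p) ∂(fundMeasure K) := by
      change ∫ y, φ (hDiag x • (hDiag τ * hDiag η) • y) ∂(homMeasure Γ (unipGroup K b)) = _
      rw [hm0, unipMeasure, integral_map (continuous_toY_unip _ _).measurable.aemeasurable]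
      · refine integral_congr_ae (Filter.Eventually.of_forall fun p => ?_)
        change φ _ = φ _
        rw [smul_toY, smul_toY]
        congr 2
        have e : q + (σ : KInf K) * ((d : KInf K) * mixedEmbedding K a) * p =
            (σ : KInf K) * (((σ⁻¹ : (KInf K)ˣ) : KInf K) * q + (d : KInf K) * mixedEmbedding K a * p) := by
          rw [mul_add, Units.mul_inv_cancel_left, mul_assoc, mul_assoc]
        have e2 : hDiag x * hDiag η * hDiag τ = hDiag x * (hDiag τ * hDiag η) := by
          rw [← map_mul, ← map_mul, ← map_mul, ← map_mul, mul_assoc, mul_comm η]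
        rw [e, mul_assoc (hDiag x * hDiag η), hσ, ← hDiag_mul_unip, ← mul_assoc (hDiag x * hDiag η), e2,
          ← mul_assoc (hDiag x)]
      · exact (hφ.comp ((continuous_const_smul _).comp (continuous_const_smul _))).aestronglyMeasurable
    change ∫ p, (Φ η _ - M η) ∂(fundMeasure K) = 0
    have hc : Continuous fun p : KInf K => (η, q + (σ : KInf K) * ((d : KInf K) * mixedEmbedding K a) * p) :=
      continuous_const.prodMk (continuous_const.add (continuous_const.mul continuous_id))
    have i1 : Integrable (fun p => Φ η (q + (σ : KInf K) * ((d : KInf K) * mixedEmbedding K a) * p))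
        (fundMeasure K) := integrable_of_abs_le (hΦc.comp hc).measurable fun p => hS₀ _
    rw [integral_sub i1 (integrable_const _), ← hM, integral_const, probReal_univ, one_smul, sub_self]

/-- Comparison of a translate of `m_ε` by `h_x u_R` with the corresponding translate of `m_ε^V`. -/
theorem exists_orbit_bound (hΓ : IsArithmetic Γ) (b : Bool) {ε : ℝ} (hε1 : ε < 1) :
    ∃ C : ℝ, 0 ≤ C ∧ ∀ φ : Y Γ → ℝ, Continuous φ → ∀ S₀ : ℝ, (∀ y, |φ y| ≤ S₀) → ∀ A : ℝ, 0 ≤ A →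
      (∀ (r : KInf K) (y : Y Γ), |φ (unip b r • y) - φ y| ≤ A * ‖r‖) →
      (∀ (ζ : KInf K) (y : Y Γ), |φ (hDiag (expU ζ) • y) - φ y| ≤ A * ‖ζ‖) →
      ∀ (x : (KInf K)ˣ) (T : ℝ), (∀ w, normAtPlace w ((x ^ unipExp b : (KInf K)ˣ) : KInf K) ≤ T) →
      ∀ R : KInf K,
      |(∫ y, φ ((hDiag x * unip b R) • y) ∂(mEps Γ ε)) - ∫ y, φ (hDiag x • y) ∂(mEpsUnip Γ (unipGroup K b) ε)| ≤
          C * (A * T) ∧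
      ∀ w, 1 ≤ normAtPlace w R →
        |(∫ y, φ ((hDiag x * unip b R) • y) ∂(mEps Γ ε)) - ∫ y, φ (hDiag x • y) ∂(mEpsUnip Γ (unipGroup K b) ε)| ≤
          C * (A * T + A) * normAtPlace w R ^ (-(1 / (6 * (Module.finrank ℚ K : ℝ)))) := by
  obtain ⟨C, hC, hbound⟩ := exists_orbit_bound_at hΓ b hε1
  refine ⟨C, hC, fun φ hφ S₀ hS₀ A hA hU hH x T hT R => ?_⟩
  have hT0 : 0 ≤ T := by
    obtain ⟨w⟩ : Nonempty (InfinitePlace K) := inferInstance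
    exact (normAtPlace_nonneg w _).trans (hT w)
  by_cases h : ∃ μ, IsHomogeneous Γ (H1 K) μ
  swap
  · have h0 : homMeasure Γ (H1 K) = 0 := by rw [homMeasure, dif_neg h]
    rw [mEps, mEpsUnip, h0, Measure.bind_zero_left, Measure.bind_zero_left, integral_zero_measure,
      integral_zero_measure, sub_zero, abs_zero]
    exact ⟨by positivity, fun w _ => by have := normAtPlace_nonneg w R; positivity⟩
  have hspec := homMeasure_spec h
  have hprob := hspec.1
  have hT2 := t2Space_Y hΓ
  obtain ⟨d, hd, hdΓ⟩ := exists_unip_mem_latticeOf hΓ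
  have hd' : IsUnit (d : KInf K) := by
    have := (isUnit_iff_ne_zero.2 (Nat.cast_ne_zero.2 hd : (d : K) ≠ 0)).map (mixedEmbedding K)
    rwa [map_natCast] at this
  have hprobU : IsProbabilityMeasure (homMeasure Γ (unipGroup K b)) :=
    (homMeasure_spec ⟨_, isHomogeneous_unipMeasure hT2 hd' (hdΓ b)⟩).1
  have hbox : boxMeasure K ε Set.univ ≤ 1 := prob_le_one
  have hprod : ((boxMeasure K ε).prod (homMeasure Γ (unipGroup K b))) Set.univ ≤ 1 := by
    rw [← Set.univ_prod_univ, Measure.prod_prod, measure_univ (μ := homMeasure Γ (unipGroup K b)), mul_one]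
    exact hbox
  have hc1 : Continuous fun y : Y Γ => φ ((hDiag x * unip b R) • y) := hφ.comp (continuous_const_smul _)
  have hc2 : Continuous fun y : Y Γ => φ (hDiag x • y) := hφ.comp (continuous_const_smul _)
  obtain ⟨i1, e1⟩ := integral_bind_of_bounded (measurable_mz (Γ := Γ) ε).aemeasurable (m := homMeasure Γ (H1 K))
    (fun z => map_univ_le_one _ hbox _) hc1.measurable (fun y => hS₀ _)
  obtain ⟨i2, e2⟩ := integral_bind_of_bounded (aemeasurable_mzUnip hT2 hd' (hdΓ b) ε hspec)
    (fun z => map_univ_le_one _ hprod _) hc2.measurable (fun y => hS₀ _)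
  have hpt : ∀ᵐ z ∂(homMeasure Γ (H1 K)), ∃ τ : (KInf K)ˣ, mixedEmbedding.norm (τ : KInf K) = 1 ∧
      (∫ y, φ ((hDiag x * unip b R) • y) ∂(mz Γ ε z)) =
        ∫ η, φ ((hDiag x * unip b R) • hDiag η • toY Γ (hDiag τ)) ∂(boxMeasure K ε) ∧
      (∫ y, φ (hDiag x • y) ∂(mzUnip Γ (unipGroup K b) ε z)) =
        ∫ η, ∫ y, φ (hDiag x • (hDiag τ * hDiag η) • y) ∂(homMeasure Γ (unipGroup K b)) ∂(boxMeasure K ε) := by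
    have hmem : ∀ᵐ z ∂(homMeasure Γ (H1 K)), z ∈ imageY Γ (H1 K) := ae_iff.2 hspec.2.2
    filter_upwards [hmem] with z hz
    obtain ⟨τ, hτ, -, rfl⟩ := lift_spec hz
    refine ⟨τ, hτ, ?_, ?_⟩
    · rw [mz, integral_map _ hc1.aestronglyMeasurable]
      exact ((continuous_hDiag (K := K)).smul
        (continuous_const : Continuous fun _ : (KInf K)ˣ => toY Γ (hDiag τ))).measurable.aemeasurable
    · have hc3 : Continuous fun p : (KInf K)ˣ × Y Γ => (hDiag τ * hDiag p.1) • p.2 :=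
        (continuous_const.mul ((continuous_hDiag (K := K)).comp continuous_fst)).smul continuous_snd
      rw [mzUnip_toY hT2 hd' (hdΓ b) ε hτ, integral_map hc3.measurable.aemeasurable hc2.aestronglyMeasurable,
        integral_prod]
      exact integrable_of_abs_le (hc2.comp hc3).measurable fun p => hS₀ _
  rw [mEps, mEpsUnip, e1, e2]
  constructor
  · refine abs_integral_sub_le i1 i2 ?_
    filter_upwards [hpt] with z hz
    obtain ⟨τ, hτ, h1, h2⟩ := hz
    rw [h1, h2]
    exact (hbound φ hφ S₀ hS₀ A hA hU hH x T hT τ hτ R).1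
  · intro w hw
    refine abs_integral_sub_le i1 i2 ?_
    filter_upwards [hpt] with z hz
    obtain ⟨τ, hτ, h1, h2⟩ := hz
    rw [h1, h2]
    exact (hbound φ hφ S₀ hS₀ A hA hU hH x T hT τ hτ R).2 w hw

end OrbitBound

section Decomposition

open scoped Classical
open NumberField.mixedEmbedding

variable {K : Type*} [Field K] [NumberField K] {Γ : Subgroup SL(2, K)} {b : Bool}

/-- The diagonal entries of `a_s`. -/
noncomputable def chPlace (s : InfinitePlace K → PosReal) (w : InfinitePlace K) : ℝ :=
  ((s w : ℝ) + (s w : ℝ)⁻¹) / 2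

/-- The off-diagonal entries of `a_s`. -/
noncomputable def shPlace (s : InfinitePlace K → PosReal) (w : InfinitePlace K) : ℝ :=
  ((s w : ℝ) - (s w : ℝ)⁻¹) / 2

/-- The Euclidean norms of the columns of `a_s`. -/
noncomputable def radPlace (s : InfinitePlace K → PosReal) (w : InfinitePlace K) : ℝ :=
  √(chPlace s w ^ 2 + shPlace s w ^ 2)

theorem chPlace_sq_sub (s : InfinitePlace K → PosReal) (w : InfinitePlace K) :
    chPlace s w ^ 2 - shPlace s w ^ 2 = 1 := by
  have := (s w).2.ne'
  rw [chPlace, shPlace]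
  field_simp
  ring

theorem radPlace_sq (s : InfinitePlace K → PosReal) (w : InfinitePlace K) :
    radPlace s w ^ 2 = chPlace s w ^ 2 + shPlace s w ^ 2 :=
  Real.sq_sqrt (by positivity)

theorem one_le_radPlace (s : InfinitePlace K → PosReal) (w : InfinitePlace K) : 1 ≤ radPlace s w := by
  refine Real.one_le_sqrt.2 ?_
  nlinarith [chPlace_sq_sub s w, sq_nonneg (shPlace s w)]

theorem radPlace_ne_zero (s : InfinitePlace K → PosReal) (w : InfinitePlace K) : radPlace s w ≠ 0 :=
  (zero_lt_one.trans_le (one_le_radPlace s w)).ne'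

theorem half_sq_radPlace_le (s : InfinitePlace K → PosReal) (w : InfinitePlace K) (h : 2 ≤ radPlace s w ^ 2) :
    radPlace s w ^ 2 / 2 ≤ |2 * (chPlace s w * shPlace s w)| := by
  refine abs_le_of_sq_le_sq' ?_ (abs_nonneg _) |>.2
  rw [sq_abs]
  have h1 := chPlace_sq_sub s w
  have h2 := radPlace_sq s w
  have h3 : (2 * (chPlace s w * shPlace s w)) ^ 2 = (radPlace s w ^ 2) ^ 2 - (chPlace s w ^ 2 - shPlace s w ^ 2) ^ 2 := by
    rw [h2]; ring
  rw [h3, h1]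
  nlinarith

/-- The unit of `k_∞` whose components are the Euclidean norms of the columns of `a_s`. -/
noncomputable def radUnit (s : InfinitePlace K → PosReal) : (KInf K)ˣ :=
  unitOfPlaces (radPlace s) (radPlace_ne_zero s)

/-- A family of rotations, as an element of `G`. -/
noncomputable def rot (x y : InfinitePlace K → ℝ) (h : ∀ w, x w ^ 2 + y w ^ 2 = 1) : GInf K :=
  ⟨!![ofPlaces x, ofPlaces fun w => -y w; ofPlaces y, ofPlaces x], by
    rw [Matrix.det_fin_two_of, ofPlaces_neg, neg_mul, sub_neg_eq_add, ← ofPlaces_mul, ← ofPlaces_mul,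
      ← ofPlaces_add, ← ofPlaces_one]
    congr 1
    funext w
    rw [← h w]; ring⟩

theorem star_ofPlaces (x : InfinitePlace K → ℝ) : star (ofPlaces x : KInf K) = ofPlaces x := by
  ext w <;> simp [ofPlaces]

theorem rot_mem_K0 (x y : InfinitePlace K → ℝ) (h : ∀ w, x w ^ 2 + y w ^ 2 = 1) : rot x y h ∈ K0 K := by
  change (!![ofPlaces x, ofPlaces fun w => -y w; ofPlaces y, ofPlaces x] : Matrix _ _ (KInf K)) ∈
    Matrix.unitaryGroup (Fin 2) (KInf K)
  rw [Matrix.mem_unitaryGroup_iff]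
  have e : star (!![ofPlaces x, ofPlaces fun w => -y w; ofPlaces y, ofPlaces x] : Matrix (Fin 2) (Fin 2) (KInf K)) =
      !![ofPlaces x, ofPlaces y; ofPlaces fun w => -y w, ofPlaces x] := by
    ext1 i j
    fin_cases i <;> fin_cases j
    · exact star_ofPlaces x
    · exact star_ofPlaces y
    · exact star_ofPlaces fun w => -y w
    · exact star_ofPlaces x
  have h' : (ofPlaces x * ofPlaces x + ofPlaces y * ofPlaces y : KInf K) = 1 := by
    rw [← ofPlaces_mul, ← ofPlaces_mul, ← ofPlaces_add, ← ofPlaces_one]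
    congr 1
    funext w
    rw [← h w]; ring
  rw [e, Matrix.mul_fin_two, ofPlaces_neg, Matrix.one_fin_two]
  congr 1
  have h1 : (ofPlaces x * ofPlaces x + -ofPlaces y * -ofPlaces y : KInf K) = 1 := by rw [← h']; ring
  have h2 : (ofPlaces x * ofPlaces y + -ofPlaces y * ofPlaces x : KInf K) = 0 := by ring
  have h3 : (ofPlaces y * ofPlaces x + ofPlaces x * -ofPlaces y : KInf K) = 0 := by ring
  have h4 : (ofPlaces y * ofPlaces y + ofPlaces x * ofPlaces x : KInf K) = 1 := by rw [← h']; ring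
  rw [h1, h2, h3, h4]

/-- The sign of the unipotent group `unipGroup K b`. -/
def unipSign (b : Bool) : ℤ := bif b then 1 else -1

/-- The decomposition of `a_s` in `K₀ H U^±`. -/
theorem exists_aMat_eq (b : Bool) (s : InfinitePlace K → PosReal) :
    ∃ k ∈ K0 K, aMat s = k * (hDiag (radUnit s ^ unipSign b) *
      unip b (ofPlaces fun w => 2 * (chPlace s w * shPlace s w) / radPlace s w ^ 2)) := by
  have hr := radPlace_ne_zero s
  have h1 : ∀ w, (chPlace s w / radPlace s w) ^ 2 + (shPlace s w / radPlace s w) ^ 2 = 1 := by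
    intro w
    rw [div_pow, div_pow, ← add_div, ← radPlace_sq, div_self (pow_ne_zero 2 (hr w))]
  have h2 : ∀ w, (chPlace s w / radPlace s w) ^ 2 + (-(shPlace s w / radPlace s w)) ^ 2 = 1 := by
    intro w
    rw [neg_sq, h1]
  have ea : (aMat s).1 = !![ofPlaces (chPlace s), ofPlaces (shPlace s); ofPlaces (shPlace s), ofPlaces (chPlace s)] := rfl
  have hA : ∀ w, shPlace s w = chPlace s w / radPlace s w * (radPlace s w * (2 * (chPlace s w * shPlace s w) / radPlace s w ^ 2))
      + -(shPlace s w / radPlace s w) * (radPlace s w)⁻¹ := by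
    intro w
    have := hr w
    field_simp
    rw [radPlace_sq]
    linear_combination (-shPlace s w) * chPlace_sq_sub s w
  have hB : ∀ w, chPlace s w = shPlace s w / radPlace s w * (radPlace s w * (2 * (chPlace s w * shPlace s w) / radPlace s w ^ 2))
      + (chPlace s w / radPlace s w) * (radPlace s w)⁻¹ := by
    intro w
    have := hr w
    field_simp
    rw [radPlace_sq]
    linear_combination (chPlace s w) * chPlace_sq_sub s w
  have hC : ∀ w, chPlace s w = chPlace s w / radPlace s w * radPlace s w := fun w => by
    have := hr w
    field_simp
  have hD : ∀ w, shPlace s w = shPlace s w / radPlace s w * radPlace s w := fun w => by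
    have := hr w
    field_simp
  cases b
  · refine ⟨_, rot_mem_K0 _ _ h2, ?_⟩
    apply Subtype.ext
    rw [val_mk_mul, val_mk_mul, ea]
    change _ = !![ofPlaces fun w => chPlace s w / radPlace s w, ofPlaces fun w => -(-(shPlace s w / radPlace s w));
        ofPlaces fun w => -(shPlace s w / radPlace s w), ofPlaces fun w => chPlace s w / radPlace s w] *
      (!![((radUnit s ^ (-1 : ℤ) : (KInf K)ˣ) : KInf K), 0; 0, (((radUnit s ^ (-1 : ℤ))⁻¹ : (KInf K)ˣ) : KInf K)] *
      !![1, 0; ofPlaces fun w => 2 * (chPlace s w * shPlace s w) / radPlace s w ^ 2, 1])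
    have e1 : ((radUnit s ^ (-1 : ℤ) : (KInf K)ˣ) : KInf K) = ofPlaces fun w => (radPlace s w)⁻¹ := by
      rw [_root_.zpow_neg_one]; rfl
    have e2 : (((radUnit s ^ (-1 : ℤ))⁻¹ : (KInf K)ˣ) : KInf K) = ofPlaces (radPlace s) := by
      rw [_root_.zpow_neg_one, inv_inv]; rfl
    rw [e1, e2, Matrix.mul_fin_two, Matrix.mul_fin_two]
    simp only [mul_one, mul_zero, zero_mul, add_zero, zero_add, ← ofPlaces_mul, ← ofPlaces_add, neg_neg]
    congr 1
    rw [← funext hC, ← funext hD]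
    rw [← funext fun w => (hA w).trans (add_comm _ _), ← funext fun w => (hB w).trans (add_comm _ _)]
  · refine ⟨_, rot_mem_K0 _ _ h1, ?_⟩
    apply Subtype.ext
    rw [val_mk_mul, val_mk_mul, ea]
    change _ = !![ofPlaces fun w => chPlace s w / radPlace s w, ofPlaces fun w => -(shPlace s w / radPlace s w);
        ofPlaces fun w => (shPlace s w / radPlace s w), ofPlaces fun w => chPlace s w / radPlace s w] *
      (!![((radUnit s ^ (1 : ℤ) : (KInf K)ˣ) : KInf K), 0; 0, (((radUnit s ^ (1 : ℤ))⁻¹ : (KInf K)ˣ) : KInf K)] *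
      !![1, ofPlaces fun w => 2 * (chPlace s w * shPlace s w) / radPlace s w ^ 2; 0, 1])
    have e1 : ((radUnit s ^ (1 : ℤ) : (KInf K)ˣ) : KInf K) = ofPlaces (radPlace s) := by
      rw [zpow_one]; rfl
    have e2 : (((radUnit s ^ (1 : ℤ))⁻¹ : (KInf K)ˣ) : KInf K) = ofPlaces fun w => (radPlace s w)⁻¹ := by
      rw [zpow_one]; rfl
    rw [e1, e2, Matrix.mul_fin_two, Matrix.mul_fin_two]
    simp only [mul_one, mul_zero, zero_mul, add_zero, zero_add, ← ofPlaces_mul, ← ofPlaces_add]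
    congr 1
    rw [← funext hC, ← funext hD, ← funext hA, ← funext hB]

/-- A positive real number as a unit of `k_∞`. -/
noncomputable def scalarUnit (t : PosReal) : (KInf K)ˣ :=
  Units.map (algebraMap ℝ (KInf K)).toMonoidHom (Units.mk0 t.1 t.2.ne')

theorem hDelta_eq (t : PosReal) : hDelta (K := K) t = hDiag (scalarUnit t) := rfl

theorem normAtPlace_scalarUnit (t : PosReal) (w : InfinitePlace K) :
    normAtPlace w ((scalarUnit t : (KInf K)ˣ) : KInf K) = t := by
  change normAtPlace w (algebraMap ℝ (KInf K) t) = t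
  rw [normAtPlace_algebraMap, abs_of_pos t.2]

theorem norm_scalarUnit (t : PosReal) :
    mixedEmbedding.norm ((scalarUnit t : (KInf K)ˣ) : KInf K) = (t : ℝ) ^ Module.finrank ℚ K := by
  rw [mixedEmbedding.norm_apply, ← InfinitePlace.sum_mult_eq, ← Finset.prod_pow_eq_pow_sum]
  exact Finset.prod_congr rfl fun w _ => by rw [normAtPlace_scalarUnit]

theorem normAtPlace_radUnit (s : InfinitePlace K → PosReal) (w : InfinitePlace K) :
    normAtPlace w (radUnit s : KInf K) = radPlace s w := by
  change normAtPlace w (ofPlaces (radPlace s)) = _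
  rw [normAtPlace_ofPlaces, abs_of_nonneg (zero_le_one.trans (one_le_radPlace s w))]

theorem norm1_aMat (s : InfinitePlace K → PosReal) : norm1 (aMat s) = mixedEmbedding.norm (radUnit s : KInf K) := by
  rw [mixedEmbedding.norm_apply, norm1, vecNorm]
  refine Finset.prod_congr rfl fun w _ => ?_
  have e0 : ((aMat s).1 *ᵥ ![1, 0]) 0 = ofPlaces (chPlace s) := by
    simp [aMat, Matrix.mulVec, dotProduct, Fin.sum_univ_two]; rfl
  have e1 : ((aMat s).1 *ᵥ ![1, 0]) 1 = ofPlaces (shPlace s) := by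
    simp [aMat, Matrix.mulVec, dotProduct, Fin.sum_univ_two]; rfl
  rw [normAtPlace_radUnit, Fin.sum_univ_two, e0, e1, normAtPlace_ofPlaces, normAtPlace_ofPlaces, sq_abs, sq_abs,
    radPlace]

theorem norm2_aMat (s : InfinitePlace K → PosReal) : norm2 (aMat s) = mixedEmbedding.norm (radUnit s : KInf K) := by
  rw [mixedEmbedding.norm_apply, norm2, vecNorm]
  refine Finset.prod_congr rfl fun w _ => ?_
  have e0 : ((aMat s).1 *ᵥ ![0, 1]) 0 = ofPlaces (shPlace s) := by
    simp [aMat, Matrix.mulVec, dotProduct, Fin.sum_univ_two]; rfl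
  have e1 : ((aMat s).1 *ᵥ ![0, 1]) 1 = ofPlaces (chPlace s) := by
    simp [aMat, Matrix.mulVec, dotProduct, Fin.sum_univ_two]; rfl
  rw [normAtPlace_radUnit, Fin.sum_univ_two, e0, e1, normAtPlace_ofPlaces, normAtPlace_ofPlaces, sq_abs, sq_abs,
    radPlace, add_comm]

theorem norm_unit_zpow (x : (KInf K)ˣ) (m : ℤ) :
    mixedEmbedding.norm ((x ^ m : (KInf K)ˣ) : KInf K) = mixedEmbedding.norm (x : KInf K) ^ m := by
  rw [mixedEmbedding.norm_apply, mixedEmbedding.norm_apply, ← Finset.prod_zpow]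
  refine Finset.prod_congr rfl fun w _ => ?_
  rw [normAtPlace_unit_zpow, ← zpow_natCast, ← zpow_natCast, zpow_comm]

/-- The measure `m_ε` is invariant under `H^(1)`. -/
theorem integral_mEps_hDiag_smul (ε : ℝ) {β : (KInf K)ˣ} (hβ : mixedEmbedding.norm (β : KInf K) = 1) {φ : Y Γ → ℝ}
    (hφ : Continuous φ) {S₀ : ℝ} (hS₀ : ∀ y, |φ y| ≤ S₀) :
    ∫ y, φ (hDiag β • y) ∂(mEps Γ ε) = ∫ y, φ y ∂(mEps Γ ε) := by
  by_cases h : ∃ μ, IsHomogeneous Γ (H1 K) μ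
  swap
  · have h0 : homMeasure Γ (H1 K) = 0 := by rw [homMeasure, dif_neg h]
    rw [mEps, h0, Measure.bind_zero_left, integral_zero_measure, integral_zero_measure]
  have hspec := homMeasure_spec h
  have hprob := hspec.1
  have hbox : boxMeasure K ε Set.univ ≤ 1 := prob_le_one
  have hc : Continuous fun y : Y Γ => φ (hDiag β • y) := hφ.comp (continuous_const_smul _)
  obtain ⟨-, e1⟩ := integral_bind_of_bounded (measurable_mz (Γ := Γ) ε).aemeasurable (m := homMeasure Γ (H1 K))
    (fun z => map_univ_le_one _ hbox _) hc.measurable (fun y => hS₀ _)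
  obtain ⟨i2, e2⟩ := integral_bind_of_bounded (measurable_mz (Γ := Γ) ε).aemeasurable (m := homMeasure Γ (H1 K))
    (fun z => map_univ_le_one _ hbox _) hφ.measurable (fun y => hS₀ _)
  have hinv : (homMeasure Γ (H1 K)).map (fun y => hDiag β • y) = homMeasure Γ (H1 K) :=
    hspec.2.1 _ ⟨β, hβ, rfl⟩
  have hm : ∀ z : Y Γ, Measurable fun η : (KInf K)ˣ => hDiag η • z := fun z =>
    ((continuous_hDiag (K := K)).smul (continuous_const : Continuous fun _ : (KInf K)ˣ => z)).measurable
  have e3 : ∀ z, ∫ y, φ (hDiag β • y) ∂(mz Γ ε z) = ∫ y, φ y ∂(mz Γ ε (hDiag β • z)) := by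
    intro z
    rw [mz, mz, integral_map (hm z).aemeasurable hc.aestronglyMeasurable,
      integral_map (hm _).aemeasurable hφ.aestronglyMeasurable]
    refine integral_congr_ae (Filter.Eventually.of_forall fun η => ?_)
    change φ _ = φ _
    rw [smul_smul, smul_smul, ← map_mul, ← map_mul, mul_comm]
  rw [mEps, e1, e2]
  simp only [e3]
  conv_rhs => rw [← hinv]
  rw [integral_map (continuous_const_smul (hDiag β)).measurable.aemeasurable]
  rw [hinv]
  exact i2.aestronglyMeasurable

/-- The function `f` as an integral over a translate of `m_ε` by `h_X u_R`. -/
theorem f_eq_integral (b : Bool) (ε : ℝ) {φ : Y Γ → ℝ} (hφ : Continuous φ) {S₀ : ℝ} (hS₀ : ∀ y, |φ y| ≤ S₀)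
    (hK : IsK0Invariant φ) (x₁ x₂ X : PosReal) (s : InfinitePlace K → PosReal)
    (hX : (X : ℝ) ^ Module.finrank ℚ K = norm1 (aMat s) ^ unipSign b * (x₁ * norm1 (aMat s))⁻¹) :
    f Γ ε φ x₁ x₂ s = ∫ y, φ ((hDiag (scalarUnit X) * unip b
      (((scalarUnit X ^ (-unipExp b) : (KInf K)ˣ) : KInf K) * ofPlaces fun w => 2 * (chPlace s w * shPlace s w))) • y)
        ∂(mEps Γ ε) := by
  obtain ⟨k, hk, hks⟩ := exists_aMat_eq b s
  set t := tParam x₁ s with ht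
  have hl' : (Module.finrank ℚ K : ℝ) ≠ 0 := by exact_mod_cast (Module.finrank_pos (R := ℚ) (M := K)).ne'
  have ht' : (t : ℝ) ^ Module.finrank ℚ K = ((x₁ : ℝ) * norm1 (aMat s))⁻¹ := by
    change (((x₁ : ℝ) * norm1 (aMat s)) ^ (-(1 : ℝ) / Module.finrank ℚ K)) ^ Module.finrank ℚ K = _
    rw [← Real.rpow_natCast, ← Real.rpow_mul (mul_pos x₁.2 (norm1_aMat_pos s)).le, div_mul_cancel₀ _ hl',
      Real.rpow_neg_one]
  set X' : (KInf K)ˣ := scalarUnit X with hX'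
  set r : KInf K := ofPlaces fun w => 2 * (chPlace s w * shPlace s w) / radPlace s w ^ 2 with hr
  set β : (KInf K)ˣ := X'⁻¹ * (radUnit s ^ unipSign b * scalarUnit t) with hβ
  have hβ1 : mixedEmbedding.norm (β : KInf K) = 1 := by
    have hXpos : (X : ℝ) ^ Module.finrank ℚ K ≠ 0 := pow_ne_zero _ X.2.ne'
    rw [hβ, Units.val_mul, Units.val_mul, map_mul, map_mul, ← _root_.zpow_neg_one, norm_unit_zpow, norm_unit_zpow,
      norm_scalarUnit, norm_scalarUnit, ← norm1_aMat, ht', ← hX, _root_.zpow_neg_one, inv_mul_cancel₀ hXpos]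
  have hrr : ((radUnit s ^ (2 : ℤ) : (KInf K)ˣ) : KInf K) * r = ofPlaces fun w => 2 * (chPlace s w * shPlace s w) := by
    have : ((radUnit s ^ (2 : ℤ) : (KInf K)ˣ) : KInf K) = ofPlaces fun w => radPlace s w * radPlace s w := by
      rw [ofPlaces_mul]
      norm_cast
      rw [pow_two]; rfl
    rw [this, ← ofPlaces_mul]
    congr 1
    funext w
    have := radPlace_ne_zero s w
    field_simp
  have hdec : aMat s * hDelta t = k * (hDiag X' * unip b (((X' ^ (-unipExp b) : (KInf K)ˣ) : KInf K) *
      ofPlaces fun w => 2 * (chPlace s w * shPlace s w)) * hDiag β) := by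
    have h1 : radUnit s ^ unipSign b * scalarUnit t = X' * β := by
      rw [hβ, mul_inv_cancel_left]
    have h2 : (((scalarUnit t : (KInf K)ˣ) ^ (-unipExp b) : (KInf K)ˣ) : KInf K) * r = 
      ((β ^ (-unipExp b) : (KInf K)ˣ) : KInf K) * ((((X' ^ (-unipExp b) : (KInf K)ˣ) : KInf K) *
      ofPlaces fun w => 2 * (chPlace s w * shPlace s w))) := by
      rw [← hrr, ← mul_assoc, ← mul_assoc, ← Units.val_mul, ← Units.val_mul]
      congr 2
      have : (2 : ℤ) = unipSign b * unipExp b := by cases b <;> rfl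
      rw [this, _root_.zpow_mul, ← _root_.mul_zpow, hβ]
      rw [mul_comm (X'⁻¹ * _) X', mul_inv_cancel_left, _root_.mul_zpow, _root_.zpow_neg (radUnit s ^ unipSign b)]
      rw [mul_right_comm, inv_mul_cancel, one_mul]
    rw [hks, hDelta_eq, mul_assoc k, mul_assoc (hDiag (radUnit s ^ unipSign b)), unip_mul_hDiag, h2,
      mul_assoc (hDiag X'), unip_mul_hDiag, ← mul_assoc (hDiag (radUnit s ^ unipSign b)),
      ← map_mul, h1, map_mul, mul_assoc (hDiag X')]
  have hinv := integral_mEps_hDiag_smul (Γ := Γ) ε hβ1 (φ := fun y => φ ((hDiag X' * unip b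
    (((X' ^ (-unipExp b) : (KInf K)ˣ) : KInf K) * ofPlaces fun w => 2 * (chPlace s w * shPlace s w))) • y))
    (hφ.comp (continuous_const_smul _)) (fun y => hS₀ _)
  rw [← hinv, f, ← ht, hdec]
  refine integral_congr_ae (Filter.Eventually.of_forall fun y => ?_)
  change φ _ = φ _
  rw [mul_smul, hK k hk, mul_smul]

end Decomposition

section Lipschitz

open scoped Classical
open NumberField.mixedEmbedding

variable {K : Type*} [Field K] [NumberField K] {Γ : Subgroup SL(2, K)}

/-- Right multiplication by `g`, on the vector space of matrices. -/
noncomputable def rightMul (g : GInf K) : (Fin 2 → Fin 2 → KInf K) →L[ℝ] (Fin 2 → Fin 2 → KInf K) :=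
  LinearMap.toContinuousLinearMap
    { toFun := fun M i j => (Matrix.of M * g.1) i j
      map_add' := fun M N => by funext i j; simp [Matrix.mul_apply, add_mul]; ring
      map_smul' := fun c M => by funext i j; simp [Matrix.mul_apply] }

/-- The orbits of a one-parameter group have constant velocity. -/
theorem distG_le (B : LinearMap.BilinForm ℝ (Matrix (Fin 2) (Fin 2) (KInf K))) {P : ℝ → GInf K}
    {X : Matrix (Fin 2) (Fin 2) (KInf K)} (hP : ContDiff ℝ 1 fun s => entries (P s))
    (hd : ∀ s, HasDerivAt (fun s => entries (P s)) (fun i j => (X * (P s).1) i j) s) (h0 : P 0 = 1) (g : GInf K) :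
    distG B g (P 1 * g) ≤ ENNReal.ofReal √(B X X) := by
  have hγ : ContDiff ℝ 1 (fun s => entries (P s * g)) := (rightMul g).contDiff.comp hP
  have hγd : ∀ s, HasDerivAt (fun s => entries (P s * g)) (fun i j => (X * (P s * g : GInf K).1) i j) s := by
    intro s
    have h1 := (rightMul g).hasFDerivAt.comp_hasDerivAt s (hd s)
    have h2 : rightMul g (fun i j => (X * (P s).1) i j) = fun i j => (X * (P s * g : GInf K).1) i j := by
      rw [val_mk_mul, ← Matrix.mul_assoc]; rfl
    rw [h2] at h1
    exact h1
  refine (iInf_le _ ⟨fun s => P s * g, hγ, (congrArg (· * g) h0).trans (one_mul g), rfl⟩).trans ?_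
  have hv : ∀ s, velocity (fun s => P s * g) s = X := by
    intro s
    rw [velocity, (hγd s).deriv]
    change X * (P s * g : GInf K).1 * ((P s * g)⁻¹ : GInf K).1 = X
    rw [Matrix.mul_assoc, ← val_mk_mul, mul_inv_cancel]
    exact Matrix.mul_one X
  simp only [hv]
  rw [setLIntegral_const, Real.volume_Icc]
  simp

theorem abs_sub_le_of_distY_le (B : LinearMap.BilinForm ℝ (Matrix (Fin 2) (Fin 2) (KInf K))) {φ : Y Γ → ℝ}
    (hL : lipConst B φ ≠ ⊤) {y y' : Y Γ} {D : ℝ} (hD : 0 ≤ D) (h : distY B y y' ≤ ENNReal.ofReal D) :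
    |φ y - φ y'| ≤ (lipConst B φ).toReal * D := by
  have h1 : ENNReal.ofReal |φ y - φ y'| / distY B y y' ≤ lipConst B φ :=
    le_iSup₂ (f := fun y y' => ENNReal.ofReal |φ y - φ y'| / distY B y y') y y'
  rw [ENNReal.div_le_iff_le_mul (Or.inr hL) (Or.inl (h.trans_lt ENNReal.ofReal_lt_top).ne)] at h1
  have h2 := h1.trans (mul_le_mul_right h (lipConst B φ))
  rw [← ENNReal.ofReal_toReal hL, ← ENNReal.ofReal_mul ENNReal.toReal_nonneg] at h2
  exact (ENNReal.ofReal_le_ofReal_iff (mul_nonneg ENNReal.toReal_nonneg hD)).1 h2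

theorem abs_sub_le_of_oneParameter (B : LinearMap.BilinForm ℝ (Matrix (Fin 2) (Fin 2) (KInf K))) {φ : Y Γ → ℝ}
    (hL : lipConst B φ ≠ ⊤) {P : ℝ → GInf K} {X : Matrix (Fin 2) (Fin 2) (KInf K)}
    (hP : ContDiff ℝ 1 fun s => entries (P s))
    (hd : ∀ s, HasDerivAt (fun s => entries (P s)) (fun i j => (X * (P s).1) i j) s) (h0 : P 0 = 1) (y : Y Γ) :
    |φ (P 1 • y) - φ y| ≤ (lipConst B φ).toReal * √(B X X) := by
  obtain ⟨g, rfl⟩ : ∃ g, toY Γ g = y := QuotientGroup.mk_surjective y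
  rw [abs_sub_comm]
  refine abs_sub_le_of_distY_le B hL (Real.sqrt_nonneg _) ?_
  exact (iInf_le _ ⟨(g, P 1 * g), rfl, rfl⟩).trans (distG_le B hP hd h0 g)

theorem exists_sqrt_bilin_le (B : LinearMap.BilinForm ℝ (Matrix (Fin 2) (Fin 2) (KInf K)))
    (N : KInf K →ₗ[ℝ] Matrix (Fin 2) (Fin 2) (KInf K)) : ∃ C : ℝ, 0 ≤ C ∧ ∀ r, √(B (N r) (N r)) ≤ C * ‖r‖ := by
  obtain ⟨c, hc⟩ : ∃ c : ℝ, ∀ r, B (N r) (N r) ≤ c * ‖r‖ ^ 2 := by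
    refine ⟨‖(B.compl₁₂ N N).toContinuousBilinearMap‖, fun r => ?_⟩
    rw [pow_two, ← mul_assoc]
    exact (le_abs_self _).trans ((B.compl₁₂ N N).toContinuousBilinearMap.le_opNorm₂ r r)
  refine ⟨√c, Real.sqrt_nonneg _, fun r => ?_⟩
  calc √(B (N r) (N r)) ≤ √(c * ‖r‖ ^ 2) := Real.sqrt_le_sqrt (hc r)
    _ = √c * ‖r‖ := by rw [Real.sqrt_mul' _ (sq_nonneg _), Real.sqrt_sq (norm_nonneg _)]

/-- The Lie algebra of `unipGroup K b`. -/
noncomputable def unipLie (b : Bool) : KInf K →ₗ[ℝ] Matrix (Fin 2) (Fin 2) (KInf K) where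
  toFun r := bif b then !![0, r; 0, 0] else !![0, 0; r, 0]
  map_add' r r' := by cases b <;> (ext1 i j; fin_cases i <;> fin_cases j <;> simp)
  map_smul' c r := by cases b <;> (ext1 i j; fin_cases i <;> fin_cases j <;> simp)

variable (K) in
/-- The Lie algebra of `H`. -/
noncomputable def diagLie : KInf K →ₗ[ℝ] Matrix (Fin 2) (Fin 2) (KInf K) where
  toFun r := !![r, 0; 0, -r]
  map_add' r r' := by ext1 i j; fin_cases i <;> fin_cases j <;> simp [add_comm]
  map_smul' c r := by ext1 i j; fin_cases i <;> fin_cases j <;> simp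

theorem hasDerivAt_expU_smul (ζ : KInf K) (s : ℝ) :
    HasDerivAt (fun s : ℝ => (expU (s • ζ) : KInf K)) (ζ * expU (s • ζ)) s := by
  refine HasDerivAt.prodMk (f₁ := fun s : ℝ => (expU (s • ζ) : KInf K).1)
    (f₂ := fun s : ℝ => (expU (s • ζ) : KInf K).2) ?_ ?_
  · refine hasDerivAt_pi.2 fun w => ?_
    have := ((hasDerivAt_id s).mul_const (ζ.1 w)).exp
    refine this.congr_deriv ?_
    change _ = ζ.1 w * Real.exp (s * ζ.1 w)
    simp [mul_comm]
  · refine hasDerivAt_pi.2 fun w => ?_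
    have := (((hasDerivAt_id s).smul_const (ζ.2 w))).cexp
    refine this.congr_deriv ?_
    change _ = ζ.2 w * Complex.exp (s • ζ.2 w)
    simp [mul_comm]

theorem contDiff_expU_smul (ζ : KInf K) : ContDiff ℝ 1 fun s : ℝ => (expU (s • ζ) : KInf K) := by
  refine contDiff_one_iff_deriv.2 ⟨fun s => (hasDerivAt_expU_smul ζ s).differentiableAt, ?_⟩
  rw [funext fun s => (hasDerivAt_expU_smul ζ s).deriv]
  refine continuous_const.mul ((Units.continuous_val (M := KInf K)).comp (continuous_expU.comp ?_))
  exact continuous_id.smul continuous_const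

theorem exists_abs_unip_smul_sub_le (B : LinearMap.BilinForm ℝ (Matrix (Fin 2) (Fin 2) (KInf K))) (b : Bool) :
    ∃ C : ℝ, 0 ≤ C ∧ ∀ φ : Y Γ → ℝ, lipConst B φ ≠ ⊤ → ∀ (r : KInf K) (y : Y Γ),
      |φ (unip b r • y) - φ y| ≤ (lipConst B φ).toReal * (C * ‖r‖) := by
  obtain ⟨C, hC, hB⟩ := exists_sqrt_bilin_le B (unipLie b)
  refine ⟨C, hC, fun φ hL r y => ?_⟩
  have hder : ∀ s : ℝ, HasDerivAt (fun s : ℝ => s • r) r s := fun s => by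
    simpa using (hasDerivAt_id s).smul_const r
  have key := abs_sub_le_of_oneParameter (Γ := Γ) B hL (P := fun s => unip b (s • r)) (X := unipLie b r) ?_ ?_ ?_ y
  · rw [one_smul] at key
    exact key.trans (mul_le_mul_of_nonneg_left (hB r) ENNReal.toReal_nonneg)
  · refine contDiff_pi.2 fun i => contDiff_pi.2 fun j => ?_
    cases b
    · change ContDiff ℝ 1 fun s : ℝ => (!![1, 0; s • r, 1] : Matrix _ _ (KInf K)) i j
      fin_cases i <;> fin_cases j <;>
        first | exact contDiff_const | exact contDiff_id.smul contDiff_const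
    · change ContDiff ℝ 1 fun s : ℝ => (!![1, s • r; 0, 1] : Matrix _ _ (KInf K)) i j
      fin_cases i <;> fin_cases j <;>
        first | exact contDiff_const | exact contDiff_id.smul contDiff_const
  · intro s
    refine hasDerivAt_pi.2 fun i => hasDerivAt_pi.2 fun j => ?_
    cases b
    · change HasDerivAt (fun s : ℝ => (!![1, 0; s • r, 1] : Matrix _ _ (KInf K)) i j)
        ((!![0, 0; r, 0] * !![1, 0; s • r, 1] : Matrix _ _ (KInf K)) i j) s
      rw [Matrix.mul_fin_two]
      simp only [zero_mul, mul_zero, mul_one, add_zero]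
      fin_cases i <;> fin_cases j <;>
        first | exact hasDerivAt_const _ _ | exact hder s
    · change HasDerivAt (fun s : ℝ => (!![1, s • r; 0, 1] : Matrix _ _ (KInf K)) i j)
        ((!![0, r; 0, 0] * !![1, s • r; 0, 1] : Matrix _ _ (KInf K)) i j) s
      rw [Matrix.mul_fin_two]
      simp only [zero_mul, mul_zero, mul_one, add_zero, zero_add]
      fin_cases i <;> fin_cases j <;>
        first | exact hasDerivAt_const _ _ | exact hder s
  · rw [zero_smul, unip_zero]

theorem exists_abs_hDiag_smul_sub_le (B : LinearMap.BilinForm ℝ (Matrix (Fin 2) (Fin 2) (KInf K))) :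
    ∃ C : ℝ, 0 ≤ C ∧ ∀ φ : Y Γ → ℝ, lipConst B φ ≠ ⊤ → ∀ (ζ : KInf K) (y : Y Γ),
      |φ (hDiag (expU ζ) • y) - φ y| ≤ (lipConst B φ).toReal * (C * ‖ζ‖) := by
  obtain ⟨C, hC, hB⟩ := exists_sqrt_bilin_le B (diagLie K)
  refine ⟨C, hC, fun φ hL ζ y => ?_⟩
  have hneg : ∀ s : ℝ, (((expU (s • ζ))⁻¹ : (KInf K)ˣ) : KInf K) = expU (s • -ζ) := by
    intro s
    rw [← expU_neg, smul_neg]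
  have key := abs_sub_le_of_oneParameter (Γ := Γ) B hL (P := fun s => hDiag (expU (s • ζ))) (X := diagLie K ζ)
    ?_ ?_ ?_ y
  · rw [one_smul] at key
    exact key.trans (mul_le_mul_of_nonneg_left (hB ζ) ENNReal.toReal_nonneg)
  · refine contDiff_pi.2 fun i => contDiff_pi.2 fun j => ?_
    change ContDiff ℝ 1 fun s : ℝ => (!![(expU (s • ζ) : KInf K), 0; 0, (((expU (s • ζ))⁻¹ : (KInf K)ˣ) : KInf K)] :
      Matrix _ _ (KInf K)) i j
    simp only [hneg]
    fin_cases i <;> fin_cases j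
    · exact contDiff_expU_smul ζ
    · exact contDiff_const
    · exact contDiff_const
    · exact contDiff_expU_smul (-ζ)
  · intro s
    refine hasDerivAt_pi.2 fun i => hasDerivAt_pi.2 fun j => ?_
    change HasDerivAt (fun s : ℝ => (!![(expU (s • ζ) : KInf K), 0; 0, (((expU (s • ζ))⁻¹ : (KInf K)ˣ) : KInf K)] :
      Matrix _ _ (KInf K)) i j) ((!![ζ, 0; 0, -ζ] *
        !![(expU (s • ζ) : KInf K), 0; 0, (((expU (s • ζ))⁻¹ : (KInf K)ˣ) : KInf K)] : Matrix _ _ (KInf K)) i j) s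
    rw [Matrix.mul_fin_two]
    simp only [hneg, zero_mul, mul_zero, add_zero, zero_add]
    fin_cases i <;> fin_cases j
    · exact hasDerivAt_expU_smul ζ s
    · exact hasDerivAt_const _ _
    · exact hasDerivAt_const _ _
    · exact hasDerivAt_expU_smul (-ζ) s
  · rw [zero_smul, expU_zero, map_one]

theorem IsSmooth.continuous {φ : Y Γ → ℝ} (h : IsSmooth φ) : Continuous φ := by
  obtain ⟨F, hF, hφ⟩ := h
  have hq : Topology.IsQuotientMap (toY Γ) := QuotientGroup.isQuotientMap_mk (N := latticeOf Γ)
  refine hq.continuous_iff.2 ?_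
  have : φ ∘ toY Γ = fun g => F (entries g) := funext fun g => (hφ g).symm
  rw [this]
  refine hF.continuous.comp (continuous_pi fun i => continuous_pi fun j => ?_)
  exact (continuous_apply_apply i j).comp
    (Matrix.SpecialLinearGroup.isClosedEmbedding_val (n := Fin 2) (R := KInf K)).continuous

theorem exists_abs_le_of_support_subset {φ : Y Γ → ℝ} (h : Continuous φ) {𝒞 : Set (Y Γ)} (h𝒞 : IsCompact 𝒞)
    (hs : Function.support φ ⊆ 𝒞) : ∃ S₀ : ℝ, ∀ y, |φ y| ≤ S₀ := by
  obtain ⟨S, hS⟩ := h𝒞.exists_bound_of_continuousOn h.continuousOn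
  refine ⟨max S 0, fun y => ?_⟩
  by_cases hy : y ∈ 𝒞
  · exact (hS y hy).trans (le_max_left _ _)
  · rw [Function.notMem_support.1 fun h' => hy (hs h'), abs_zero]
    exact le_max_right _ _

end Lipschitz

section CuspEstimate

open scoped Classical
open NumberField.mixedEmbedding

variable {K : Type*} [Field K] [NumberField K] {Γ : Subgroup SL(2, K)} {b : Bool}

/-- Optimization of the two bounds for the distance to the boundary values. -/
theorem le_exp_of_cusp_bounds {q u v E C : ℝ} (hq : 0 < q) (hq1 : q ≤ 1) (hC : 0 ≤ C) (huv : u ≤ v)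
    (hu : -(q / 48) * v < u) (h1 : E ≤ C * Real.exp (-2 * q * u))
    (h2 : 2 ≤ Real.exp (q * (v - u)) → 1 ≤ Real.exp (q * (u + v)) / 2 →
      E ≤ C * (Real.exp (-2 * q * u) + 1) * (Real.exp (q * (u + v)) / 2) ^ (-(q / 6))) :
    E ≤ 32 * C * Real.exp (-(q ^ 2 / 24) * v) := by
  have hv : 0 < v := by
    by_contra hv
    have : 0 ≤ -(q / 48) * v := by nlinarith
    linarith
  have he : (2 : ℝ) ≤ Real.exp 1 := by linarith [Real.add_one_le_exp (1 : ℝ)]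
  have hqv : 0 < q * v := mul_pos hq hv
  have hqq : q ^ 2 * v ≤ q * v := by nlinarith
  have hquv : -2 * q * u ≤ q ^ 2 / 24 * v := by nlinarith
  have hone : ∀ t : ℝ, t ≤ 1 → Real.exp t ≤ 3 := fun t ht =>
    (Real.exp_le_exp.2 ht).trans (by linarith [Real.exp_one_lt_d9])
  by_cases hc1 : q * v ≤ 2
  · refine h1.trans ?_
    have h3 : Real.exp (-2 * q * u) ≤ 32 * Real.exp (-(q ^ 2 / 24) * v) := by
      have h4 : Real.exp (-2 * q * u) = Real.exp (-2 * q * u + q ^ 2 / 24 * v) * Real.exp (-(q ^ 2 / 24) * v) := by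
        rw [← Real.exp_add]; congr 1; ring
      rw [h4]
      refine mul_le_mul_of_nonneg_right ((hone _ ?_).trans (by norm_num)) (Real.exp_pos _).le
      linarith
    calc C * Real.exp (-2 * q * u) ≤ C * (32 * Real.exp (-(q ^ 2 / 24) * v)) := by gcongr
      _ = _ := by ring
  push Not at hc1
  by_cases hc2 : v / 2 ≤ u
  · refine h1.trans ?_
    have h3 : Real.exp (-2 * q * u) ≤ Real.exp (-(q ^ 2 / 24) * v) := by
      refine Real.exp_le_exp.2 ?_
      nlinarith
    calc C * Real.exp (-2 * q * u) ≤ C * Real.exp (-(q ^ 2 / 24) * v) := by gcongr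
      _ ≤ 32 * C * Real.exp (-(q ^ 2 / 24) * v) := by
        refine mul_le_mul_of_nonneg_right (by linarith) (Real.exp_pos _).le
  push Not at hc2
  have h3 : 2 ≤ Real.exp (q * (v - u)) := he.trans (Real.exp_le_exp.2 (by nlinarith))
  have huv' : v / 2 ≤ u + v := by nlinarith
  have h4 : 1 ≤ Real.exp (q * (u + v)) / 2 := by
    have : Real.exp 1 ≤ Real.exp (q * (u + v)) := Real.exp_le_exp.2 (by nlinarith)
    linarith
  refine (h2 h3 h4).trans ?_
  have h5 : (Real.exp (q * (u + v)) / 2) ^ (-(q / 6)) ≤ 2 * Real.exp (-(q ^ 2 / 12) * v) := by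
    rw [Real.div_rpow (Real.exp_pos _).le zero_le_two, ← Real.exp_mul, div_eq_mul_inv, mul_comm,
      ← Real.rpow_neg zero_le_two, neg_neg]
    refine mul_le_mul ?_ (Real.exp_le_exp.2 ?_) (Real.exp_pos _).le zero_le_two
    · calc (2 : ℝ) ^ (q / 6) ≤ 2 ^ (1 : ℝ) := Real.rpow_le_rpow_of_exponent_le one_le_two (by linarith)
        _ = 2 := Real.rpow_one 2
    · have : q ^ 2 * (v / 2) ≤ q ^ 2 * (u + v) := mul_le_mul_of_nonneg_left huv' (sq_nonneg q)
      nlinarith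
  have h6 : Real.exp (-2 * q * u) + 1 ≤ 2 * Real.exp (q ^ 2 / 24 * v) := by
    have h7 := Real.exp_le_exp.2 hquv
    have h8 : 1 ≤ Real.exp (q ^ 2 / 24 * v) := Real.one_le_exp (by positivity)
    linarith
  calc C * (Real.exp (-2 * q * u) + 1) * (Real.exp (q * (u + v)) / 2) ^ (-(q / 6))
      ≤ C * (2 * Real.exp (q ^ 2 / 24 * v)) * (2 * Real.exp (-(q ^ 2 / 12) * v)) := by gcongr
    _ = 4 * C * (Real.exp (q ^ 2 / 24 * v) * Real.exp (-(q ^ 2 / 12) * v)) := by ring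
    _ = 4 * C * Real.exp (-(q ^ 2 / 24) * v) := by rw [← Real.exp_add]; congr 2; ring
    _ ≤ 32 * C * Real.exp (-(q ^ 2 / 24) * v) :=
      mul_le_mul_of_nonneg_right (by linarith) (Real.exp_pos _).le

theorem one_le_norm_radUnit (s : InfinitePlace K → PosReal) : 1 ≤ mixedEmbedding.norm (radUnit s : KInf K) := by
  rw [mixedEmbedding.norm_apply]
  refine Finset.one_le_prod fun w _ => ?_
  rw [normAtPlace_radUnit]
  exact one_le_pow₀ (one_le_radPlace s w)

theorem exists_le_sq_radPlace (s : InfinitePlace K → PosReal) {Q : ℝ}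
    (hQ : Q ^ Module.finrank ℚ K ≤ mixedEmbedding.norm (radUnit s : KInf K) ^ 2) : ∃ w, Q ≤ radPlace s w ^ 2 := by
  by_contra! h
  refine absurd hQ (not_le.2 ?_)
  rw [mixedEmbedding.norm_apply, ← InfinitePlace.sum_mult_eq, ← Finset.prod_pow_eq_pow_sum, ← Finset.prod_pow]
  refine Finset.prod_lt_prod_of_nonempty (fun w _ => ?_) (fun w _ => ?_) Finset.univ_nonempty
  · rw [normAtPlace_radUnit]
    have := one_le_radPlace s w
    positivity
  · rw [normAtPlace_radUnit, ← pow_mul, mul_comm, pow_mul]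
    exact pow_lt_pow_left₀ (h w) (sq_nonneg _) w.mult_ne_zero

/-- The distance of `f` to its boundary values, near one of the two ends. -/
theorem exists_cusp_bound (hΓ : IsArithmetic Γ) (B : LinearMap.BilinForm ℝ (Matrix (Fin 2) (Fin 2) (KInf K)))
    (b : Bool) {ε : ℝ} (hε1 : ε < 1) :
    ∃ C : ℝ, 0 ≤ C ∧ ∀ φ : Y Γ → ℝ, Continuous φ → ∀ S₀ : ℝ, (∀ y, |φ y| ≤ S₀) → IsK0Invariant φ →
      lipConst B φ ≠ ⊤ → ∀ (x₁ x₂ : PosReal) (s : InfinitePlace K → PosReal) (x y X : PosReal),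
      (x : ℝ)⁻¹ * (y : ℝ)⁻¹ = norm1 (aMat s) ^ 2 →
      (X : ℝ) ^ Module.finrank ℚ K = norm1 (aMat s) ^ unipSign b * (x₁ * norm1 (aMat s))⁻¹ →
      (X : ℝ) ^ unipExp b = (x : ℝ) ^ (-2 * (1 / (Module.finrank ℚ K : ℝ))) →
      (y : ℝ) ^ (1 / (Module.finrank ℚ K : ℝ) / 48) < x →
      |f Γ ε φ x₁ x₂ s - ∫ y, φ (hDelta (K := K) X • y) ∂(mEpsUnip Γ (unipGroup K b) ε)| ≤
        C * (lipConst B φ).toReal * (y : ℝ) ^ ((1 / (Module.finrank ℚ K : ℝ)) ^ 2 / 24) := by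
  obtain ⟨C₀, hC₀, hbound⟩ := exists_orbit_bound hΓ b hε1
  obtain ⟨C₁, hC₁, hU⟩ := exists_abs_unip_smul_sub_le (Γ := Γ) B b
  obtain ⟨C₂, hC₂, hH⟩ := exists_abs_hDiag_smul_sub_le (Γ := Γ) B
  refine ⟨32 * (C₀ * (C₁ + C₂)), by positivity, ?_⟩
  intro φ hφ S₀ hS₀ hK hL x₁ x₂ s x y X hxy hXl hXk hδ
  have hl : 0 < Module.finrank ℚ K := Module.finrank_pos
  have hl1 : (1 : ℝ) ≤ Module.finrank ℚ K := by exact_mod_cast hl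
  set l : ℝ := (Module.finrank ℚ K : ℝ) with hldef
  set q : ℝ := 1 / l with hq
  have hq0 : 0 < q := by positivity
  have hq1 : q ≤ 1 := by rw [hq, div_le_one (by linarith)]; exact hl1
  set u := Real.log x with hu
  set v := -Real.log y with hv
  have hxu : (x : ℝ) = Real.exp u := (Real.exp_log x.2).symm
  have hyv : (y : ℝ) = Real.exp (-v) := by rw [hv, neg_neg, Real.exp_log y.2]
  set A := (lipConst B φ).toReal * (C₁ + C₂) with hA
  have hLr : 0 ≤ (lipConst B φ).toReal := ENNReal.toReal_nonneg
  have hA0 : 0 ≤ A := by positivity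
  rw [hxu, hyv, ← Real.exp_neg, ← Real.exp_neg, ← Real.exp_add] at hxy
  have hN : 1 ≤ norm1 (aMat s) := by rw [norm1_aMat]; exact one_le_norm_radUnit s
  have huv : u ≤ v := by
    have h1 : (1 : ℝ) ≤ norm1 (aMat s) ^ 2 := one_le_pow₀ hN
    rw [← hxy, Real.one_le_exp_iff] at h1
    linarith
  have hu' : -(q / 48) * v < u := by
    rw [hxu, hyv, ← Real.exp_mul, Real.exp_lt_exp] at hδ
    linarith
  have hT : (X : ℝ) ^ unipExp b = Real.exp (-2 * q * u) := by
    rw [hXk, hxu, ← Real.exp_mul]; congr 1; ring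
  have hTw : ∀ w, normAtPlace w ((scalarUnit X ^ unipExp b : (KInf K)ˣ) : KInf K) ≤ Real.exp (-2 * q * u) := by
    intro w
    rw [normAtPlace_unit_zpow, normAtPlace_scalarUnit, hT]
  set R : KInf K := ((scalarUnit X ^ (-unipExp b) : (KInf K)ˣ) : KInf K) *
    ofPlaces fun w => 2 * (chPlace s w * shPlace s w) with hR
  obtain ⟨e1, e2⟩ := hbound φ hφ S₀ hS₀ A hA0
    (fun r z => (hU φ hL r z).trans (by
      rw [hA, mul_assoc]
      exact mul_le_mul_of_nonneg_left (mul_le_mul_of_nonneg_right (by linarith) (norm_nonneg _)) hLr))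
    (fun r z => (hH φ hL r z).trans (by
      rw [hA, mul_assoc]
      exact mul_le_mul_of_nonneg_left (mul_le_mul_of_nonneg_right (by linarith) (norm_nonneg _)) hLr))
    (scalarUnit X) (Real.exp (-2 * q * u)) hTw R
  rw [← f_eq_integral b ε hφ hS₀ hK x₁ x₂ X s hXl] at e1 e2
  rw [hDelta_eq]
  set E := |f Γ ε φ x₁ x₂ s - ∫ z : Y Γ, φ ((hDiag (scalarUnit X) : GInf K) • z) ∂(mEpsUnip Γ (unipGroup K b) ε)| with hE
  have key : E ≤ 32 * (C₀ * A) * Real.exp (-(q ^ 2 / 24) * v) := by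
    refine le_exp_of_cusp_bounds hq0 hq1 (by positivity) huv hu' (by rw [mul_assoc]; exact e1) fun h3 h4 => ?_
    obtain ⟨w, hw⟩ := exists_le_sq_radPlace s (Q := Real.exp (q * (v - u))) (by
      rw [← norm1_aMat, ← hxy, ← Real.exp_nat_mul, ← hldef, hq]
      refine Real.exp_le_exp.2 (le_of_eq ?_)
      field_simp
      ring)
    have hRw : Real.exp (q * (u + v)) / 2 ≤ normAtPlace w R := by
      have h5 := half_sq_radPlace_le s w (h3.trans hw)
      rw [hR, map_mul, normAtPlace_ofPlaces, normAtPlace_unit_zpow, normAtPlace_scalarUnit, _root_.zpow_neg, hT,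
        ← Real.exp_neg]
      calc Real.exp (q * (u + v)) / 2 = Real.exp (-(-2 * q * u)) * (Real.exp (q * (v - u)) / 2) := by
            rw [mul_div_assoc', ← Real.exp_add]; congr 2; ring
        _ ≤ _ := by
          refine mul_le_mul_of_nonneg_left ?_ (Real.exp_pos _).le
          linarith
    refine (e2 w (h4.trans hRw)).trans ?_
    have h6 : normAtPlace w R ^ (-(1 / (6 * l))) ≤ (Real.exp (q * (u + v)) / 2) ^ (-(q / 6)) := by
      have : 1 / (6 * l) = q / 6 := by rw [hq]; field_simp
      rw [this]
      exact Real.rpow_le_rpow_of_nonpos (by linarith) hRw (by linarith)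
    calc C₀ * (A * Real.exp (-2 * q * u) + A) * normAtPlace w R ^ (-(1 / (6 * l)))
        ≤ C₀ * (A * Real.exp (-2 * q * u) + A) * (Real.exp (q * (u + v)) / 2) ^ (-(q / 6)) := by gcongr
      _ = _ := by ring
  refine key.trans (le_of_eq ?_)
  rw [hyv, ← Real.exp_mul, hA]
  have : -v * (q ^ 2 / 24) = -(q ^ 2 / 24) * v := by ring
  rw [this]
  ring

end CuspEstimate

end AffineQuadric

open AffineQuadric in
theorem proposition2p3 {K : Type*} [Field K] [NumberField K]
    (Γ : Subgroup (Matrix.SpecialLinearGroup (Fin 2) K)) (hΓ : AffineQuadric.IsArithmetic Γ)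
    (B : LinearMap.BilinForm ℝ (Matrix (Fin 2) (Fin 2) (AffineQuadric.KInf K)))
    (hBsymm : ∀ X Z, B X Z = B Z X) (hBpos : ∀ X, X ≠ 0 → 0 < B X X)
    (ε : ℝ) (hε : 0 < ε) (hε1 : ε < 1) (hinj : AffineQuadric.BoxInjective Γ ε) :
    ∃ δ ∈ Set.Ioo (0 : ℝ) (1 / 2), ∃ δ' ∈ Set.Ioo (0 : ℝ) (1 / 2),
      ∀ 𝒞 : Set (AffineQuadric.Y Γ), IsCompact 𝒞 →
        ∃ C : ℝ, 1 < C ∧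
          ∀ φ : AffineQuadric.Y Γ → ℝ, AffineQuadric.IsSmooth φ → AffineQuadric.IsK0Invariant φ →
            Function.support φ ⊆ 𝒞 →
            ∀ (x₁ x₂ : AffineQuadric.PosReal) (s : InfinitePlace K → AffineQuadric.PosReal),
              (x₁, x₂, s) ∈ AffineQuadric.N0 K →
              ((x₂ : ℝ) ^ δ < x₁ →
                ENNReal.ofReal
                    |AffineQuadric.f Γ ε φ x₁ x₂ s - AffineQuadric.fBdry1 Γ ε φ x₁| ≤
                  ENNReal.ofReal C * AffineQuadric.lipConst B φ *
                    ENNReal.ofReal ((x₂ : ℝ) ^ δ')) ∧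
              ((x₁ : ℝ) ^ δ < x₂ →
                ENNReal.ofReal
                    |AffineQuadric.f Γ ε φ x₁ x₂ s - AffineQuadric.fBdry2 Γ ε φ x₂| ≤
                  ENNReal.ofReal C * AffineQuadric.lipConst B φ *
                    ENNReal.ofReal ((x₁ : ℝ) ^ δ')) := by
  obtain ⟨C₁, hC₁, h1⟩ := exists_cusp_bound hΓ B true hε1
  obtain ⟨C₂, hC₂, h2⟩ := exists_cusp_bound hΓ B false hε1
  have hl1 : (1 : ℝ) ≤ Module.finrank ℚ K := by exact_mod_cast (Module.finrank_pos (R := ℚ) (M := K))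
  have hl0 : (Module.finrank ℚ K : ℝ) ≠ 0 := by positivity
  have hq0 : 0 < 1 / (Module.finrank ℚ K : ℝ) := by positivity
  have hq1 : 1 / (Module.finrank ℚ K : ℝ) ≤ 1 := (div_le_one (by linarith)).2 hl1
  refine ⟨1 / (Module.finrank ℚ K : ℝ) / 48, ⟨by positivity, by linarith⟩,
    (1 / (Module.finrank ℚ K : ℝ)) ^ 2 / 24, ⟨by positivity, by nlinarith⟩, fun 𝒞 h𝒞 => ?_⟩
  refine ⟨C₁ + C₂ + 2, by linarith, fun φ hφ hK hs x₁ x₂ s hN => ?_⟩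
  have hφc := hφ.continuous
  obtain ⟨S₀, hS₀⟩ := exists_abs_le_of_support_subset hφc h𝒞 hs
  by_cases hL : lipConst B φ = ⊤
  · have hC : ENNReal.ofReal (C₁ + C₂ + 2) ≠ 0 := (ENNReal.ofReal_pos.2 (by linarith)).ne'
    have htop : ∀ x : PosReal, ENNReal.ofReal (C₁ + C₂ + 2) * lipConst B φ *
        ENNReal.ofReal ((x : ℝ) ^ ((1 / (Module.finrank ℚ K : ℝ)) ^ 2 / 24)) = ⊤ := by
      intro x
      rw [hL, ENNReal.mul_top hC, ENNReal.top_mul (ENNReal.ofReal_pos.2 (Real.rpow_pos_of_pos x.2 _)).ne']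
    exact ⟨fun _ => (htop x₂).symm ▸ le_top, fun _ => (htop x₁).symm ▸ le_top⟩
  have hlip : ∀ {E C r : ℝ}, C ≤ C₁ + C₂ + 2 → 0 ≤ r → E ≤ C * (lipConst B φ).toReal * r →
      ENNReal.ofReal E ≤ ENNReal.ofReal (C₁ + C₂ + 2) * lipConst B φ * ENNReal.ofReal r := by
    intro E C r hC hr hE
    rw [← ENNReal.ofReal_toReal hL, ← ENNReal.ofReal_mul (by linarith), ← ENNReal.ofReal_mul (by positivity)]
    refine ENNReal.ofReal_le_ofReal (hE.trans ?_)
    gcongr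
  have hN' : (x₁ : ℝ)⁻¹ * (x₂ : ℝ)⁻¹ = norm1 (aMat s) ^ 2 := by
    have h : (x₁ : ℝ)⁻¹ * (x₂ : ℝ)⁻¹ = norm1 (aMat s) * norm2 (aMat s) := hN
    rw [h, norm2_aMat, ← norm1_aMat, pow_two]
  have hpos := norm1_aMat_pos s
  have hx₁ := x₁.2
  have hx₂ := x₂.2
  constructor
  · intro hδ
    refine hlip (C := C₁) (by linarith) (Real.rpow_nonneg hx₂.le _) ?_
    refine h1 φ hφc S₀ hS₀ hK hL x₁ x₂ s x₁ x₂
      ⟨(x₁ : ℝ) ^ (-(1 : ℝ) / Module.finrank ℚ K), Real.rpow_pos_of_pos x₁.2 _⟩ hN' ?_ ?_ hδ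
    · change ((x₁ : ℝ) ^ (-(1 : ℝ) / Module.finrank ℚ K)) ^ Module.finrank ℚ K = norm1 (aMat s) ^ (1 : ℤ) * _
      rw [← Real.rpow_natCast, ← Real.rpow_mul hx₁.le, div_mul_cancel₀ _ hl0, Real.rpow_neg_one, zpow_one]
      field_simp
    · change ((x₁ : ℝ) ^ (-(1 : ℝ) / Module.finrank ℚ K)) ^ (2 : ℤ) = _
      rw [← Real.rpow_intCast, ← Real.rpow_mul hx₁.le]
      congr 1
      push_cast
      ring
  · intro hδ
    refine hlip (C := C₂) (by linarith) (Real.rpow_nonneg hx₁.le _) ?_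
    refine h2 φ hφc S₀ hS₀ hK hL x₁ x₂ s x₂ x₁
      ⟨(x₂ : ℝ) ^ ((1 : ℝ) / Module.finrank ℚ K), Real.rpow_pos_of_pos x₂.2 _⟩ ((mul_comm _ _).trans hN') ?_ ?_ hδ
    · change ((x₂ : ℝ) ^ ((1 : ℝ) / Module.finrank ℚ K)) ^ Module.finrank ℚ K = norm1 (aMat s) ^ (-1 : ℤ) * _
      rw [← Real.rpow_natCast, ← Real.rpow_mul hx₂.le, div_mul_cancel₀ _ hl0, Real.rpow_one,
        _root_.zpow_neg_one, mul_inv]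
      have : (norm1 (aMat s))⁻¹ * ((x₁ : ℝ)⁻¹ * (norm1 (aMat s))⁻¹) = (x₁ : ℝ)⁻¹ * (norm1 (aMat s) ^ 2)⁻¹ := by
        rw [pow_two, mul_inv]; ring
      rw [this, ← hN']
      field_simp
    · change ((x₂ : ℝ) ^ ((1 : ℝ) / Module.finrank ℚ K)) ^ (-2 : ℤ) = _
      rw [← Real.rpow_intCast, ← Real.rpow_mul hx₂.le]
      congr 1
      push_cast
      ring
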